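/- Let $p_+,p_-\ge 2$ be coprime integers, $N=p_+p_-$, $\mathbb H^{\pm}=\{\pm\operatorname{Im}\tau>0\}$, and let $\mathcal T=\{(r,s): 1\le r<p_+,\ 1\le s<p_-,\ sp_+>rp_-\}$ be the Kac table. Write $q=e^{2\pi i\tau}$, and let $\eta$ be the Dedekind eta function. Put $\alpha_+=\sqrt{2p_- /p_+}$, $\alpha_-=-\sqrt{2p_+/p_-}$, $\alpha_0=\alpha_++\alpha_-$, $\alpha_{r,s;n}=\frac{1-r}2\alpha_++\frac{1-s}2\alpha_-+\frac n2\sqrt{2N}$, and let $\mathrm{ch}[\mathcal F_{r,s;n}]=q^{(\alpha_{r,s;n}-\alpha_0/2)^2/2}/\eta(\tau)$ be the character of the corresponding Fock module. The characters of the minimal model module $\mathcal L_{r,s}$ and of the atypical $(p_+,p_-)$-singlet module $\mathcal I_{r,s;0}$ are given by $$\mathrm{ch}[\mathcal L_{r,s}]=\sum_{k\in\mathbb Z}\big(\mathrm{ch}[\mathcal F_{r,s;2k}]-\mathrm{ch}[\mathcal F_{p_+-r,s;2k+1}]\big),$$ $$\mathrm{ch}[\mathcal I_{r,s;0}]=\sum_{k\ge0}(k+1)\big(\mathrm{ch}[\mathcal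 F_{p_+-r,s;-2k-1}]+\mathrm{ch}[\mathcal F_{r,p_--s;-2k-3}]-\mathrm{ch}[\mathcal F_{r,s;-2k-2}]-\mathrm{ch}[\mathcal F_{p_+-r,p_--s;-2k-2}]\big).$$ With $P_b(\tau)=\sum_{k\ge0}q^{N(k+b/2N)^2}$, $b=p_+s+p_-r$ and $b'=p_+s-p_-r$, define the modified characters, for $(r,s)\in\mathcal T$ and $\tau\in\mathbb H^+$, by $$\tilde\chi_{r,s}=\eta\,\mathrm{ch}[\mathcal I_{r,s;0}]-\Big(\tfrac{b'}{2N}\,(P_{b'}-P_{2N-b'})-\tfrac{b}{2N}\,(P_{b}-P_{2N-b})\Big),$$ that is, $\tilde\chi_{r,s}=\sum_{m\in\mathbb Z}\big(|m+\tfrac b{2N}|\,q^{N(m+b/2N)^2}-|m+\tfrac{b'}{2N}|\,q^{N(m+b'/2N)^2}\big)$. Let $\mathbf f=(\eta\,\mathrm{ch}[\mathcal L_{r,s}])_{(r,s)\in\mathcal T}$, let $\mathbf{SM}=\mathbf{SM}(p_+,p_-)$ be the $S$-matrix of the $(p_+,p_-)$ Virasoro minimal model, $$\mathbf{SM}_{(r,s),(r',s')}=(-1)^{(r+s)(r'+s')}\sqrt{\tfrac8{p_+p_-}}\,\sin\Big(\tfrac{\pi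 rr'(p_--p_+)}{p_+}\Big)\sin\Big(\tfrac{\pi ss'(p_--p_+)}{p_-}\Big),$$ and put $$\mathbf G^*(w)=\frac{\sqrt{2i}}{4\pi\sqrt{p_+p_-}}\int_{\bar w}^{i\infty}\frac{\mathbf f(z)}{(z-w)^{3/2}}\,dz\quad(w\in\mathbb H^-),\qquad g(w)=\frac{\sqrt{2i}}{4\pi\sqrt{p_+p_-}}\int_0^{i\infty}\frac{\mathbf f(u)}{(u-w)^{3/2}}\,du\quad(w\in\mathbb C\setminus i[0,\infty)),$$ where the first integral is along the vertical ray and the second along the imaginary axis, $(z-w)^{3/2}$ is the principal branch, and in $g$ the power $(\cdot)^{3/2}$ is the branch on $\mathbb C\setminus(-i)[0,\infty)$ that is positive on $(0,\infty)$. All these integrals converge absolutely. Then there is a function $\mathbf G:\mathbb H^+\cup\mathbb H^-\cup\mathbb Q\to\mathbb C^{\mathcal T}$ with $\mathbf G=(\tilde\chi_{r,s})$ on $\mathbb H^+$ and $\mathbf G=\mathbf G^*$ on $\mathbb H^-$ such that the following hold. (1) For every $x\in\mathbb Q$ the limits of $\mathbf G(x+it)$ and $\mathbf G(x-it)$ as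 $t\to0^+$ exist, equal $\mathbf G(x)$, and agree to all orders: there are $a_m\in\mathbb C^{\mathcal T}$ with $a_0=\mathbf G(x)$, $\mathbf G(x+it)\sim\sum_m a_mt^m$ and $\mathbf G(x-it)\sim\sum_ma_m(-t)^m$. (2) $\mathbf G|_{\mathbb Q}$ is a vector-valued quantum modular form of weight $\frac32$ with quantum set $\mathbb Q$. That is, there is a map $\rho:SL_2(\mathbb Z)\to GL(\mathbb C^{\mathcal T})$ for which the operators $(F|\gamma)(w)=(cw+d)^{-3/2}\rho(\gamma)F(\gamma w)$, $\gamma=\begin{pmatrix}a&b\\c&d\end{pmatrix}$, on functions on $\mathbb H^-$ (principal branch) satisfy $F|(\gamma_1\gamma_2)=(F|\gamma_1)|\gamma_2$, and for every $\gamma\in SL_2(\mathbb Z)$ the function $$x\mapsto \mathbf G(x)-(cx+d)^{-3/2}\rho(\gamma)\,\mathbf G\Big(\frac{ax+b}{cx+d}\Big),\qquad x\in\mathbb Q,\ cx+d\ne0,$$ extends to a $C^\infty$ function on $\mathbb R$ that is real-analytic where $cx+d\neq0$; here $(cx+d)^{3/2}$ is the boundary value from $\mathbb H^-$. Moreover $\rho\begin{pmatrix}0&-1\\1&0\end{pmatrix}=e^{\pi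 i/4}\,\mathbf{SM}$. (3) For all $w\in\mathbb H^+\cup\mathbb H^-\cup\mathbb Q$ with $w\notin i[0,\infty)$, with the principal branch of $(1/(wi))^{3/2}$, $$\Big(\frac1{wi}\Big)^{3/2}\mathbf G\Big(-\frac1w\Big)+\mathbf{SM}\,\mathbf G(w)=\mathbf{SM}\,g(w).$$ For $w\in i(0,\infty)$ the same identity holds with $g(w)$ replaced by the limit of $g(w')$ as $w'\to w$ horizontally from the left. -/

import Mathlib

open Complex MeasureTheory Filter Topology Set
open scoped Real ContDiff Matrix MatrixGroups

noncomputable section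

namespace Singlet

/-! ### Characters of modules over the `(p₊, p₋)`-singlet algebra -/

/-- The Kac table `{(r, s) : 1 ≤ r < p₊, 1 ≤ s < p₋, r p₋ < s p₊}`. -/
def kacTable (pp pm : ℕ) : Finset (ℕ × ℕ) :=
  (Finset.Ico 1 pp ×ˢ Finset.Ico 1 pm).filter fun k => k.1 * pm < k.2 * pp

/-- `α₊ = √(2 p₋ / p₊)`. -/
def alphaPlus (pp pm : ℕ) : ℝ := √(2 * pm / pp)

/-- `α₋ = -√(2 p₊ / p₋)`. -/
def alphaMinus (pp pm : ℕ) : ℝ := -√(2 * pp / pm)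

/-- `α₀ = α₊ + α₋`. -/
def alphaZero (pp pm : ℕ) : ℝ := alphaPlus pp pm + alphaMinus pp pm

/-- `α_{r,s;n} = (1 - r)/2 α₊ + (1 - s)/2 α₋ + n/2 √(2 p₊ p₋)`. -/
def alphaRS (pp pm : ℕ) (r s n : ℤ) : ℝ :=
  (1 - r) / 2 * alphaPlus pp pm + (1 - s) / 2 * alphaMinus pp pm + n / 2 * √(2 * pp * pm)

/-- The real power `q ^ x = exp (2 π i τ x)` of the nome. -/
def qPow (τ : ℂ) (x : ℝ) : ℂ := exp (2 * π * I * τ * x)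

/-- The character `q^{(λ - α₀/2)²/2} / η(τ)` of the standard (Fock) module `F_λ`. -/
def chFock (pp pm : ℕ) (l : ℝ) (τ : ℂ) : ℂ :=
  qPow τ ((l - alphaZero pp pm / 2) ^ 2 / 2) / ModularForm.eta τ

/-- The character of the irreducible minimal model module `L_{r,s}`: the alternating sum
`∑_{k ∈ ℤ} (ch F_{r,s;2k} - ch F_{p₊-r,s;2k+1})` over the Felder complex. -/
def chVir (pp pm : ℕ) (r s : ℤ) (τ : ℂ) : ℂ :=
  ∑' k : ℤ, (chFock pp pm (alphaRS pp pm r s (2 * k)) τ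
    - chFock pp pm (alphaRS pp pm (pp - r) s (2 * k + 1)) τ)

/-- The character of the atypical irreducible module `I_{r,s;0}`, in terms of the characters of
the standard modules `F_{r,s;n}` in its resolution. -/
def chAtypical (pp pm : ℕ) (r s : ℤ) (τ : ℂ) : ℂ :=
  ∑' k : ℕ, ((k : ℂ) + 1) *
    (chFock pp pm (alphaRS pp pm (pp - r) s (-2 * k - 1)) τ
      + chFock pp pm (alphaRS pp pm r (pm - s) (-2 * k - 3)) τ
      - chFock pp pm (alphaRS pp pm r s (-2 * k - 2)) τ
      - chFock pp pm (alphaRS pp pm (pp - r) (pm - s) (-2 * k - 2)) τ)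

/-- The partial theta function `P_{a,b}(τ) = ∑_{k ≥ 0} q^{a (k + b/(2a))²}`. -/
def partialTheta (a : ℕ) (b : ℤ) (τ : ℂ) : ℂ :=
  ∑' k : ℕ, qPow τ (a * ((k : ℝ) + b / (2 * a)) ^ 2)

/-- The modified atypical character `χ̃_{r,s}` on the upper half-plane: `η · ch I_{r,s;0}` minus the
combination of differences of partial theta functions which leaves
`∑_{m ∈ ℤ} (|m + b/(2N)| q^{N (m + b/(2N))²} - |m + b'/(2N)| q^{N (m + b'/(2N))²})`, where
`N = p₊ p₋`, `b = p₊ s + p₋ r` and `b' = p₊ s - p₋ r`. -/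
def chiTilde (pp pm : ℕ) (r s : ℤ) (τ : ℂ) : ℂ :=
  ModularForm.eta τ * chAtypical pp pm r s τ
    - (((pp * s - pm * r : ℤ) : ℂ) / (2 * pp * pm)
          * (partialTheta (pp * pm) (pp * s - pm * r) τ
              - partialTheta (pp * pm) (2 * pp * pm - (pp * s - pm * r)) τ)
        - ((pp * s + pm * r : ℤ) : ℂ) / (2 * pp * pm)
          * (partialTheta (pp * pm) (pp * s + pm * r) τ
              - partialTheta (pp * pm) (2 * pp * pm - (pp * s + pm * r)) τ))

/-- The component `f_{r,s} = η · ch L_{r,s}` of the vector `f`. -/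
def cuspVec (pp pm : ℕ) (z : ℂ) (k : kacTable pp pm) : ℂ :=
  ModularForm.eta z * chVir pp pm k.1.1 k.1.2 z

/-- The `S`-matrix of the `(p₊, p₋)` Virasoro minimal model. -/
def minimalS (pp pm : ℕ) : Matrix (kacTable pp pm) (kacTable pp pm) ℂ := fun k l =>
  (((-1) ^ ((k.1.1 + k.1.2) * (l.1.1 + l.1.2)) * √(8 / (pp * pm))
    * Real.sin (π * k.1.1 * l.1.1 * ((pm : ℝ) - pp) / pp)
    * Real.sin (π * k.1.2 * l.1.2 * ((pm : ℝ) - pp) / pm) : ℝ) : ℂ)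

/-- The normalising constant `√(2i) / (4 π √(p₊ p₋))`. -/
def eichlerConst (pp pm : ℕ) : ℂ := (2 * I) ^ (1 / 2 : ℂ) / (4 * π * √(pp * pm))

/-- The integrand of the Eichler integral of `f` at `w` in the lower half-plane, along the ray
`z = w̄ + i t`, `t > 0`, with `dz = i dt`. -/
def eichlerIntegrand (pp pm : ℕ) (w : ℂ) (k : kacTable pp pm) (t : ℝ) : ℂ :=
  cuspVec pp pm (starRingEnd ℂ w + I * t) k / (starRingEnd ℂ w + I * t - w) ^ (3 / 2 : ℂ) * I

/-- The non-holomorphic Eichler integral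
`G*(w) = √(2i) / (4 π √(p₊ p₋)) ∫_{w̄}^{i∞} f(z) / (z - w)^{3/2} dz`, for `Im w < 0`. -/
def eichlerG (pp pm : ℕ) (w : ℂ) (k : kacTable pp pm) : ℂ :=
  eichlerConst pp pm * ∫ t in Ioi (0 : ℝ), eichlerIntegrand pp pm w k t

/-- The branch of `z^{3/2}` on `ℂ ∖ (-i)[0, ∞)` that is positive on the positive real axis; for
`Im z > 0` it is the principal branch. -/
def cutPow (z : ℂ) : ℂ := exp (3 * π * I / 4) * (-I * z) ^ (3 / 2 : ℂ)

/-- The integrand of the error integral at `w ∉ i[0, ∞)`, along `u = i t`, `t > 0`. -/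
def errorIntegrand (pp pm : ℕ) (w : ℂ) (k : kacTable pp pm) (t : ℝ) : ℂ :=
  cuspVec pp pm (I * t) k / cutPow (I * t - w) * I

/-- The error integral `g(w) = √(2i) / (4 π √(p₊ p₋)) ∫_0^{i∞} f(u) / (u - w)^{3/2} du`, taken
along the imaginary axis. -/
def errorG (pp pm : ℕ) (w : ℂ) (k : kacTable pp pm) : ℂ :=
  eichlerConst pp pm * ∫ t in Ioi (0 : ℝ), errorIntegrand pp pm w k t

/-! ### Vector-valued quantum modular forms with quantum set `ℚ` -/

/-- The Möbius action `x ↦ (a x + b) / (c x + d)`. -/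
def mob {K : Type*} [Field K] (γ : SL(2, ℤ)) (x : K) : K :=
  ((γ 0 0 : K) * x + (γ 0 1 : K)) / ((γ 1 0 : K) * x + (γ 1 1 : K))

/-- The automorphy factor `(c w + d)^k`: the principal power on the open lower half-plane, extended
continuously to the real points with `c w + d ≠ 0`. (For `c > 0` and `w` in the lower half-plane
the number `c w + d` has argument in `(-π, 0)`.) -/
def autFactor (k : ℝ) (γ : SL(2, ℤ)) (w : ℂ) : ℂ :=
  if 0 < γ 1 0 then exp (-(π * I * k / 2)) * (I * ((γ 1 0 : ℂ) * w + (γ 1 1 : ℂ))) ^ (k : ℂ)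
  else ((γ 1 0 : ℂ) * w + (γ 1 1 : ℂ)) ^ (k : ℂ)

variable {ι : Type*} [Fintype ι] [DecidableEq ι]

/-- `ρ` is a multiplier system of weight `k`: the operators
`(F | γ)(w) = (c w + d)^{-k} ρ(γ) F(γ w)` satisfy `F | (γ₁ γ₂) = (F | γ₁) | γ₂`. -/
def IsMultiplierSystem (k : ℝ) (ρ : SL(2, ℤ) → GL ι ℂ) : Prop :=
  ∀ (γ₁ γ₂ : SL(2, ℤ)) (w : ℂ), w.im < 0 →
    (autFactor k (γ₁ * γ₂) w)⁻¹ • (ρ (γ₁ * γ₂) : Matrix ι ι ℂ) =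
      ((autFactor k γ₂ w)⁻¹ * (autFactor k γ₁ (mob γ₂ w))⁻¹) •
        ((ρ γ₂ : Matrix ι ι ℂ) * (ρ γ₁ : Matrix ι ι ℂ))

/-- `F : ℚ → ℂ^ι` is a vector-valued quantum modular form of weight `k` with quantum set `ℚ` and
multiplier system `ρ`: for every `γ`, the function `F(x) - (c x + d)^{-k} ρ(γ) F(γ x)` extends to a
smooth function on `ℝ` which is real-analytic away from the point `-d/c`. -/
def IsQuantumModular (k : ℝ) (ρ : SL(2, ℤ) → GL ι ℂ) (F : ℚ → ι → ℂ) : Prop :=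
  IsMultiplierSystem k ρ ∧
  ∀ γ : SL(2, ℤ), ∃ h : ℝ → ι → ℂ, ContDiff ℝ ∞ h ∧
    AnalyticOnNhd ℝ h {x : ℝ | (γ 1 0 : ℝ) * x + (γ 1 1 : ℝ) ≠ 0} ∧
    ∀ x : ℚ, (γ 1 0 : ℚ) * x + (γ 1 1 : ℚ) ≠ 0 →
      h x = F x - (autFactor k γ (x : ℂ))⁻¹ • ((ρ γ : Matrix ι ι ℂ) *ᵥ F (mob γ x))

/-- The values `G(x + i t)` and `G(x - i t)`, `t → 0⁺`, tend to `G(x)` and agree to all orders: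
they have asymptotic expansions `∑ a_m t^m` and `∑ a_m (-t)^m` with `a_0 = G(x)`. -/
def AgreeToAllOrders (G : ℂ → ι → ℂ) (x : ℝ) : Prop :=
  ∃ a : ℕ → ι → ℂ, a 0 = G x ∧ ∀ n : ℕ,
    ((fun t : ℝ => G (x + t * I) - ∑ m ∈ Finset.range n, ((t : ℂ) ^ m) • a m)
      =O[𝓝[>] 0] fun t : ℝ => t ^ n) ∧
    ((fun t : ℝ => G (x - t * I) - ∑ m ∈ Finset.range n, ((-t : ℂ) ^ m) • a m)
      =O[𝓝[>] 0] fun t : ℝ => t ^ n)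

end Singlet

end

noncomputable section

namespace Singlet

/-! Write `N = p₊p₋`. All Fock exponents are of the form `n²/(4N)`. So `f_k = ∑ a_k(n) q^{n²/(4N)}`
with `a_k = thetaCoeff` even and `2N`-periodic, and `χ̃_k = -(1/2N) ∑ a_k(n) |n| q^{n²/(4N)}`.
Poisson summation and the expansion of a sine product in the functions `a_l` make `f` a vector of
weight `1/2` with `S`-matrix `M = minimalS`. Its components are linearly independent and decay
rapidly at every cusp. Apart from explicit series for the characters, only these facts, collected in
`WeightHalf`, are used.

Agreement at `x ∈ ℚ`: put `F(t) = f(x + it)`, which with all derivatives is smaller than every power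
of `t` at `0` and at `∞`. Since `|n|` is a constant times `n² ∫ u^{-1/2} e^{-cn²u} du`, the
character `χ̃(x + iy)` is a constant times `2 ∫_0^∞ F'(y + u) u^{-1/2} du` (`chiTilde_ray`), and
`G*(x - iy)` is the same constant times `∫_y^∞ F(t) (t + y)^{-3/2} dt` (`eichlerG_ray`). Integration
by parts shows that both have the Taylor coefficients `2 ∫ F^{(m+1)}(t) t^{-1/2} dt / m!`, up to the
sign `(-1)^m` (`expansion_pos`, `expansion_neg`).

Quantum modularity: `f(z) (z - w)^{-3/2} dz` is carried to itself by the modular group up to a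
weight `3/2` factor in `w` and a matrix. That matrix is `ρ(γ)`, and linear independence forces the
cocycle relation. Hence the failure of modularity of `G*` under `γ` is the integral from the cusp
`-d/c` to `i∞` (`eichlerLower_sub`). It is a Stieltjes transform, analytic off the cut and smooth
along the real line because of the rapid decay of `f`. The value `G(x)` is the Eichler integral from
`x` evaluated at `w = x`, and its transformation law is a limit from the lower half-plane
(`eichlerRat_sub`).

The `S`-law on the upper half-plane: `g` is a Stieltjes transform with cut `i[0, ∞)`. On the left
side of the cut at `iy`, the part of the integral with `t > y` gives `χ̃(iy)`. The part with `t < y`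
becomes, through `t ↦ 1/t` and the `S`-law of `f`, the term in `χ̃(i/y)` (`tendsto_stieltjes_cut`).
So `χ̃(w) + (1/(wi))^{3/2} M χ̃(-1/w) - g(w)` is holomorphic in the second quadrant with zero
boundary values on the imaginary axis, hence zero (`eq_zero_of_boundary`). Complex conjugation gives
the first quadrant, and `M² = 1` brings the identity into the stated form. -/

/-! ### Arithmetic of the Kac table -/

/-- The coefficient of `q^{n²/(4N)}` in `η · ch L_{r,s}`: the even, `2N`-periodic function equal to
`1/2` on `± (p₊ s - p₋ r)`, to `-1/2` on `± (p₊ s + p₋ r)`, and to `0` elsewhere. -/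
def thetaCoeff (pp pm : ℕ) (k : ℕ × ℕ) (n : ℤ) : ℝ :=
  ((if (2 * pp * pm : ℤ) ∣ n - (pp * k.2 - pm * k.1) then 1 else 0)
    + (if (2 * pp * pm : ℤ) ∣ n + (pp * k.2 - pm * k.1) then 1 else 0)
    - (if (2 * pp * pm : ℤ) ∣ n - (pp * k.2 + pm * k.1) then 1 else 0)
    - (if (2 * pp * pm : ℤ) ∣ n + (pp * k.2 + pm * k.1) then 1 else 0)) / 2

lemma mem_kacTable {pp pm : ℕ} {k : ℕ × ℕ} :
    k ∈ kacTable pp pm ↔ (1 ≤ k.1 ∧ k.1 < pp) ∧ (1 ≤ k.2 ∧ k.2 < pm) ∧ k.1 * pm < k.2 * pp := by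
  simp [kacTable, Finset.mem_filter, Finset.mem_product, and_assoc]

/-- The congruence gives `x - x' = m i`, `y - y' = p j` with `i ≡ j` modulo `2` and `|i|, |j| ≤ 1`.
If both were `±1`, then `|x| + |x'| = m` and `|y| + |y'| ≥ p`, against the sum of the two strict
inequalities. -/
lemma eq_of_dvd_of_region {p m : ℤ} (hp : 0 < p) (hm : 0 < m) (hcop : IsCoprime p m)
    {x y x' y' : ℤ} (hx : |x| < m) (hx' : |x'| < m) (hy : |y| < p) (hy' : |y'| < p)
    (h : |y| * m < |x| * p) (h' : |y'| * m < |x'| * p)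
    (hd : 2 * p * m ∣ (p * x - m * y) - (p * x' - m * y')) : x = x' ∧ y = y' := by
  obtain ⟨l, hl⟩ := hd
  have h1 : m ∣ x - x' := by
    refine hcop.symm.dvd_of_dvd_mul_left (⟨2 * p * l + y - y', ?_⟩ : m ∣ p * (x - x'))
    linear_combination hl
  have h2 : p ∣ y - y' := by
    refine hcop.dvd_of_dvd_mul_left (⟨-2 * m * l + x - x', ?_⟩ : p ∣ m * (y - y'))
    linear_combination -hl
  obtain ⟨i, hi⟩ := h1
  obtain ⟨j, hj⟩ := h2
  have hij : i - j = 2 * l := by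
    have : p * m ≠ 0 := by positivity
    apply mul_left_cancel₀ this
    linear_combination hl - p * hi + m * hj
  rw [abs_lt] at hx hx' hy hy'
  have hi1 : i < 2 := by
    by_contra hc
    nlinarith
  have hi2 : -2 < i := by
    by_contra hc
    nlinarith
  have hj1 : j < 2 := by
    by_contra hc
    nlinarith
  have hj2 : -2 < j := by
    by_contra hc
    nlinarith
  have hxa : |x| = x ∧ 0 ≤ x ∨ |x| = -x ∧ x < 0 := by
    rcases le_or_gt 0 x with h | h
    · exact Or.inl ⟨abs_of_nonneg h, h⟩
    · exact Or.inr ⟨abs_of_neg h, h⟩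
  have hxa' : |x'| = x' ∧ 0 ≤ x' ∨ |x'| = -x' ∧ x' < 0 := by
    rcases le_or_gt 0 x' with h | h
    · exact Or.inl ⟨abs_of_nonneg h, h⟩
    · exact Or.inr ⟨abs_of_neg h, h⟩
  have key : i = 0 ∧ j = 0 := by
    by_contra hne
    have hcases : (i = 1 ∨ i = -1) ∧ (j = 1 ∨ j = -1) := by omega
    have e1 : |x| + |x'| = m := by
      rcases hcases.1 with rfl | rfl <;> omega
    have e2 : p ≤ |y| + |y'| := by
      have := abs_sub y y'
      rcases hcases.2 with rfl | rfl
      · rw [hj, mul_one, abs_of_pos hp] at this; exact this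
      · rw [hj, mul_neg, mul_one, abs_neg, abs_of_pos hp] at this; exact this
    nlinarith
  rw [key.1] at hi
  rw [key.2] at hj
  constructor <;> linarith

/-- Representatives in the region are unique, so at most one of the four classes `(±s, ±r)` in
`thetaCoeff` can contain `n`. The classes with equal signs carry `+1/2`, those with opposite signs
`-1/2`, whence the sign of `xy`. -/
lemma thetaCoeff_of_region {pp pm : ℕ} (hpp : 2 ≤ pp) (hpm : 2 ≤ pm) (hcop : Nat.Coprime pp pm)
    {l : ℕ × ℕ} (hl : l ∈ kacTable pp pm) {x y n : ℤ} (hx0 : x ≠ 0) (hy0 : y ≠ 0)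
    (hx : |x| < pm) (hy : |y| < pp) (h : |y| * pm < |x| * pp)
    (hn : (2 * pp * pm : ℤ) ∣ n - (pp * x - pm * y)) :
    thetaCoeff pp pm l n =
      if l = (y.natAbs, x.natAbs) then (((x * y).sign : ℤ) : ℝ) / 2 else 0 := by
  obtain ⟨⟨hr1, hr2⟩, ⟨hs1, hs2⟩, hrs⟩ := mem_kacTable.1 hl
  obtain ⟨r, s⟩ := l
  simp only at hr1 hr2 hs1 hs2 hrs
  have hp : (0 : ℤ) < pp := by omega
  have hm : (0 : ℤ) < pm := by omega
  have hc : IsCoprime (pp : ℤ) pm := Nat.isCoprime_iff_coprime.2 hcop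
  have crit : ∀ x' y' : ℤ, |x'| = s → |y'| = r →
      ((2 * pp * pm : ℤ) ∣ n - (pp * x' - pm * y') ↔ x = x' ∧ y = y') := by
    intro x' y' hx' hy'
    constructor
    · intro hd
      have hd' : (2 * pp * pm : ℤ) ∣ (pp * x - pm * y) - (pp * x' - pm * y') := by
        have := dvd_sub hd hn
        rwa [show n - (pp * x' - pm * y') - (n - (pp * x - pm * y))
          = (pp * x - pm * y) - (pp * x' - pm * y') by ring] at this
      refine eq_of_dvd_of_region hp hm hc hx (by rw [hx']; exact_mod_cast hs2) hy
        (by rw [hy']; exact_mod_cast hr2) h ?_ hd'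
      rw [hx', hy']; exact_mod_cast hrs
    · rintro ⟨rfl, rfl⟩; exact hn
  have c1 := crit s r (by simp) (by simp)
  have c2 := crit (-s) (-r) (by simp) (by simp)
  have c3 := crit s (-r) (by simp) (by simp)
  have c4 := crit (-s) r (by simp) (by simp)
  have e1 : n - (pp * (s : ℤ) - pm * r) = n - (pp * s - pm * r) := rfl
  have e2 : n - (pp * (-s : ℤ) - pm * -r) = n + (pp * s - pm * r) := by ring
  have e3 : n - (pp * (s : ℤ) - pm * -r) = n - (pp * s + pm * r) := by ring
  have e4 : n - (pp * (-s : ℤ) - pm * r) = n + (pp * s + pm * r) := by ring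
  rw [e2] at c2
  rw [e3] at c3
  rw [e4] at c4
  unfold thetaCoeff
  simp only [c1, c2, c3, c4, Prod.mk.injEq]
  have hs0 : (0 : ℤ) < s := by omega
  have hr0 : (0 : ℤ) < r := by omega
  rcases lt_or_gt_of_ne hx0 with hx1 | hx1 <;> rcases lt_or_gt_of_ne hy0 with hy1 | hy1
  · have : (x * y).sign = 1 := Int.sign_eq_one_of_pos (mul_pos_of_neg_of_neg hx1 hy1)
    rw [this]
    have k1 : ¬ (x = s ∧ y = r) := by omega
    have k3 : ¬ (x = s ∧ y = -r) := by omega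
    have k4 : ¬ (x = -s ∧ y = r) := by omega
    have k2 : (x = -s ∧ y = -r) ↔ (r = y.natAbs ∧ s = x.natAbs) := by omega
    simp only [k1, k3, k4, k2, if_false]
    split_ifs <;> norm_num
  · have : (x * y).sign = -1 := Int.sign_eq_neg_one_of_neg (mul_neg_of_neg_of_pos hx1 hy1)
    rw [this]
    have k1 : ¬ (x = s ∧ y = r) := by omega
    have k3 : ¬ (x = s ∧ y = -r) := by omega
    have k2 : ¬ (x = -s ∧ y = -r) := by omega
    have k4 : (x = -s ∧ y = r) ↔ (r = y.natAbs ∧ s = x.natAbs) := by omega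
    simp only [k1, k3, k4, k2, if_false]
    split_ifs <;> norm_num
  · have : (x * y).sign = -1 := Int.sign_eq_neg_one_of_neg (mul_neg_of_pos_of_neg hx1 hy1)
    rw [this]
    have k1 : ¬ (x = s ∧ y = r) := by omega
    have k4 : ¬ (x = -s ∧ y = r) := by omega
    have k2 : ¬ (x = -s ∧ y = -r) := by omega
    have k3 : (x = s ∧ y = -r) ↔ (r = y.natAbs ∧ s = x.natAbs) := by omega
    simp only [k1, k3, k4, k2, if_false]
    split_ifs <;> norm_num
  · have : (x * y).sign = 1 := Int.sign_eq_one_of_pos (mul_pos hx1 hy1)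
    rw [this]
    have k3 : ¬ (x = s ∧ y = -r) := by omega
    have k4 : ¬ (x = -s ∧ y = r) := by omega
    have k2 : ¬ (x = -s ∧ y = -r) := by omega
    have k1 : (x = s ∧ y = r) ↔ (r = y.natAbs ∧ s = x.natAbs) := by omega
    simp only [k1, k3, k4, k2, if_false]
    split_ifs <;> norm_num

/-- Bézout gives `n = p x₀ - m y₁` with `0 < x₀ < m`, and `y₁` is moved modulo `2p` into `(-p, p)`.
If the point lies on the wrong side of `|y| m = |x| p`, the shift by `(-m, ±p)`, with the sign
opposite to that of `y₃`, moves it to the right side and changes `n` by a multiple of `2pm`. -/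
lemma exists_region {p m : ℤ} (hp : 2 ≤ p) (hm : 2 ≤ m) (hcop : IsCoprime p m) {n : ℤ}
    (hnp : ¬ p ∣ n) (hnm : ¬ m ∣ n) :
    ∃ x y : ℤ, x ≠ 0 ∧ y ≠ 0 ∧ |x| < m ∧ |y| < p ∧ |y| * m < |x| * p ∧
      2 * p * m ∣ n - (p * x - m * y) := by
  obtain ⟨u, v, huv⟩ := hcop
  -- a representative with `0 < x < m`
  set x₀ := (n * u) % m with hx₀
  have hx₀1 : 0 ≤ x₀ := Int.emod_nonneg _ (by omega)
  have hx₀2 : x₀ < m := Int.emod_lt_of_pos _ (by omega)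
  have hx₀3 : n * u = m * (n * u / m) + x₀ := (Int.mul_ediv_add_emod _ _).symm
  set y₁ := -(n * v + p * (n * u / m)) with hy₁
  have hn1 : n = p * x₀ - m * y₁ := by
    rw [hy₁]
    linear_combination (-n) * huv + p * hx₀3
  set y₂ := y₁ % (2 * p) with hy₂
  have hy₂1 : 0 ≤ y₂ := Int.emod_nonneg _ (by omega)
  have hy₂2 : y₂ < 2 * p := Int.emod_lt_of_pos _ (by omega)
  have hy₂3 : y₁ = 2 * p * (y₁ / (2 * p)) + y₂ := (Int.mul_ediv_add_emod _ _).symm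
  have hx₀0 : x₀ ≠ 0 := fun h => hnm ⟨-y₁, by rw [hn1, h]; ring⟩
  have hpy : ∀ y j : ℤ, y₁ = 2 * p * j + y → ¬ p ∣ y := by
    rintro y j hj ⟨w, rfl⟩
    exact hnp ⟨x₀ - m * (2 * j + w), by rw [hn1, hj]; ring⟩
  obtain ⟨y₃, j, hj, hy₃⟩ : ∃ y j : ℤ, y₁ = 2 * p * j + y ∧ |y| < p := by
    rcases lt_trichotomy y₂ p with hlt | heq | hgt
    · exact ⟨y₂, _, hy₂3, by rw [abs_of_nonneg hy₂1]; exact hlt⟩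
    · exact absurd (by rw [heq]) (hpy y₂ _ hy₂3)
    · refine ⟨y₂ - 2 * p, y₁ / (2 * p) + 1, by linear_combination hy₂3, ?_⟩
      rw [abs_lt]; constructor <;> linarith
  have hy₃0 : y₃ ≠ 0 := fun h => hpy y₃ j hj (h ▸ dvd_zero p)
  have hx₀p : 0 < x₀ := lt_of_le_of_ne hx₀1 (Ne.symm hx₀0)
  have hdiv : n = p * x₀ - m * y₃ - 2 * p * m * j := by rw [hn1, hj]; ring
  rcases lt_trichotomy (|y₃| * m) (x₀ * p) with hlt | heq | hgt
  · exact ⟨x₀, y₃, hx₀0, hy₃0, by rwa [abs_of_pos hx₀p], hy₃, by rwa [abs_of_pos hx₀p],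
      ⟨-j, by rw [hdiv]; ring⟩⟩
  · exfalso
    have : p ∣ |y₃| := by
      exact IsCoprime.dvd_of_dvd_mul_right (⟨u, v, huv⟩ : IsCoprime p m) (⟨x₀, by rw [heq]; ring⟩ : p ∣ |y₃| * m)
    exact hpy y₃ j hj ((dvd_abs _ _).1 this)
  · rcases lt_or_gt_of_ne hy₃0 with hneg | hpos
    · -- reflect to `(x₀ - m, y₃ + p)`
      rw [abs_of_neg hneg] at hgt hy₃
      refine ⟨x₀ - m, y₃ + p, by omega, by omega, ?_, ?_, ?_, ⟨1 - j, by rw [hdiv]; ring⟩⟩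
      · rw [abs_lt]; constructor <;> linarith
      · rw [abs_lt]; constructor <;> linarith
      · rw [abs_of_neg (by linarith : x₀ - m < 0), abs_of_pos (by linarith : 0 < y₃ + p)]
        linarith
    · rw [abs_of_pos hpos] at hgt hy₃
      refine ⟨x₀ - m, y₃ - p, by omega, by omega, ?_, ?_, ?_, ⟨-j, by rw [hdiv]; ring⟩⟩
      · rw [abs_lt]; constructor <;> linarith
      · rw [abs_lt]; constructor <;> linarith
      · rw [abs_of_neg (by linarith : x₀ - m < 0), abs_of_neg (by linarith : y₃ - p < 0)]
        linarith

/-- If `p₊ ∣ n` and `n` were in one of the four classes, coprimality would give `p₊ ∣ r`, impossible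
for `0 < r < p₊`; likewise for `p₋` and `s`. -/
lemma thetaCoeff_eq_zero {pp pm : ℕ} (hcop : Nat.Coprime pp pm) {k : ℕ × ℕ}
    (hk : k ∈ kacTable pp pm) {n : ℤ} (hn : (pp : ℤ) ∣ n ∨ (pm : ℤ) ∣ n) :
    thetaCoeff pp pm k n = 0 := by
  obtain ⟨⟨hr1, hr2⟩, ⟨hs1, hs2⟩, -⟩ := mem_kacTable.1 hk
  have hc : IsCoprime (pp : ℤ) pm := Nat.isCoprime_iff_coprime.2 hcop
  have key : ∀ a b : ℤ, a.natAbs = k.2 → b.natAbs = k.1 →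
      ¬ (2 * pp * pm : ℤ) ∣ n - (pp * a + pm * b) := by
    rintro a b ha hb ⟨w, hw⟩
    rcases hn with ⟨v, rfl⟩ | ⟨v, rfl⟩
    · have : (pp : ℤ) ∣ b := hc.dvd_of_dvd_mul_left
        (⟨v - a - 2 * pm * w, by linear_combination -hw⟩ : (pp : ℤ) ∣ pm * b)
      have := Nat.le_of_dvd (by omega) (Int.natCast_dvd.1 this)
      omega
    · have : (pm : ℤ) ∣ a := hc.symm.dvd_of_dvd_mul_left
        (⟨v - b - 2 * pp * w, by linear_combination -hw⟩ : (pm : ℤ) ∣ pp * a)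
      have := Nat.le_of_dvd (by omega) (Int.natCast_dvd.1 this)
      omega
  have k1 := key k.2 (-k.1) (by simp) (by simp)
  have k2 := key (-k.2) k.1 (by simp) (by simp)
  have k3 := key k.2 k.1 (by simp) (by simp)
  have k4 := key (-k.2) (-k.1) (by simp) (by simp)
  rw [show n - (pp * (k.2 : ℤ) + pm * -k.1) = n - (pp * k.2 - pm * k.1) by ring] at k1
  rw [show n - (pp * (-k.2 : ℤ) + pm * k.1) = n + (pp * k.2 - pm * k.1) by ring] at k2
  rw [show n - (pp * (-k.2 : ℤ) + pm * -k.1) = n + (pp * k.2 + pm * k.1) by ring] at k4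
  simp [thetaCoeff, k1, k2, k3, k4]

lemma thetaCoeff_neg (pp pm : ℕ) (k : ℕ × ℕ) (n : ℤ) :
    thetaCoeff pp pm k (-n) = thetaCoeff pp pm k n := by
  have h : ∀ b : ℤ, ((2 * pp * pm : ℤ) ∣ -n - b ↔ (2 * pp * pm : ℤ) ∣ n + b) := fun b => by
    rw [← dvd_neg, show -(-n - b) = n + b by ring]
  have h' : ∀ b : ℤ, ((2 * pp * pm : ℤ) ∣ -n + b ↔ (2 * pp * pm : ℤ) ∣ n - b) := fun b => by
    rw [← dvd_neg, show -(-n + b) = n - b by ring]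
  simp only [thetaCoeff, h, h']
  ring

lemma abs_thetaCoeff_le (pp pm : ℕ) (k : ℕ × ℕ) (n : ℤ) : |thetaCoeff pp pm k n| ≤ 1 := by
  unfold thetaCoeff
  rw [abs_le]
  constructor <;> split_ifs <;> norm_num

lemma thetaCoeff_zero {pp pm : ℕ} (hcop : Nat.Coprime pp pm) {k : ℕ × ℕ}
    (hk : k ∈ kacTable pp pm) : thetaCoeff pp pm k 0 = 0 :=
  thetaCoeff_eq_zero hcop hk (Or.inl (dvd_zero _))

/-- The index `b' = p₊s - p₋r` singles out one row of the Kac table; this is what linear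
independence rests on. -/
lemma thetaCoeff_label {pp pm : ℕ} (hpp : 2 ≤ pp) (hpm : 2 ≤ pm) (hcop : Nat.Coprime pp pm)
    {k l : ℕ × ℕ} (hk : k ∈ kacTable pp pm) (hl : l ∈ kacTable pp pm) :
    thetaCoeff pp pm l (pp * k.2 - pm * k.1) = if l = k then 1 / 2 else 0 := by
  obtain ⟨⟨hr1, hr2⟩, ⟨hs1, hs2⟩, hrs⟩ := mem_kacTable.1 hk
  rw [thetaCoeff_of_region hpp hpm hcop hl (x := k.2) (y := k.1) (by omega) (by omega)
    (by rw [Nat.abs_cast]; exact_mod_cast hs2) (by rw [Nat.abs_cast]; exact_mod_cast hr2)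
    (by rw [Nat.abs_cast, Nat.abs_cast]; exact_mod_cast hrs) (by simp)]
  have : ((k.2 : ℤ) * k.1).sign = 1 := Int.sign_eq_one_of_pos (by positivity)
  simp [this]

/-- The sine product that appears in the Poisson dual of `η · ch L_{r,s}`. -/
def sinProd (pp pm : ℕ) (k : ℕ × ℕ) (n : ℤ) : ℝ :=
  Real.sin (π * n * k.2 / pm) * Real.sin (π * n * k.1 / pp)

lemma sinProd_eq_zero {pp pm : ℕ} (hpp : 2 ≤ pp) (hpm : 2 ≤ pm) (k : ℕ × ℕ) {n : ℤ}
    (hn : (pp : ℤ) ∣ n ∨ (pm : ℤ) ∣ n) : sinProd pp pm k n = 0 := by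
  have hp : (pp : ℝ) ≠ 0 := by positivity
  have hm : (pm : ℝ) ≠ 0 := by positivity
  unfold sinProd
  rcases hn with ⟨v, rfl⟩ | ⟨v, rfl⟩
  · have : π * ((pp * v : ℤ) : ℝ) * k.1 / pp = ((v * k.1 : ℤ) : ℝ) * π := by
      push_cast; field_simp
    rw [this, Real.sin_int_mul_pi, mul_zero]
  · have : π * ((pm * v : ℤ) : ℝ) * k.2 / pm = ((v * k.2 : ℤ) : ℝ) * π := by
      push_cast; field_simp
    rw [this, Real.sin_int_mul_pi, zero_mul]

/-- Substituting for `n` leaves the angles `πsx p₊/p₋` and `-πry p₋/p₊` up to multiples of `π`.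
Passing to the differences `p₋ - p₊` of the `S`-matrix costs further multiples of `π`, and all the
signs collect into the power of `-1`. -/
lemma sinProd_of_dvd {pp pm : ℕ} (hpp : 2 ≤ pp) (hpm : 2 ≤ pm) (k : ℕ × ℕ) {x y n : ℤ}
    (hn : (2 * pp * pm : ℤ) ∣ n - (pp * x - pm * y)) :
    sinProd pp pm k n = (-1) ^ ((k.1 + k.2) * (y.natAbs + x.natAbs))
      * Real.sin (π * k.1 * y * ((pm : ℝ) - pp) / pp)
      * Real.sin (π * k.2 * x * ((pm : ℝ) - pp) / pm) := by
  have hp : (pp : ℝ) ≠ 0 := by positivity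
  have hm : (pm : ℝ) ≠ 0 := by positivity
  obtain ⟨w, hw⟩ := hn
  obtain ⟨r, s⟩ := k
  have hn : n = pp * x - pm * y + 2 * pp * pm * w := by linear_combination hw
  have e1 : π * n * s / pm = π * s * x * pp / pm - ((s * y - 2 * pp * w * s : ℤ) : ℝ) * π := by
    rw [hn]; push_cast; field_simp; ring
  have e2 : π * n * r / pp = -(π * r * y * pm / pp) + ((r * x + 2 * pm * w * r : ℤ) : ℝ) * π := by
    rw [hn]; push_cast; field_simp; ring
  have e3 : π * r * y * ((pm : ℝ) - pp) / pp = π * r * y * pm / pp - ((r * y : ℤ) : ℝ) * π := by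
    push_cast; field_simp
  have e4 : π * s * x * ((pm : ℝ) - pp) / pm
      = -(π * s * x * pp / pm) + ((s * x : ℤ) : ℝ) * π := by
    push_cast; field_simp; ring
  have hpow : ((-1 : ℝ)) ^ ((r + s) * (y.natAbs + x.natAbs)) = (-1) ^ (((r : ℤ) + s) * (y + x)) := by
    rw [← zpow_natCast]
    rcases Int.even_or_odd (((r : ℤ) + s) * (y + x)) with h | h
    · rw [h.neg_one_zpow, Even.neg_one_zpow]
      rw [Int.even_mul, Int.even_add, Int.even_add] at h
      push_cast
      rw [Int.even_mul, Int.even_add, Int.even_add, even_abs, even_abs]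
      exact h
    · rw [h.neg_one_zpow, Odd.neg_one_zpow]
      rw [← Int.not_even_iff_odd, Int.even_mul, Int.even_add, Int.even_add] at h
      rw [← Int.not_even_iff_odd]
      push_cast
      rw [Int.even_mul, Int.even_add, Int.even_add, even_abs, even_abs]
      exact h
  have hA : (-1 : ℝ) ^ (s * y - 2 * pp * w * s : ℤ) = (-1) ^ (s * y : ℤ) := by
    rw [zpow_sub₀ (by norm_num), Even.neg_one_zpow (n := 2 * pp * w * s)
      ⟨pp * w * s, by ring⟩, div_one]
  have hB : (-1 : ℝ) ^ (r * x + 2 * pm * w * r : ℤ) = (-1) ^ (r * x : ℤ) := by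
    rw [zpow_add₀ (by norm_num), Even.neg_one_zpow (n := 2 * pm * w * r)
      ⟨pm * w * r, by ring⟩, mul_one]
  unfold sinProd
  simp only
  rw [hpow, e1, e2, e3, e4, Real.sin_sub_int_mul_pi, Real.sin_add_int_mul_pi,
    Real.sin_sub_int_mul_pi, Real.sin_add_int_mul_pi, Real.sin_neg, Real.sin_neg, hA, hB]
  have hsq : ∀ a : ℤ, ((-1 : ℝ) ^ a) * ((-1 : ℝ) ^ a) = 1 := fun a => by
    rw [← mul_zpow]; norm_num
  have h1 : (-1 : ℝ) ^ (((r : ℤ) + s) * (y + x)) =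
      (-1) ^ (r * y : ℤ) * (-1) ^ (r * x : ℤ) * ((-1) ^ (s * y : ℤ) * (-1) ^ (s * x : ℤ)) := by
    rw [← zpow_add₀ (by norm_num), ← zpow_add₀ (by norm_num), ← zpow_add₀ (by norm_num)]
    ring_nf
  rw [h1]
  linear_combination (-(((-1 : ℝ) ^ (s * y : ℤ)) * ((-1 : ℝ) ^ (r * x : ℤ)))
    * Real.sin (π * s * x * pp / pm) * Real.sin (π * r * y * pm / pp))
      * (-hsq (r * y) - (-1 : ℝ) ^ (r * y : ℤ) * (-1 : ℝ) ^ (r * y : ℤ) * hsq (s * x))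

/-- The sine product expands in the coefficients of the theta series, with the rows of the
`S`-matrix as coefficients. -/
lemma sum_minimalS_mul_thetaCoeff {pp pm : ℕ} (hpp : 2 ≤ pp) (hpm : 2 ≤ pm)
    (hcop : Nat.Coprime pp pm) (k : kacTable pp pm) (n : ℤ) :
    ∑ l : kacTable pp pm, minimalS pp pm k l * (thetaCoeff pp pm l n : ℂ)
      = ((√(2 / (pp * pm)) * sinProd pp pm k n : ℝ) : ℂ) := by
  have hp : (pp : ℝ) ≠ 0 := by positivity
  have hm : (pm : ℝ) ≠ 0 := by positivity
  by_cases hn : (pp : ℤ) ∣ n ∨ (pm : ℤ) ∣ n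
  · rw [sinProd_eq_zero hpp hpm _ hn]
    simp [thetaCoeff_eq_zero hcop (Subtype.prop _) hn]
  · rw [not_or] at hn
    obtain ⟨x, y, hx0, hy0, hx, hy, hxy, hd⟩ := exists_region (p := pp) (m := pm)
      (by omega) (by omega) (Nat.isCoprime_iff_coprime.2 hcop) hn.1 hn.2
    have hmem : (y.natAbs, x.natAbs) ∈ kacTable pp pm := by
      rw [mem_kacTable]
      rw [Int.abs_eq_natAbs] at hx hy
      refine ⟨⟨by simp only; omega, by simp only; omega⟩,
        ⟨by simp only; omega, by simp only; omega⟩, ?_⟩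
      zify
      exact hxy
    have hco : ∀ l : kacTable pp pm, thetaCoeff pp pm l n =
        if l = ⟨_, hmem⟩ then (((x * y).sign : ℤ) : ℝ) / 2 else 0 := fun l => by
      rw [thetaCoeff_of_region hpp hpm hcop l.2 hx0 hy0 hx hy hxy hd]
      simp [Subtype.ext_iff]
    simp only [hco]
    rw [Finset.sum_eq_single ⟨_, hmem⟩ (fun l _ hl => by simp [hl]) (by simp)]
    rw [sinProd_of_dvd hpp hpm _ hd, if_pos rfl, minimalS, ← ofReal_mul]
    congr 1
    -- This `2` cancels the `1/2` in the value of `thetaCoeff`.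
    have h8 : √(8 / (pp * pm) : ℝ) = 2 * √(2 / (pp * pm)) := by
      rw [show (8 / (pp * pm) : ℝ) = 2 ^ 2 * (2 / (pp * pm)) by ring, Real.sqrt_mul (by positivity),
        Real.sqrt_sq (by norm_num)]
    rw [h8]
    -- The row label contains `|x|` and `|y|`; since the sine is odd, going back to `x` and `y`
    -- produces `sign x · sign y`, which cancels the sign in the coefficient.
    have hodd : ∀ (z : ℤ) (c d e : ℝ), Real.sin (π * c * (z.natAbs : ℝ) * d / e) =
        (z.sign : ℝ) * Real.sin (π * c * z * d / e) := by
      intro z c d e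
      rcases lt_trichotomy z 0 with h | h | h
      · have : ((z.natAbs : ℕ) : ℝ) = -z := by
          rw [Nat.cast_natAbs, abs_of_neg h]; push_cast; ring
        rw [this, Int.sign_eq_neg_one_of_neg h]
        rw [show π * c * -(z : ℝ) * d / e = -(π * c * z * d / e) by ring, Real.sin_neg]
        push_cast; ring
      · subst h; simp
      · have : ((z.natAbs : ℕ) : ℝ) = z := by
          rw [Nat.cast_natAbs, abs_of_pos h]
        rw [this, Int.sign_eq_one_of_pos h]; push_cast; ring
    simp only
    rw [hodd, hodd, Int.sign_mul]
    have hs : ∀ z : ℤ, z ≠ 0 → (z.sign : ℝ) * z.sign = 1 := by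
      intro z hz
      rcases lt_or_gt_of_ne hz with h | h
      · rw [Int.sign_eq_neg_one_of_neg h]; norm_num
      · rw [Int.sign_eq_one_of_pos h]; norm_num
    push_cast
    set A := Real.sin (π * (k.1.1 : ℝ) * y * ((pm : ℝ) - pp) / pp)
    set B := Real.sin (π * (k.1.2 : ℝ) * x * ((pm : ℝ) - pp) / pm)
    have h1 := hs x hx0
    have h2 := hs y hy0
    linear_combination ((-1 : ℝ) ^ ((k.1.1 + k.1.2) * (y.natAbs + x.natAbs)) * √(2 / (pp * pm)) * A * B)
      * (h1 + (x.sign : ℝ) * x.sign * h2)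

/-! ### Theta series with bounded coefficients -/

lemma norm_qPow (z : ℂ) (x : ℝ) : ‖qPow z x‖ = Real.exp (-(2 * π * x * z.im)) := by
  rw [qPow, Complex.norm_exp]
  congr 1
  simp
  ring

lemma norm_qPow_sq (N : ℝ) (z : ℂ) (n : ℤ) :
    ‖qPow z ((n : ℝ) ^ 2 / (4 * N))‖ = Real.exp (-(π * z.im / (2 * N)) * (n : ℝ) ^ 2) := by
  rw [norm_qPow]
  congr 1
  ring

lemma summable_pow_mul_exp_neg_sq {c : ℝ} (hc : 0 < c) (j : ℕ) :
    Summable fun n : ℤ => |(n : ℝ)| ^ j * Real.exp (-c * (n : ℝ) ^ 2) := by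
  refine (summable_pow_mul_jacobiTheta₂_term_bound 0 (div_pos hc Real.pi_pos) j).congr fun n => ?_
  push_cast
  congr 2
  field_simp
  ring

/-- The theta series `∑ a_n q^{n²/(4N)}`. -/
def thetaSeries (N : ℝ) (a : ℤ → ℂ) (z : ℂ) : ℂ := ∑' n : ℤ, a n * qPow z ((n : ℝ) ^ 2 / (4 * N))

lemma norm_thetaSeries_term_le {N : ℝ} {a : ℤ → ℂ} {j : ℕ} (ha : ∀ n, ‖a n‖ ≤ |(n : ℝ)| ^ j)
    (z : ℂ) (n : ℤ) : ‖a n * qPow z ((n : ℝ) ^ 2 / (4 * N))‖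
      ≤ |(n : ℝ)| ^ j * Real.exp (-(π * z.im / (2 * N)) * (n : ℝ) ^ 2) := by
  rw [norm_mul, norm_qPow_sq]
  exact mul_le_mul_of_nonneg_right (ha n) (Real.exp_pos _).le

lemma summable_thetaSeries {N : ℝ} (hN : 0 < N) {a : ℤ → ℂ} {j : ℕ}
    (ha : ∀ n, ‖a n‖ ≤ |(n : ℝ)| ^ j) {z : ℂ} (hz : 0 < z.im) :
    Summable fun n : ℤ => a n * qPow z ((n : ℝ) ^ 2 / (4 * N)) :=
  Summable.of_norm_bounded (summable_pow_mul_exp_neg_sq (by positivity) j)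
    (norm_thetaSeries_term_le ha z)

lemma hasDerivAt_qPow (z : ℂ) (x : ℝ) :
    HasDerivAt (fun z => qPow z x) (2 * π * I * x * qPow z x) z := by
  unfold qPow
  have : HasDerivAt (fun z : ℂ => 2 * π * I * z * x) (2 * π * I * x) z := by
    simpa using (((hasDerivAt_id z).const_mul (2 * π * I)).mul_const (x : ℂ))
  exact this.cexp.congr_deriv (mul_comm _ _)

lemma hasDerivAt_thetaSeries {N : ℝ} (hN : 0 < N) {a : ℤ → ℂ} {j : ℕ}
    (ha : ∀ n, ‖a n‖ ≤ |(n : ℝ)| ^ j) {z : ℂ} (hz : 0 < z.im) :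
    HasDerivAt (thetaSeries N a)
      (∑' n : ℤ, a n * (2 * π * I * ((n : ℝ) ^ 2 / (4 * N) : ℝ)
        * qPow z ((n : ℝ) ^ 2 / (4 * N)))) z := by
  have hT : IsOpen {w : ℂ | z.im / 2 < w.im} := isOpen_lt continuous_const continuous_im
  have hTc : IsPreconnected {w : ℂ | z.im / 2 < w.im} :=
    (convex_halfSpace_im_gt _).isPreconnected
  have hzT : z ∈ {w : ℂ | z.im / 2 < w.im} := by
    change z.im / 2 < z.im
    linarith
  refine hasDerivAt_tsum_of_isPreconnected
    (u := fun n : ℤ => (2 * π / (4 * N)) * (|(n : ℝ)| ^ (j + 2)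
      * Real.exp (-(π * (z.im / 2) / (2 * N)) * (n : ℝ) ^ 2)))
    ((summable_pow_mul_exp_neg_sq (by positivity) (j + 2)).mul_left _) hT hTc
    (fun n w _ => (hasDerivAt_qPow w _).const_mul (a n)) (fun n w hw => ?_) hzT
    (summable_thetaSeries hN ha hz) hzT
  have hw' : z.im / 2 < w.im := hw
  rw [norm_mul, norm_mul, norm_qPow_sq]
  have h1 : ‖(2 * π * I * (((n : ℝ) ^ 2 / (4 * N) : ℝ) : ℂ))‖ = 2 * π / (4 * N) * |(n : ℝ)| ^ 2 := by
    rw [norm_mul, norm_mul, norm_mul, norm_I, norm_real, norm_real, Real.norm_of_nonneg Real.pi_pos.le,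
      Real.norm_of_nonneg (by positivity), sq_abs]
    simp
    ring
  rw [h1]
  have h2 : Real.exp (-(π * w.im / (2 * N)) * (n : ℝ) ^ 2)
      ≤ Real.exp (-(π * (z.im / 2) / (2 * N)) * (n : ℝ) ^ 2) := by
    apply Real.exp_le_exp.2
    apply mul_le_mul_of_nonneg_right _ (sq_nonneg _)
    apply neg_le_neg
    gcongr
  calc ‖a n‖ * (2 * π / (4 * N) * |(n : ℝ)| ^ 2 * Real.exp (-(π * w.im / (2 * N)) * (n : ℝ) ^ 2))
      ≤ |(n : ℝ)| ^ j * (2 * π / (4 * N) * |(n : ℝ)| ^ 2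
        * Real.exp (-(π * (z.im / 2) / (2 * N)) * (n : ℝ) ^ 2)) := by
        gcongr
        exact ha n
    _ = _ := by ring

/-- Decay of a theta series whose coefficients vanish for `|n| < M`. -/
lemma exists_norm_thetaSeries_le {N : ℝ} (hN : 0 < N) {a : ℤ → ℂ} (ha : ∀ n, ‖a n‖ ≤ 1) {M : ℕ}
    (hM : ∀ n : ℤ, n.natAbs < M → a n = 0) {δ : ℝ} (hδ : 0 < δ) :
    ∃ C, 0 ≤ C ∧ ∀ z : ℂ, δ ≤ z.im →
      ‖thetaSeries N a z‖ ≤ C * Real.exp (-(π * (M : ℝ) ^ 2 / (2 * N)) * (z.im - δ)) := by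
  have hs : Summable fun n : ℤ => Real.exp (-(π * δ / (2 * N)) * (n : ℝ) ^ 2) := by
    simpa using summable_pow_mul_exp_neg_sq (c := π * δ / (2 * N)) (by positivity) 0
  refine ⟨∑' n : ℤ, Real.exp (-(π * δ / (2 * N)) * (n : ℝ) ^ 2),
    tsum_nonneg fun n => (Real.exp_pos _).le, fun z hz => ?_⟩
  have ha0 : ∀ n, ‖a n‖ ≤ |(n : ℝ)| ^ 0 := by simpa using ha
  rw [← tsum_mul_right]
  refine tsum_of_norm_bounded (hs.mul_right _).hasSum fun n => ?_
  rw [norm_mul, norm_qPow_sq]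
  by_cases hn : n.natAbs < M
  · rw [hM n hn, norm_zero, zero_mul]; positivity
  · rw [← Real.exp_add]
    refine (mul_le_of_le_one_left (Real.exp_pos _).le (ha n)).trans (Real.exp_le_exp.2 ?_)
    have h1 : (M : ℝ) ^ 2 ≤ (n : ℝ) ^ 2 := by
      have : (M : ℝ) ≤ |(n : ℝ)| := by
        rw [← Int.cast_abs, Int.abs_eq_natAbs]
        exact_mod_cast not_lt.1 hn
      rw [← sq_abs (n : ℝ)]
      gcongr
    have h2 : (M : ℝ) ^ 2 * (z.im - δ) ≤ (n : ℝ) ^ 2 * (z.im - δ) := by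
      apply mul_le_mul_of_nonneg_right h1; linarith
    have h3 : 0 < π / (2 * N) := by positivity
    have h4 := mul_le_mul_of_nonneg_left h2 h3.le
    have e1 : -(π * z.im / (2 * N)) * (n : ℝ) ^ 2
      = -(π / (2 * N) * ((n : ℝ) ^ 2 * (z.im - δ))) - π * δ / (2 * N) * (n : ℝ) ^ 2 := by
      ring
    have e2 : -(π * (M : ℝ) ^ 2 / (2 * N)) * (z.im - δ)
      = -(π / (2 * N) * ((M : ℝ) ^ 2 * (z.im - δ))) := by ring
    rw [e1, e2]
    linarith

/-- An even theta series with bounded coefficients that vanishes identically has coefficients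
zero. -/
lemma eq_zero_of_thetaSeries_eq_zero {N : ℝ} (hN : 0 < N) {a : ℤ → ℂ} (ha : ∀ n, ‖a n‖ ≤ 1)
    (heven : ∀ n, a (-n) = a n) (h : ∀ z : ℂ, 0 < z.im → thetaSeries N a z = 0) (n : ℤ) :
    a n = 0 := by
  have main : ∀ M : ℕ, ∀ n : ℤ, n.natAbs < M → a n = 0 := by
    intro M
    induction M with
    | zero => intro n hn; omega
    | succ M ih =>
      have haM : a M = 0 := by
        by_contra hne
        -- Without its terms `|n| = M` the series decays like `e^{-c(M+1)²t}` on the imaginary axis,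
        -- yet by hypothesis it equals minus those terms, which have exact size `e^{-cM²t}`.
        set b : ℤ → ℂ := fun n => if n.natAbs = M then 0 else a n with hb
        have hb1 : ∀ n, ‖b n‖ ≤ 1 := by
          intro n
          simp only [hb]
          split_ifs
          · simp
          · exact ha n
        have hb2 : ∀ n : ℤ, n.natAbs < M + 1 → b n = 0 := by
          intro n hn
          simp only [hb]
          split_ifs with hc
          · rfl
          · exact ih n (by omega)
        obtain ⟨C, hC, hbd⟩ := exists_norm_thetaSeries_le hN hb1 hb2 one_pos
        -- the terms with `|n| = M`
        set S : Finset ℤ := {(M : ℤ), -(M : ℤ)} with hS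
        have hdecomp : ∀ z : ℂ, 0 < z.im → thetaSeries N b z
            = -((S.card : ℂ) * a M * qPow z ((M : ℝ) ^ 2 / (4 * N))) := by
          intro z hz
          have hs1 := summable_thetaSeries hN (a := a) (j := 0) (by simpa using ha) hz
          have hs2 := summable_thetaSeries hN (a := b) (j := 0) (by simpa using hb1) hz
          have hsub := hs1.tsum_sub hs2
          have h0 : ∑' n : ℤ, a n * qPow z ((n : ℝ) ^ 2 / (4 * N)) = 0 := h z hz
          rw [h0, zero_sub] at hsub
          rw [thetaSeries, ← neg_eq_iff_eq_neg, ← hsub, tsum_eq_sum (s := S)]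
          · have : ∀ n ∈ S, a n * qPow z ((n : ℝ) ^ 2 / (4 * N)) - b n * qPow z ((n : ℝ) ^ 2 / (4 * N))
                = a M * qPow z ((M : ℝ) ^ 2 / (4 * N)) := by
              intro n hn
              rw [hS, Finset.mem_insert, Finset.mem_singleton] at hn
              rcases hn with rfl | rfl
              · simp [hb]
              · simp [hb, heven]
            rw [Finset.sum_congr rfl this, Finset.sum_const, nsmul_eq_mul, mul_assoc]
          · intro n hn
            have : n.natAbs ≠ M := by
              rw [hS, Finset.mem_insert, Finset.mem_singleton] at hn
              omega
            simp [hb, this]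
        -- `S` has one element for `M = 0` and two otherwise; the lower bound suffices.
        have hcard : 1 ≤ (S.card : ℝ) := by
          exact_mod_cast Finset.card_pos.2 ⟨(M : ℤ), by simp [hS]⟩
        have key : ∀ t : ℝ, 1 ≤ t → ‖a M‖ ≤ C * Real.exp (π * ((M : ℝ) + 1) ^ 2 / (2 * N))
            * Real.exp (-(π / (2 * N)) * t) := by
          intro t ht
          have h1 := hbd (I * t) (by simpa using ht)
          rw [hdecomp (I * t) (by simp; linarith), norm_neg, norm_mul, norm_mul] at h1
          have h2 := norm_qPow_sq N (I * t) M
          simp only [Int.cast_natCast] at h2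
          rw [h2] at h1
          simp only [mul_im, I_re, ofReal_im, mul_zero, I_im, ofReal_re, one_mul, zero_add,
            RCLike.norm_natCast] at h1
          have h3 : ‖a M‖ * Real.exp (-(π * t / (2 * N)) * (M : ℝ) ^ 2)
              ≤ C * Real.exp (-(π * ((M + 1 : ℕ) : ℝ) ^ 2 / (2 * N)) * (t - 1)) := by
            refine le_trans ?_ h1
            rw [mul_assoc]
            exact le_mul_of_one_le_left (by positivity) hcard
          rw [← le_div_iff₀ (Real.exp_pos _), mul_div_assoc, ← Real.exp_sub] at h3
          refine h3.trans ?_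
          rw [mul_assoc, ← Real.exp_add]
          refine mul_le_mul_of_nonneg_left (Real.exp_le_exp.2 ?_) hC
          have hMt : 0 ≤ 2 * (M : ℝ) * (π / (2 * N)) * t := by positivity
          push_cast
          have : -(π * ((M : ℝ) + 1) ^ 2 / (2 * N)) * (t - 1) - -(π * t / (2 * N)) * (M : ℝ) ^ 2
            = π * ((M : ℝ) + 1) ^ 2 / (2 * N) + -(π / (2 * N)) * t
              - 2 * (M : ℝ) * (π / (2 * N)) * t := by ring
          rw [this]
          linarith
        have hlim : Tendsto (fun t : ℝ => C * Real.exp (π * ((M : ℝ) + 1) ^ 2 / (2 * N))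
            * Real.exp (-(π / (2 * N)) * t)) atTop (𝓝 0) := by
          rw [← mul_zero (C * Real.exp (π * ((M : ℝ) + 1) ^ 2 / (2 * N)))]
          refine Tendsto.const_mul _ (Real.tendsto_exp_atBot.comp ?_)
          exact tendsto_id.const_mul_atTop_of_neg (by rw [neg_lt_zero]; positivity)
        have : ‖a M‖ ≤ 0 := ge_of_tendsto hlim (eventually_atTop.2 ⟨1, key⟩)
        exact hne (norm_le_zero_iff.1 this)
      intro n hn
      rcases Nat.lt_succ_iff_lt_or_eq.1 hn with h' | h'
      · exact ih n h'
      · rcases Int.natAbs_eq n with h2 | h2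
        · rw [h2, h', haM]
        · rw [h2, h', heven, haM]
  exact main (n.natAbs + 1) n (Nat.lt_succ_self _)

/-! ### The characters as theta series -/

lemma hasSum_ite_dvd {M b : ℤ} (hM : M ≠ 0) {g : ℤ → ℂ} {A : ℂ}
    (h : HasSum (fun m : ℤ => g (b + M * m)) A) :
    HasSum (fun n : ℤ => if M ∣ n - b then g n else 0) A := by
  have hinj : Function.Injective fun m : ℤ => b + M * m := fun m₁ m₂ hm => by
    have : M * m₁ = M * m₂ := by simpa using hm
    exact mul_left_cancel₀ hM this
  rw [← hinj.hasSum_iff]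
  · refine h.congr_fun ?_
    intro m
    simp
  · intro n hn
    refine if_neg ?_
    rintro ⟨m, hm⟩
    exact hn ⟨m, by simp only; linarith⟩

lemma hasSum_progression_neg {M b : ℤ} {g : ℤ → ℂ} (hg : ∀ n, g (-n) = g n) {A : ℂ}
    (h : HasSum (fun m : ℤ => g (b + M * m)) A) : HasSum (fun m : ℤ => g (-b + M * m)) A := by
  rw [← (Equiv.neg ℤ).hasSum_iff]
  refine h.congr_fun fun m => ?_
  simp only [Function.comp, Equiv.neg_apply]
  rw [← hg]
  congr 1
  ring

/-- For even `g` the classes of `b` and `-b` have equal sums, so the factors `1/2` combine to one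
copy of each progression. -/
lemma hasSum_thetaCoeff_mul {pp pm : ℕ} (hpp : 2 ≤ pp) (hpm : 2 ≤ pm) {k : ℕ × ℕ} {g : ℤ → ℂ}
    (hg : ∀ n, g (-n) = g n) {A B : ℂ}
    (hA : HasSum (fun m : ℤ => g ((pp * k.2 - pm * k.1) + 2 * pp * pm * m)) A)
    (hB : HasSum (fun m : ℤ => g ((pp * k.2 + pm * k.1) + 2 * pp * pm * m)) B) :
    HasSum (fun n : ℤ => (thetaCoeff pp pm k n : ℂ) * g n) (A - B) := by
  have hM : (2 * pp * pm : ℤ) ≠ 0 := by positivity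
  have h1 := hasSum_ite_dvd hM hA
  have h2 := hasSum_ite_dvd hM (hasSum_progression_neg hg hA)
  have h3 := hasSum_ite_dvd hM hB
  have h4 := hasSum_ite_dvd hM (hasSum_progression_neg hg hB)
  have h := (((h1.add h2).sub h3).sub h4).div_const 2
  rw [show (A + A - B - B) / 2 = A - B by ring] at h
  refine h.congr_fun fun n => ?_
  simp only [sub_neg_eq_add, thetaCoeff]
  push_cast
  simp only [apply_ite ((↑) : ℝ → ℂ), ofReal_one, ofReal_zero]
  split_ifs <;> ring

/-- The half-argument `q`-power `q^{n²/(4N)}` with `N = p₊ p₋`. -/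
abbrev qSq (pp pm : ℕ) (z : ℂ) (n : ℤ) : ℂ := qPow z ((n : ℝ) ^ 2 / (4 * (pp * pm : ℝ)))

lemma qSq_neg (pp pm : ℕ) (z : ℂ) (n : ℤ) : qSq pp pm z (-n) = qSq pp pm z n := by
  simp [qSq]

lemma summable_qSq {pp pm : ℕ} (hpp : 2 ≤ pp) (hpm : 2 ≤ pm) {z : ℂ} (hz : 0 < z.im) (j : ℕ)
    (c : ℂ) : Summable fun n : ℤ => (|(n : ℝ)| ^ j : ℝ) * c * qSq pp pm z n := by
  have := (summable_thetaSeries (N := pp * pm) (by positivity)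
    (a := fun n : ℤ => ((|(n : ℝ)| ^ j : ℝ) : ℂ)) (j := j) (by simp) hz).mul_left c
  refine this.congr fun n => ?_
  ring

lemma summable_progression {M b : ℤ} (hM : M ≠ 0) {g : ℤ → ℂ} (hg : Summable g) :
    Summable fun m : ℤ => g (b + M * m) := by
  refine hg.comp_injective (i := fun m : ℤ => b + M * m) fun m₁ m₂ hm => ?_
  have : M * m₁ = M * m₂ := by simpa using hm
  exact mul_left_cancel₀ hM this

/-- With `R = √(2p₊p₋)` one has `α₊ = R/p₊` and `α₋ = -R/p₋`, so the shifted weight is `R/(2p₊p₋)`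
times an integer. This is how every Fock character becomes a theta term. -/
lemma alphaRS_sub {pp pm : ℕ} (hpp : 2 ≤ pp) (hpm : 2 ≤ pm) (r s n : ℤ) :
    (alphaRS pp pm r s n - alphaZero pp pm / 2) ^ 2 / 2
      = ((pp * s - pm * r + pp * pm * n : ℤ) : ℝ) ^ 2 / (4 * (pp * pm : ℝ)) := by
  have hp : (0 : ℝ) < pp := by positivity
  have hm : (0 : ℝ) < pm := by positivity
  set R := √(2 * pp * pm : ℝ) with hR
  have hR2 : R ^ 2 = 2 * pp * pm := Real.sq_sqrt (by positivity)
  have h1 : alphaPlus pp pm = R / pp := by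
    rw [alphaPlus, hR, show (2 * pm / pp : ℝ) = 2 * pp * pm / pp ^ 2 by field_simp,
      Real.sqrt_div (by positivity), Real.sqrt_sq hp.le]
  have h2 : alphaMinus pp pm = -(R / pm) := by
    rw [alphaMinus, hR, show (2 * pp / pm : ℝ) = 2 * pp * pm / pm ^ 2 by field_simp,
      Real.sqrt_div (by positivity), Real.sqrt_sq hm.le]
  have h3 : alphaRS pp pm r s n - alphaZero pp pm / 2
      = R * ((pp * s - pm * r + pp * pm * n : ℤ) : ℝ) / (2 * pp * pm) := by
    rw [alphaRS, alphaZero, h1, h2, ← hR]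
    push_cast
    field_simp
    ring
  rw [h3, div_pow, mul_pow, hR2]
  push_cast
  field_simp
  ring

lemma eta_mul_chFock {pp pm : ℕ} (hpp : 2 ≤ pp) (hpm : 2 ≤ pm) (r s n : ℤ) {z : ℂ}
    (hz : 0 < z.im) : ModularForm.eta z * chFock pp pm (alphaRS pp pm r s n) z
      = qSq pp pm z (pp * s - pm * r + pp * pm * n) := by
  rw [chFock, alphaRS_sub hpp hpm, mul_div_cancel₀ _ (ModularForm.eta_ne_zero hz)]

lemma hasSum_cuspVec {pp pm : ℕ} (hpp : 2 ≤ pp) (hpm : 2 ≤ pm) (k : kacTable pp pm) {z : ℂ}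
    (hz : 0 < z.im) :
    HasSum (fun n : ℤ => (thetaCoeff pp pm k n : ℂ) * qSq pp pm z n) (cuspVec pp pm z k) := by
  have hM : (2 * pp * pm : ℤ) ≠ 0 := by positivity
  have hs : Summable (qSq pp pm z) := by simpa using summable_qSq hpp hpm hz 0 1
  have hA := (summable_progression (b := pp * k.1.2 - pm * k.1.1) hM hs).hasSum
  have hB := (summable_progression (b := pp * k.1.2 + pm * k.1.1) hM hs).hasSum
  have h := hasSum_thetaCoeff_mul hpp hpm (qSq_neg pp pm z) hA hB
  convert h using 1
  rw [cuspVec, chVir, ← tsum_mul_left, ← hA.summable.tsum_sub hB.summable]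
  refine tsum_congr fun m => ?_
  rw [mul_sub, eta_mul_chFock hpp hpm _ _ _ hz, eta_mul_chFock hpp hpm _ _ _ hz]
  -- The index of the second Fock module is `p₊s - p₋(p₊ - r) + N(2k + 1) = (p₊s + p₋r) + 2Nk`.
  congr 2 <;> ring

lemma cuspVec_eq_thetaSeries {pp pm : ℕ} (hpp : 2 ≤ pp) (hpm : 2 ≤ pm) (k : kacTable pp pm) {z : ℂ}
    (hz : 0 < z.im) :
    cuspVec pp pm z k = thetaSeries (pp * pm) (fun n => (thetaCoeff pp pm k n : ℂ)) z :=
  (hasSum_cuspVec hpp hpm k hz).tsum_eq.symm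

/-- The sum of `|n| q^{n²/(4N)}` over a residue class modulo `2N`, split at zero. -/
lemma hasSum_abs_progression {pp pm : ℕ} (hpp : 2 ≤ pp) (hpm : 2 ≤ pm) {b : ℤ} (hb : 0 < b)
    (hb' : b < 2 * pp * pm) {z : ℂ} (hz : 0 < z.im) :
    HasSum (fun m : ℤ => ((|((b + 2 * pp * pm * m : ℤ) : ℝ)| : ℝ) : ℂ)
        * (1 / (2 * pp * pm)) * qSq pp pm z (b + 2 * pp * pm * m))
      (∑' k : ℕ, ((k : ℂ) + 1) * (qSq pp pm z (b + 2 * pp * pm * (k + 1))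
          + qSq pp pm z (-b + 2 * pp * pm * (k + 1)))
        + (b : ℂ) / (2 * pp * pm) * (partialTheta (pp * pm) b z
          - partialTheta (pp * pm) (2 * pp * pm - b) z)) := by
  have hM : (2 * pp * pm : ℤ) ≠ 0 := by positivity
  have hpC : (pp : ℂ) ≠ 0 := Nat.cast_ne_zero.2 (by omega)
  have hmC : (pm : ℂ) ≠ 0 := Nat.cast_ne_zero.2 (by omega)
  have hpR : (pp : ℝ) ≠ 0 := by positivity
  have hmR : (pm : ℝ) ≠ 0 := by positivity
  have hs0 : Summable (qSq pp pm z) := by simpa using summable_qSq hpp hpm hz 0 1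
  have hs1 := summable_qSq hpp hpm hz 1 (1 / (2 * pp * pm))
  simp only [pow_one] at hs1
  have hp1 : Summable fun k : ℕ => ((|((b + 2 * pp * pm * k : ℤ) : ℝ)| : ℝ) : ℂ)
        * (1 / (2 * pp * pm)) * qSq pp pm z (b + 2 * pp * pm * k) :=
    (summable_progression (b := b) hM hs1).comp_injective Nat.cast_injective
  have hn1 : Summable fun k : ℕ => ((|((-b + 2 * pp * pm * (k + 1 : ℕ) : ℤ) : ℝ)| : ℝ) : ℂ)
        * (1 / (2 * pp * pm)) * qSq pp pm z (-b + 2 * pp * pm * (k + 1 : ℕ)) :=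
    (summable_progression (b := -b) hM hs1).comp_injective
      (Nat.cast_injective.comp (add_left_injective 1))
  have hp0 : Summable fun k : ℕ => qSq pp pm z (b + 2 * pp * pm * k) :=
    (summable_progression (b := b) hM hs0).comp_injective Nat.cast_injective
  have hn0 : Summable fun k : ℕ => qSq pp pm z (-b + 2 * pp * pm * (k + 1 : ℕ)) :=
    (summable_progression (b := -b) hM hs0).comp_injective
      (Nat.cast_injective.comp (add_left_injective 1))
  obtain ⟨X, hX⟩ := hp1
  obtain ⟨Y, hY⟩ := hn1
  have hP : partialTheta (pp * pm) b z = ∑' k : ℕ, qSq pp pm z (b + 2 * pp * pm * k) := by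
    refine tsum_congr fun k => ?_
    congr 1
    push_cast
    field_simp
    ring
  have hQ : partialTheta (pp * pm) (2 * pp * pm - b) z
      = ∑' k : ℕ, qSq pp pm z (-b + 2 * pp * pm * (k + 1 : ℕ)) := by
    refine tsum_congr fun k => ?_
    congr 1
    push_cast
    field_simp
    ring
  -- For `m ≥ 0` the weight is `m + b/(2N)`: the part `m` feeds the weighted sum, the constant feeds
  -- `P_b`.
  have hp2 : HasSum (fun k : ℕ => (k : ℂ) * qSq pp pm z (b + 2 * pp * pm * k))
      (X - (b : ℂ) / (2 * pp * pm) * ∑' k : ℕ, qSq pp pm z (b + 2 * pp * pm * k)) := by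
    refine (hX.sub (hp0.hasSum.mul_left _)).congr_fun fun k => ?_
    have : (0 : ℝ) ≤ ((b + 2 * pp * pm * k : ℤ) : ℝ) := by exact_mod_cast by positivity
    rw [abs_of_nonneg this]
    push_cast
    field_simp
    ring
  -- For `m = -(k+1)` the weight is `(k+1) - b/(2N)`, which explains the opposite sign of
  -- `P_{2N-b}`.
  have hn2 : HasSum (fun k : ℕ => ((k : ℂ) + 1) * qSq pp pm z (-b + 2 * pp * pm * (k + 1 : ℕ)))
      (Y + (b : ℂ) / (2 * pp * pm)
          * ∑' k : ℕ, qSq pp pm z (-b + 2 * pp * pm * (k + 1 : ℕ))) := by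
    refine (hY.add (hn0.hasSum.mul_left _)).congr_fun fun k => ?_
    have : (0 : ℝ) ≤ ((-b + 2 * pp * pm * (k + 1 : ℕ) : ℤ) : ℝ) := by
      have : (0 : ℤ) ≤ 2 * pp * pm * k := by positivity
      exact_mod_cast by push_cast; linarith
    rw [abs_of_nonneg this]
    push_cast
    field_simp
    ring
  have hp3 : HasSum (fun k : ℕ => ((k : ℂ) + 1) * qSq pp pm z (b + 2 * pp * pm * (k + 1)))
      (X - (b : ℂ) / (2 * pp * pm) * ∑' k : ℕ, qSq pp pm z (b + 2 * pp * pm * k)) := by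
    -- The term `k = 0` has weight zero, so the index shift costs nothing.
    have := (hasSum_nat_add_iff' 1).2 hp2
    simp only [Finset.range_one, Finset.sum_singleton, Nat.cast_zero, zero_mul, sub_zero] at this
    refine this.congr_fun fun k => ?_
    push_cast
    ring_nf
  have h4 := hp3.add hn2
  have e : ∑' k : ℕ, ((k : ℂ) + 1) * (qSq pp pm z (b + 2 * pp * pm * (k + 1))
          + qSq pp pm z (-b + 2 * pp * pm * (k + 1)))
      = ∑' k : ℕ, (((k : ℂ) + 1) * qSq pp pm z (b + 2 * pp * pm * (k + 1))
          + ((k : ℂ) + 1) * qSq pp pm z (-b + 2 * pp * pm * (k + 1 : ℕ))) :=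
    tsum_congr fun k => by push_cast; ring
  rw [e, h4.tsum_eq, hP, hQ]
  have hn1' : HasSum (fun k : ℕ => ((|((b + 2 * pp * pm * (-(k + 1 : ℤ)) : ℤ) : ℝ)| : ℝ) : ℂ)
        * (1 / (2 * pp * pm)) * qSq pp pm z (b + 2 * pp * pm * (-(k + 1 : ℤ)))) Y := by
    refine hY.congr_fun fun k => ?_
    have e : b + 2 * pp * pm * (-(k + 1 : ℤ)) = -(-b + 2 * pp * pm * (k + 1 : ℕ)) := by
      push_cast
      ring
    rw [e, qSq_neg, Int.cast_neg, abs_neg]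
  convert HasSum.of_nat_of_neg_add_one
    (f := fun m : ℤ => ((|((b + 2 * pp * pm * m : ℤ) : ℝ)| : ℝ) : ℂ)
        * (1 / (2 * pp * pm)) * qSq pp pm z (b + 2 * pp * pm * m)) hX hn1' using 1
  ring

lemma label_bounds {pp pm : ℕ} {k : ℕ × ℕ} (hk : k ∈ kacTable pp pm) :
    (0 : ℤ) < pp * k.2 - pm * k.1 ∧ (pp * k.2 + pm * k.1 : ℤ) < 2 * pp * pm ∧
      (pp * k.2 - pm * k.1 : ℤ) < 2 * pp * pm ∧ (0 : ℤ) < pp * k.2 + pm * k.1 := by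
  obtain ⟨⟨hr1, hr2⟩, ⟨hs1, hs2⟩, hrs⟩ := mem_kacTable.1 hk
  zify at hr1 hr2 hs1 hs2 hrs
  have h1 : (pp * k.2 : ℤ) < pp * pm := by nlinarith
  have h2 : (pm * k.1 : ℤ) < pp * pm := by nlinarith
  have h3 : (0 : ℤ) < pm * k.1 := by nlinarith
  refine ⟨by linarith, by linarith, by linarith, by linarith⟩

/-- The minus sign arises because `thetaCoeff` is positive on the class of `b'` and negative on that
of `b`, while `χ̃` has the signs reversed. -/
lemma hasSum_chiTilde {pp pm : ℕ} (hpp : 2 ≤ pp) (hpm : 2 ≤ pm) (k : kacTable pp pm) {z : ℂ}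
    (hz : 0 < z.im) :
    HasSum (fun n : ℤ => (thetaCoeff pp pm k n : ℂ)
      * (((|(n : ℝ)| : ℝ) : ℂ) * (1 / (2 * pp * pm)) * qSq pp pm z n))
      (-chiTilde pp pm k.1.1 k.1.2 z) := by
  obtain ⟨hb1, hb2, hb3, hb4⟩ := label_bounds k.2
  have hA := hasSum_abs_progression hpp hpm hb1 hb3 hz
  have hB := hasSum_abs_progression hpp hpm hb4 hb2 hz
  have h := hasSum_thetaCoeff_mul hpp hpm (k := k.1)
    (g := fun n : ℤ => ((|(n : ℝ)| : ℝ) : ℂ) * (1 / (2 * pp * pm)) * qSq pp pm z n)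
    (fun n => by rw [qSq_neg]; push_cast; rw [abs_neg]) hA hB
  convert h using 1
  have hM : (2 * pp * pm : ℤ) ≠ 0 := by positivity
  have hs : ∀ b : ℤ, Summable fun k : ℕ => ((k : ℂ) + 1) * qSq pp pm z (b + 2 * pp * pm * (k + 1)) := by
    intro b
    have hs0 : Summable (qSq pp pm z) := by simpa using summable_qSq hpp hpm hz 0 1
    have hs1 : Summable fun n : ℤ => ((n : ℂ)) * qSq pp pm z n := by
      have := summable_thetaSeries (N := pp * pm) (by positivity)
        (a := fun n : ℤ => (n : ℂ)) (j := 1) (by simp) hz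
      exact this
    have hp0 : Summable fun k : ℕ => qSq pp pm z (b + 2 * pp * pm * (k + 1 : ℕ)) :=
      (summable_progression (b := b) hM hs0).comp_injective
        (Nat.cast_injective.comp (add_left_injective 1))
    have hp1 : Summable fun k : ℕ => ((b + 2 * pp * pm * (k + 1 : ℕ) : ℤ) : ℂ)
        * qSq pp pm z (b + 2 * pp * pm * (k + 1 : ℕ)) :=
      (summable_progression (b := b) hM hs1).comp_injective
        (Nat.cast_injective.comp (add_left_injective 1))
    have hpC : (pp : ℂ) ≠ 0 := Nat.cast_ne_zero.2 (by omega)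
    have hmC : (pm : ℂ) ≠ 0 := Nat.cast_ne_zero.2 (by omega)
    refine ((hp1.sub (hp0.mul_left (b : ℂ))).mul_left (1 / (2 * pp * pm : ℂ))).congr fun k => ?_
    push_cast
    field_simp
    ring
  have hs2 : ∀ b : ℤ, Summable fun k : ℕ => ((k : ℂ) + 1)
      * (qSq pp pm z (b + 2 * pp * pm * (k + 1)) + qSq pp pm z (-b + 2 * pp * pm * (k + 1))) := by
    intro b
    simp only [mul_add]
    simpa only [mul_add] using (hs b).add (hs (-b))
  rw [chiTilde, chAtypical, ← tsum_mul_left]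
  have key : ∑' n : ℕ, ModularForm.eta z * (((n : ℂ) + 1) *
      (chFock pp pm (alphaRS pp pm (pp - k.1.1) k.1.2 (-2 * n - 1)) z
      + chFock pp pm (alphaRS pp pm k.1.1 (pm - k.1.2) (-2 * n - 3)) z
      - chFock pp pm (alphaRS pp pm k.1.1 k.1.2 (-2 * n - 2)) z
      - chFock pp pm (alphaRS pp pm (pp - k.1.1) (pm - k.1.2) (-2 * n - 2)) z))
      = ∑' n : ℕ, ((n : ℂ) + 1) * (qSq pp pm z ((pp * k.1.2 + pm * k.1.1) + 2 * pp * pm * (n + 1))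
          + qSq pp pm z (-(pp * k.1.2 + pm * k.1.1) + 2 * pp * pm * (n + 1)))
        - ∑' n : ℕ, ((n : ℂ) + 1) * (qSq pp pm z ((pp * k.1.2 - pm * k.1.1) + 2 * pp * pm * (n + 1))
          + qSq pp pm z (-(pp * k.1.2 - pm * k.1.1) + 2 * pp * pm * (n + 1))) := by
    rw [← (hs2 _).tsum_sub (hs2 _)]
    refine tsum_congr fun n => ?_
    have e1 := eta_mul_chFock hpp hpm (pp - k.1.1) k.1.2 (-2 * n - 1) hz
    have e2 := eta_mul_chFock hpp hpm k.1.1 (pm - k.1.2) (-2 * n - 3) hz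
    have e3 := eta_mul_chFock hpp hpm k.1.1 k.1.2 (-2 * n - 2) hz
    have e4 := eta_mul_chFock hpp hpm (pp - k.1.1) (pm - k.1.2) (-2 * n - 2) hz
    -- Each of the four Fock indices lies, after a change of overall sign that `qSq` does not see,
    -- in a progression of `±b` or `±b'`.
    have f1 : qSq pp pm z (pp * k.1.2 - pm * (pp - k.1.1) + pp * pm * (-2 * n - 1))
        = qSq pp pm z (-(pp * k.1.2 + pm * k.1.1) + 2 * pp * pm * (n + 1)) := by
      rw [← qSq_neg]; congr 1; ring
    have f2 : qSq pp pm z (pp * (pm - k.1.2) - pm * k.1.1 + pp * pm * (-2 * n - 3))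
        = qSq pp pm z ((pp * k.1.2 + pm * k.1.1) + 2 * pp * pm * (n + 1)) := by
      rw [← qSq_neg]; congr 1; ring
    have f3 : qSq pp pm z (pp * k.1.2 - pm * k.1.1 + pp * pm * (-2 * n - 2))
        = qSq pp pm z (-(pp * k.1.2 - pm * k.1.1) + 2 * pp * pm * (n + 1)) := by
      rw [← qSq_neg]; congr 1; ring
    have f4 : qSq pp pm z (pp * (pm - k.1.2) - pm * (pp - k.1.1) + pp * pm * (-2 * n - 2))
        = qSq pp pm z ((pp * k.1.2 - pm * k.1.1) + 2 * pp * pm * (n + 1)) := by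
      rw [← qSq_neg]; congr 1; ring
    rw [f1] at e1
    rw [f2] at e2
    rw [f3] at e3
    rw [f4] at e4
    linear_combination ((n : ℂ) + 1) * (e1 + e2 - e3 - e4)
  rw [key]
  push_cast
  ring

/-! ### Modular transformation of the vector `f` -/

lemma ofReal_pos_mul_cpow {r : ℝ} (hr : 0 < r) {z : ℂ} (hz : z ≠ 0) (s : ℂ) :
    ((r : ℂ) * z) ^ s = (r : ℂ) ^ s * z ^ s := by
  have hr' : (r : ℂ) ≠ 0 := ofReal_ne_zero.2 hr.ne'
  rw [cpow_def_of_ne_zero (mul_ne_zero hr' hz), cpow_def_of_ne_zero hr', cpow_def_of_ne_zero hz,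
    log_ofReal_mul hr hz, ← exp_add, ofReal_log hr.le, add_mul]

lemma sqrt_eq_cpow {r : ℝ} (hr : 0 ≤ r) : (r : ℂ) ^ (1 / 2 : ℂ) = ((√r : ℝ) : ℂ) := by
  rw [Real.sqrt_eq_rpow, ofReal_cpow hr]
  norm_num

/-- The Poisson dual of a theta series over a residue class modulo `2N`. -/
lemma tsum_progression_eq {pp pm : ℕ} (hpp : 2 ≤ pp) (hpm : 2 ≤ pm) (b : ℤ) {z : ℂ}
    (hz : 0 < z.im) :
    ∑' m : ℤ, qSq pp pm z (b + 2 * pp * pm * m)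
      = 1 / (((√(2 * (pp * pm) : ℝ) : ℝ) : ℂ) * (-I * z) ^ (1 / 2 : ℂ))
        * jacobiTheta₂ (b / (2 * (pp * pm))) (-1 / (2 * (pp * pm) * z)) := by
  have hpC : (pp : ℂ) ≠ 0 := Nat.cast_ne_zero.2 (by omega)
  have hmC : (pm : ℂ) ≠ 0 := Nat.cast_ne_zero.2 (by omega)
  have hz0 : z ≠ 0 := fun h => by simp [h] at hz
  have hN : (0 : ℝ) < 2 * (pp * pm : ℝ) := by positivity
  have h1 : ∑' m : ℤ, qSq pp pm z (b + 2 * pp * pm * m)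
      = exp (2 * π * I * z * (b ^ 2 / (4 * (pp * pm))))
        * jacobiTheta₂ (b * z) (2 * (pp * pm) * z) := by
    rw [jacobiTheta₂, ← tsum_mul_left]
    refine tsum_congr fun m => ?_
    rw [qSq, qPow, jacobiTheta₂_term, ← exp_add]
    congr 1
    push_cast
    field_simp
    ring
  rw [h1, jacobiTheta₂_functional_equation]
  have h2 : (-I * (2 * (pp * pm) * z)) ^ (1 / 2 : ℂ)
      = ((√(2 * (pp * pm) : ℝ) : ℝ) : ℂ) * (-I * z) ^ (1 / 2 : ℂ) := by
    rw [← sqrt_eq_cpow hN.le, ← ofReal_pos_mul_cpow hN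
      (mul_ne_zero (neg_ne_zero.2 I_ne_zero) hz0)]
    congr 1
    push_cast
    ring
  have h3 : exp (2 * π * I * z * (b ^ 2 / (4 * (pp * pm))))
      * exp (-π * I * (b * z) ^ 2 / (2 * (pp * pm) * z)) = 1 := by
    rw [← exp_add, ← exp_zero]
    congr 1
    field_simp
    ring
  rw [h2]
  have h4 : (b * z) / (2 * (pp * pm) * z) = (b : ℂ) / (2 * (pp * pm)) := by field_simp
  rw [h4]
  linear_combination (1 / (((√(2 * (pp * pm) : ℝ) : ℝ) : ℂ) * (-I * z) ^ (1 / 2 : ℂ))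
    * jacobiTheta₂ (b / (2 * (pp * pm))) (-1 / (2 * (pp * pm) * z))) * h3

/-- The Jacobi theta function is even in its argument; averaging its series over `±b/(2N)` turns
exponentials into cosines and yields a theta series in `-1/z` of the same shape. -/
lemma hasSum_two_cos_mul {pp pm : ℕ} (hpp : 2 ≤ pp) (hpm : 2 ≤ pm) (b : ℤ) {z : ℂ}
    (hz : 0 < z.im) :
    HasSum (fun n : ℤ => ((Real.cos (π * n * b / (pp * pm)) : ℝ) : ℂ) * qSq pp pm (-1 / z) n)
      (jacobiTheta₂ (b / (2 * (pp * pm))) (-1 / (2 * (pp * pm) * z))) := by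
  have hpC : (pp : ℂ) ≠ 0 := Nat.cast_ne_zero.2 (by omega)
  have hmC : (pm : ℂ) ≠ 0 := Nat.cast_ne_zero.2 (by omega)
  have hz0 : z ≠ 0 := fun h => by simp [h] at hz
  have him : 0 < (-1 / (2 * (pp * pm) * z) : ℂ).im := by
    have h2 : (-1 / (2 * (pp * pm) * z) : ℂ) = ((1 / (2 * (pp * pm)) : ℝ) : ℂ) * (-z⁻¹) := by
      push_cast; field_simp
    rw [h2, im_ofReal_mul, neg_im, inv_im]
    have : 0 < normSq z := normSq_pos.2 hz0
    have hp : (0 : ℝ) < pp * pm := by positivity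
    have : 0 < z.im / normSq z := by positivity
    rw [neg_div, neg_neg]
    positivity
  have h1 := hasSum_jacobiTheta₂_term ((b : ℂ) / (2 * (pp * pm))) him
  have h2 := hasSum_jacobiTheta₂_term (-((b : ℂ) / (2 * (pp * pm)))) him
  rw [jacobiTheta₂_neg_left] at h2
  have h := (h1.add h2).div_const 2
  rw [add_self_div_two] at h
  refine h.congr_fun fun n => ?_
  rw [jacobiTheta₂_term, jacobiTheta₂_term, ofReal_cos, Complex.cos, qSq, qPow, add_div, add_div,
    add_mul, ← mul_div_right_comm, ← mul_div_right_comm, ← exp_add, ← exp_add]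
  congr 3
  · push_cast
    field_simp
    ring
  · push_cast
    field_simp
    ring

/-- The `S`-transformation of the vector `f`. -/
lemma cuspVec_S {pp pm : ℕ} (hpp : 2 ≤ pp) (hpm : 2 ≤ pm) (hcop : Nat.Coprime pp pm) {z : ℂ}
    (hz : 0 < z.im) (k : kacTable pp pm) :
    cuspVec pp pm z k = 1 / (-I * z) ^ (1 / 2 : ℂ)
      * (minimalS pp pm *ᵥ cuspVec pp pm (-1 / z)) k := by
  have hp : (pp : ℝ) ≠ 0 := by positivity
  have hm : (pm : ℝ) ≠ 0 := by positivity
  have hz0 : z ≠ 0 := fun h => by simp [h] at hz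
  have hz' : 0 < (-1 / z).im := by
    rw [neg_div, one_div, neg_im, inv_im, neg_div, neg_neg]
    exact div_pos hz (normSq_pos.2 hz0)
  have hM : (2 * pp * pm : ℤ) ≠ 0 := by positivity
  have hs : Summable (qSq pp pm z) := by simpa using summable_qSq hpp hpm hz 0 1
  have hA := (summable_progression (b := pp * k.1.2 - pm * k.1.1) hM hs).hasSum
  have hB := (summable_progression (b := pp * k.1.2 + pm * k.1.1) hM hs).hasSum
  rw [(hasSum_cuspVec hpp hpm k hz).unique
    (hasSum_thetaCoeff_mul hpp hpm (qSq_neg pp pm z) hA hB),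
    tsum_progression_eq hpp hpm _ hz, tsum_progression_eq hpp hpm _ hz]
  -- This `2` matches the one in the difference of two cosines as twice a product of sines.
  have hsq : √(2 * (pp * pm) : ℝ) * √(2 / (pp * pm)) = 2 := by
    rw [← Real.sqrt_mul (by positivity),
      show (2 * (pp * pm) * (2 / (pp * pm)) : ℝ) = 2 ^ 2 by field_simp,
      Real.sqrt_sq (by norm_num)]
  have hne : ((√(2 * (pp * pm) : ℝ) : ℝ) : ℂ) ≠ 0 :=
    ofReal_ne_zero.2 (Real.sqrt_pos.2 (by positivity)).ne'
  generalize √(2 * (pp * pm) : ℝ) = R at *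
  have h1 := (hasSum_two_cos_mul hpp hpm (pp * k.1.2 - pm * k.1.1) hz).sub
    (hasSum_two_cos_mul hpp hpm (pp * k.1.2 + pm * k.1.1) hz)
  have h2 : HasSum (fun n : ℤ => ∑ l : kacTable pp pm, minimalS pp pm k l
      * ((thetaCoeff pp pm l n : ℂ) * qSq pp pm (-1 / z) n))
      ((minimalS pp pm *ᵥ cuspVec pp pm (-1 / z)) k) :=
    hasSum_sum fun l _ => (hasSum_cuspVec hpp hpm l hz').mul_left _
  have h3 : HasSum (fun n : ℤ => (R : ℂ)
      * ∑ l : kacTable pp pm, minimalS pp pm k l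
      * ((thetaCoeff pp pm l n : ℂ) * qSq pp pm (-1 / z) n))
      (jacobiTheta₂ ((pp * k.1.2 - pm * k.1.1 : ℤ) / (2 * (pp * pm))) (-1 / (2 * (pp * pm) * z))
        - jacobiTheta₂ ((pp * k.1.2 + pm * k.1.1 : ℤ) / (2 * (pp * pm)))
          (-1 / (2 * (pp * pm) * z))) := by
    refine h1.congr_fun fun n => ?_
    simp only [← mul_assoc]
    rw [← Finset.sum_mul, sum_minimalS_mul_thetaCoeff hpp hpm hcop, ← sub_mul, ← mul_assoc,
      ← ofReal_mul, ← ofReal_sub, ← mul_assoc, hsq]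
    congr 2
    -- The difference of the dual series for `b'` and `b` has coefficients `2 sin · sin`, which the
    -- rows of the `S`-matrix expand in the `thetaCoeff`.
    rw [Real.cos_sub_cos, sinProd]
    have e1 : (π * n * ((pp * k.1.2 - pm * k.1.1 : ℤ) : ℝ) / (pp * pm)
        + π * n * ((pp * k.1.2 + pm * k.1.1 : ℤ) : ℝ) / (pp * pm)) / 2
        = π * n * k.1.2 / pm := by
      push_cast; field_simp; ring
    have e2 : (π * n * ((pp * k.1.2 - pm * k.1.1 : ℤ) : ℝ) / (pp * pm)
        - π * n * ((pp * k.1.2 + pm * k.1.1 : ℤ) : ℝ) / (pp * pm)) / 2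
        = -(π * n * k.1.1 / pp) := by
      push_cast; field_simp; ring
    rw [e1, e2, Real.sin_neg]
    ring
  have h4 := h3.unique (h2.mul_left _)
  rw [← mul_sub, h4]
  field_simp

/-- `T` acts diagonally: squares are constant modulo `4N` on the classes of `±b'` and of `±b`, and
`b² = b'² + 4N rs`. -/
lemma cuspVec_add_one {pp pm : ℕ} (hpp : 2 ≤ pp) (hpm : 2 ≤ pm) (k : kacTable pp pm) {z : ℂ}
    (hz : 0 < z.im) : cuspVec pp pm (z + 1) k
      = qPow 1 (((pp * k.1.2 - pm * k.1.1 : ℤ) : ℝ) ^ 2 / (4 * (pp * pm))) * cuspVec pp pm z k := by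
  have hpC : (pp : ℂ) ≠ 0 := Nat.cast_ne_zero.2 (by omega)
  have hmC : (pm : ℂ) ≠ 0 := Nat.cast_ne_zero.2 (by omega)
  have hz1 : 0 < (z + 1).im := by simpa using hz
  refine (hasSum_cuspVec hpp hpm k hz1).unique
    (((hasSum_cuspVec hpp hpm k hz).mul_left _).congr_fun fun n => ?_)
  -- on the support of the coefficients, `n²` is constant modulo `4N`
  by_cases h0 : thetaCoeff pp pm k n = 0
  · simp [h0]
  have key : ∃ j : ℤ, (n : ℝ) ^ 2 = ((pp * k.1.2 - pm * k.1.1 : ℤ) : ℝ) ^ 2 + 4 * pp * pm * j := by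
    have hc : (2 * pp * pm : ℤ) ∣ n - (pp * k.1.2 - pm * k.1.1) ∨
        (2 * pp * pm : ℤ) ∣ n + (pp * k.1.2 - pm * k.1.1) ∨
        (2 * pp * pm : ℤ) ∣ n - (pp * k.1.2 + pm * k.1.1) ∨
        (2 * pp * pm : ℤ) ∣ n + (pp * k.1.2 + pm * k.1.1) := by
      by_contra hne
      simp only [not_or] at hne
      exact h0 (by simp [thetaCoeff, hne])
    rcases hc with ⟨w, hw⟩ | ⟨w, hw⟩ | ⟨w, hw⟩ | ⟨w, hw⟩
    · refine ⟨(pp * k.1.2 - pm * k.1.1) * w + pp * pm * w ^ 2, ?_⟩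
      rw [show n = (pp * k.1.2 - pm * k.1.1) + 2 * pp * pm * w by linarith]
      push_cast; ring
    · refine ⟨-(pp * k.1.2 - pm * k.1.1) * w + pp * pm * w ^ 2, ?_⟩
      rw [show n = -(pp * k.1.2 - pm * k.1.1) + 2 * pp * pm * w by linarith]
      push_cast; ring
    · refine ⟨k.1.1 * k.1.2 + (pp * k.1.2 + pm * k.1.1) * w + pp * pm * w ^ 2, ?_⟩
      rw [show n = (pp * k.1.2 + pm * k.1.1) + 2 * pp * pm * w by linarith]
      push_cast; ring
    · refine ⟨k.1.1 * k.1.2 - (pp * k.1.2 + pm * k.1.1) * w + pp * pm * w ^ 2, ?_⟩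
      rw [show n = -(pp * k.1.2 + pm * k.1.1) + 2 * pp * pm * w by linarith]
      push_cast; ring
  obtain ⟨j, hj⟩ := key
  have e1 : qSq pp pm (z + 1) n
      = qPow 1 (((pp * k.1.2 - pm * k.1.1 : ℤ) : ℝ) ^ 2 / (4 * (pp * pm))) * qSq pp pm z n := by
    have hj' : (n : ℂ) ^ 2 = ((pp * k.1.2 - pm * k.1.1 : ℤ) : ℂ) ^ 2 + 4 * pp * pm * j := by
      exact_mod_cast hj
    rw [qSq, qSq, qPow, qPow, qPow, ← exp_add]
    rw [exp_eq_exp_iff_exists_int]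
    refine ⟨j, ?_⟩
    push_cast at hj' ⊢
    rw [hj']
    field_simp
    ring
  rw [e1]
  ring

/-- A vanishing combination is an even theta series with bounded coefficients, so every coefficient
is zero; the one at `n = b'` is half of the `k`-th scalar. -/
lemma cuspVec_indep {pp pm : ℕ} (hpp : 2 ≤ pp) (hpm : 2 ≤ pm) (hcop : Nat.Coprime pp pm)
    {c : kacTable pp pm → ℂ}
    (h : ∀ z : ℂ, 0 < z.im → ∑ k, c k * cuspVec pp pm z k = 0) : c = 0 := by
  -- Dividing by `A` brings the coefficients into the unit disc, as the uniqueness lemma for theta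
  -- series requires.
  set A : ℝ := 1 + ∑ k, ‖c k‖ with hA
  have hA0 : 0 < A := by positivity
  set a : ℤ → ℂ := fun n => (∑ k, c k * (thetaCoeff pp pm k n : ℂ)) / A with ha
  have hN : (0 : ℝ) < pp * pm := by positivity
  have hbound : ∀ n, ‖a n‖ ≤ 1 := by
    intro n
    rw [ha]
    simp only
    rw [norm_div, norm_real, Real.norm_of_nonneg hA0.le, div_le_one hA0]
    refine (norm_sum_le _ _).trans ?_
    rw [hA]
    refine le_add_of_nonneg_of_le zero_le_one (Finset.sum_le_sum fun k _ => ?_)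
    rw [norm_mul, norm_real]
    exact mul_le_of_le_one_right (norm_nonneg _) (abs_thetaCoeff_le _ _ _ _)
  have heven : ∀ n, a (-n) = a n := by
    intro n
    simp only [ha, thetaCoeff_neg]
  have hzero : ∀ z : ℂ, 0 < z.im → thetaSeries (pp * pm) a z = 0 := by
    intro z hz
    have h1 : HasSum (fun n : ℤ => ∑ k : kacTable pp pm, c k * ((thetaCoeff pp pm k n : ℂ)
        * qSq pp pm z n)) (∑ k, c k * cuspVec pp pm z k) :=
      hasSum_sum fun k _ => (hasSum_cuspVec hpp hpm k hz).mul_left _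
    rw [h z hz] at h1
    have h2 := h1.div_const (A : ℂ)
    rw [zero_div] at h2
    refine HasSum.tsum_eq (h2.congr_fun fun n => ?_)
    simp only [ha, ← mul_assoc]
    rw [← Finset.sum_mul]
    simp only [qSq]
    ring_nf
  have hall := eq_zero_of_thetaSeries_eq_zero hN hbound heven hzero
  funext k
  have h1 := hall (pp * k.1.2 - pm * k.1.1)
  simp only [ha] at h1
  rw [div_eq_zero_iff, or_iff_left (ofReal_ne_zero.2 hA0.ne')] at h1
  simp only [thetaCoeff_label hpp hpm hcop k.2 (Subtype.prop _), Subtype.coe_inj] at h1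
  rw [Finset.sum_eq_single k (fun l _ hl => by simp [hl]) (by simp)] at h1
  simpa using h1

/-- The data used of the vector `f`: a holomorphic vector-valued function on the upper half-plane
with linearly independent components, of weight `1/2` for `SL₂(ℤ)`, that decays at the cusp. -/
structure WeightHalf {ι : Type*} [Fintype ι] (f : ℂ → ι → ℂ) (M : Matrix ι ι ℂ) : Prop where
  diff : ∀ z : ℂ, 0 < z.im → ∀ k, DifferentiableAt ℂ (fun z => f z k) z
  decay : ∃ κ : ℝ, 0 < κ ∧ ∀ δ : ℝ, 0 < δ → ∃ C : ℝ, 0 ≤ C ∧ ∀ z : ℂ, δ ≤ z.im → ∀ k,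
    ‖f z k‖ ≤ C * Real.exp (-κ * z.im)
  trans_T : ∃ D : ι → ℂ, (∀ k, D k ≠ 0) ∧ ∀ z : ℂ, 0 < z.im → ∀ k, f (z + 1) k = D k * f z k
  trans_S : ∀ z : ℂ, 0 < z.im → f z = (1 / (-I * z) ^ (1 / 2 : ℂ)) • (M *ᵥ f (-1 / z))
  indep : ∀ c : ι → ℂ, (∀ z : ℂ, 0 < z.im → ∑ k, c k * f z k = 0) → c = 0

lemma weightHalf_cuspVec {pp pm : ℕ} (hpp : 2 ≤ pp) (hpm : 2 ≤ pm) (hcop : Nat.Coprime pp pm) :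
    WeightHalf (cuspVec pp pm) (minimalS pp pm) where
  diff z hz k := by
    have h1 := (hasDerivAt_thetaSeries (N := pp * pm) (by positivity)
      (a := fun n => (thetaCoeff pp pm k n : ℂ)) (j := 0)
      (by simpa using abs_thetaCoeff_le pp pm k) hz).differentiableAt
    refine h1.congr_of_eventuallyEq ?_
    filter_upwards [(isOpen_lt continuous_const continuous_im).mem_nhds hz] with w hw
    exact cuspVec_eq_thetaSeries hpp hpm k hw
  decay := by
    have hN : (0 : ℝ) < pp * pm := by positivity
    refine ⟨π / (2 * (pp * pm)), by positivity, fun δ hδ => ?_⟩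
    have h : ∀ k : kacTable pp pm, ∃ C, 0 ≤ C ∧ ∀ z : ℂ, δ ≤ z.im →
        ‖cuspVec pp pm z k‖ ≤ C * Real.exp (-(π / (2 * (pp * pm))) * z.im) := by
      intro k
      -- Taking `M = 1` is possible because the constant coefficient vanishes: this is cuspidality
      -- at `i∞`.
      obtain ⟨C, hC, hb⟩ := exists_norm_thetaSeries_le hN
        (a := fun n => (thetaCoeff pp pm k n : ℂ)) (M := 1)
        (by simpa using abs_thetaCoeff_le pp pm k)
        (fun n hn => by
          rw [show n = 0 by omega, thetaCoeff_zero hcop k.2, ofReal_zero]) hδ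
      refine ⟨C * Real.exp (π / (2 * (pp * pm)) * δ), by positivity, fun z hz => ?_⟩
      rw [cuspVec_eq_thetaSeries hpp hpm k (hδ.trans_le hz)]
      refine (hb z hz).trans (le_of_eq ?_)
      rw [mul_assoc, ← Real.exp_add]
      congr 2
      push_cast
      ring
    choose C hC hb using h
    refine ⟨∑ k, C k, Finset.sum_nonneg fun k _ => hC k, fun z hz k => (hb k z hz).trans ?_⟩
    exact mul_le_mul_of_nonneg_right
      (Finset.single_le_sum (fun l _ => hC l) (Finset.mem_univ k)) (Real.exp_pos _).le
  trans_T := ⟨fun k => qPow 1 (((pp * k.1.2 - pm * k.1.1 : ℤ) : ℝ) ^ 2 / (4 * (pp * pm))),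
    fun _ => exp_ne_zero _, fun z hz k => cuspVec_add_one hpp hpm k hz⟩
  trans_S z hz := funext fun k => cuspVec_S hpp hpm hcop hz k
  indep _ h := cuspVec_indep hpp hpm hcop h

/-! ### Consequences of linear independence. -/

section Modular

variable {ι : Type*} [Fintype ι] {f : ℂ → ι → ℂ} {M : Matrix ι ι ℂ}

/-- This reduces identities between matrices to identities between values of `f`, so no relation
between generators of the modular group has to be checked. -/
lemma WeightHalf.matrix_ext (hf : WeightHalf f M) {X Y : Matrix ι ι ℂ}
    (h : ∀ z : ℂ, 0 < z.im → X *ᵥ f z = Y *ᵥ f z) : X = Y := by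
  ext i j
  have h1 := hf.indep (fun j => X i j - Y i j) fun z hz => by
    have := congrFun (h z hz) i
    simp only [Matrix.mulVec, dotProduct] at this
    simp only [sub_mul, Finset.sum_sub_distrib, this, sub_self]
  exact sub_eq_zero.1 (congrFun h1 j)

lemma neg_one_div_im_pos {z : ℂ} (hz : 0 < z.im) : 0 < (-1 / z).im := by
  have hz0 : z ≠ 0 := fun h => by simp [h] at hz
  rw [neg_div, one_div, neg_im, inv_im, neg_div, neg_neg]
  exact div_pos hz (normSq_pos.2 hz0)

/-- Applying the `S`-law twice returns to `z`, and the two square roots are taken at inverse points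
of the right half-plane, so they cancel. -/
lemma WeightHalf.mul_self [DecidableEq ι] (hf : WeightHalf f M) : M * M = 1 := by
  refine hf.matrix_ext fun z hz => ?_
  have hz0 : z ≠ 0 := fun h => by simp [h] at hz
  have h1 := hf.trans_S _ hz
  have h2 := hf.trans_S _ (neg_one_div_im_pos hz)
  rw [show -1 / (-1 / z) = z by field_simp] at h2
  rw [h2, Matrix.mulVec_smul, smul_smul, Matrix.mulVec_mulVec] at h1
  have hre : 0 < (-I * z).re := by simpa using hz
  have hne : -I * z ≠ 0 := fun h => by simp [h] at hre
  have e : -I * (-1 / z) = (-I * z)⁻¹ := by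
    rw [mul_inv, inv_neg, inv_I, neg_neg]
    field_simp
  have harg : (-I * z).arg ≠ π := by
    intro h
    have := (arg_eq_pi_iff.1 h).1
    linarith
  have h3 : (-I * z) ^ (1 / 2 : ℂ) ≠ 0 := by
    rw [Ne, cpow_eq_zero_iff]
    simp [hz0]
  have h4 : 1 / (-I * z) ^ (1 / 2 : ℂ) * (1 / (-I * (-1 / z)) ^ (1 / 2 : ℂ)) = 1 := by
    rw [e, inv_cpow _ _ harg]
    field_simp
  rw [h4, one_smul] at h1
  rw [← h1, Matrix.one_mulVec]

end Modular

/-! ### The Möbius action -/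

/-- The denominator `c z + d`. -/
def den (γ : SL(2, ℤ)) (z : ℂ) : ℂ := (γ 1 0 : ℂ) * z + (γ 1 1 : ℂ)

lemma det_eq {R : Type*} [CommRing R] (γ : SL(2, ℤ)) :
    (γ 0 0 : R) * γ 1 1 - (γ 0 1 : R) * γ 1 0 = 1 := by
  have h := γ.det_coe
  rw [Matrix.det_fin_two] at h
  exact_mod_cast congrArg (Int.cast : ℤ → R) h

lemma sl_mul_apply (γ₁ γ₂ : SL(2, ℤ)) (i j : Fin 2) :
    (γ₁ * γ₂) i j = γ₁ i 0 * γ₂ 0 j + γ₁ i 1 * γ₂ 1 j := by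
  rw [Matrix.SpecialLinearGroup.coe_mul, Matrix.mul_apply, Fin.sum_univ_two]

lemma den_im (γ : SL(2, ℤ)) (z : ℂ) : (den γ z).im = γ 1 0 * z.im := by
  simp [den]

lemma den_ne_zero (γ : SL(2, ℤ)) {z : ℂ} (hz : z.im ≠ 0) : den γ z ≠ 0 := by
  intro h
  have h1 := congrArg im h
  rw [den_im, zero_im, mul_eq_zero, or_iff_left hz] at h1
  have h2 : (γ 1 0 : ℂ) = 0 := by exact_mod_cast h1
  rw [den, h2, zero_mul, zero_add] at h
  have h3 := det_eq (R := ℂ) γ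
  rw [h, h2] at h3
  simp at h3

lemma mob_mul {K : Type*} [Field K] (γ₁ γ₂ : SL(2, ℤ)) {z : K}
    (hz : (γ₂ 1 0 : K) * z + γ₂ 1 1 ≠ 0) : mob (γ₁ * γ₂) z = mob γ₁ (mob γ₂ z) := by
  have e : ∀ a b n D : K, D ≠ 0 → a * (n / D) + b = (a * n + b * D) / D := by
    intro a b n D hD
    field_simp
  unfold mob
  rw [e _ _ _ _ hz, e _ _ _ _ hz, div_div_div_cancel_right₀ hz]
  simp only [sl_mul_apply]
  push_cast
  congr 1 <;> ring

lemma den_mul (γ₁ γ₂ : SL(2, ℤ)) {z : ℂ} (hz : den γ₂ z ≠ 0) :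
    den (γ₁ * γ₂) z = den γ₁ (mob γ₂ z) * den γ₂ z := by
  rw [den, den, add_mul, mob, mul_assoc, show (γ₂ 1 0 : ℂ) * z + γ₂ 1 1 = den γ₂ z from rfl,
    div_mul_cancel₀ _ hz, den]
  simp only [sl_mul_apply]
  push_cast
  ring

lemma mob_sub_mob (γ : SL(2, ℤ)) {z w : ℂ} (hz : den γ z ≠ 0) (hw : den γ w ≠ 0) :
    mob γ z - mob γ w = (z - w) / (den γ z * den γ w) := by
  have h := det_eq (R := ℂ) γ
  unfold den at *
  unfold mob
  rw [div_sub_div _ _ hz hw]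
  congr 1
  linear_combination (z - w) * h

lemma mob_conj (γ : SL(2, ℤ)) (z : ℂ) :
    mob γ ((starRingEnd ℂ) z) = (starRingEnd ℂ) (mob γ z) := by
  simp [mob]

lemma mob_im (γ : SL(2, ℤ)) {z : ℂ} (hz : z.im ≠ 0) :
    (mob γ z).im = z.im / normSq (den γ z) := by
  have hz' : ((starRingEnd ℂ) z).im ≠ 0 := by simpa using hz
  have h := mob_sub_mob γ (den_ne_zero γ hz) (den_ne_zero γ hz')
  have h1 : den γ ((starRingEnd ℂ) z) = (starRingEnd ℂ) (den γ z) := by simp [den]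
  rw [mob_conj, sub_conj, sub_conj, h1, mul_conj, div_eq_mul_inv, ← ofReal_inv] at h
  have h2 := congrArg im h
  simp only [mul_im, I_im, I_re, mul_zero, mul_one, ofReal_im, ofReal_re, mul_re] at h2
  rw [div_eq_mul_inv]
  linarith

lemma mob_im_pos (γ : SL(2, ℤ)) {z : ℂ} (hz : 0 < z.im) : 0 < (mob γ z).im := by
  rw [mob_im γ hz.ne']
  exact div_pos hz (normSq_pos.2 (den_ne_zero γ hz.ne'))

lemma mob_im_neg (γ : SL(2, ℤ)) {z : ℂ} (hz : z.im < 0) : (mob γ z).im < 0 := by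
  rw [mob_im γ hz.ne]
  exact div_neg_of_neg_of_pos hz (normSq_pos.2 (den_ne_zero γ hz.ne))

lemma hasDerivAt_mob (γ : SL(2, ℤ)) {z : ℂ} (hz : den γ z ≠ 0) :
    HasDerivAt (mob γ) (1 / den γ z ^ 2) z := by
  have h1 : HasDerivAt (fun z : ℂ => (γ 0 0 : ℂ) * z + γ 0 1) (γ 0 0 : ℂ) z := by
    simpa using ((hasDerivAt_id z).const_mul (γ 0 0 : ℂ)).add_const (γ 0 1 : ℂ)
  have h2 : HasDerivAt (fun z : ℂ => (γ 1 0 : ℂ) * z + γ 1 1) (γ 1 0 : ℂ) z := by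
    simpa using ((hasDerivAt_id z).const_mul (γ 1 0 : ℂ)).add_const (γ 1 1 : ℂ)
  refine (h1.div h2 hz).congr_deriv ?_
  have h := det_eq (R := ℂ) γ
  unfold den
  congr 1
  linear_combination h

lemma mob_S (z : ℂ) : mob ModularGroup.S z = -1 / z := by
  simp [mob, ModularGroup.S]

lemma mob_T (z : ℂ) : mob ModularGroup.T z = z + 1 := by
  simp [mob, ModularGroup.T]

lemma den_S (z : ℂ) : den ModularGroup.S z = z := by
  simp [den, ModularGroup.S]

lemma den_T (z : ℂ) : den ModularGroup.T z = 1 := by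
  simp [den, ModularGroup.T]

lemma mob_one {K : Type*} [Field K] (z : K) : mob 1 z = z := by
  simp [mob]

lemma den_one (z : ℂ) : den 1 z = 1 := by
  simp [den]

lemma continuousOn_mob (γ : SL(2, ℤ)) : ContinuousOn (mob γ) {z : ℂ | z.im ≠ 0} := fun _ hz =>
  (hasDerivAt_mob γ (den_ne_zero γ hz)).continuousAt.continuousWithinAt

lemma continuous_den (γ : SL(2, ℤ)) : Continuous (den γ) := by
  unfold den
  fun_prop

/-! ### The multiplier system -/

section Modular

variable {ι : Type*} [Fintype ι] [DecidableEq ι] {f : ℂ → ι → ℂ} {M : Matrix ι ι ℂ}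

/-- Existence of a transformation law of `f` under every element of the modular group. -/
lemma WeightHalf.exists_transform (hf : WeightHalf f M) (γ : SL(2, ℤ)) :
    ∃ (s : ℂ → ℂ) (A : GL ι ℂ), ContinuousOn s {z | 0 < z.im} ∧
      (∀ z, 0 < z.im → s z ^ 2 = den γ z) ∧
      ∀ z, 0 < z.im → f (mob γ z) = s z • ((A : Matrix ι ι ℂ) *ᵥ f z) := by
  have hγ : γ ∈ Subgroup.closure {ModularGroup.S, ModularGroup.T} := by
    simp [SpecialLinearGroup.SL2Z_generators]
  have hmaps : ∀ γ : SL(2, ℤ), MapsTo (mob γ) {z : ℂ | 0 < z.im} {z : ℂ | 0 < z.im} :=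
    fun γ _ hz => mob_im_pos γ hz
  have hcont : ∀ γ : SL(2, ℤ), ContinuousOn (mob γ) {z : ℂ | 0 < z.im} := fun γ =>
    (continuousOn_mob γ).mono fun z (hz : 0 < z.im) => hz.ne'
  induction hγ using Subgroup.closure_induction with
  | mem γ hγ =>
    rcases hγ with rfl | rfl
    · have hc : (exp (π * I / 4)) ^ 2 = I := by
        rw [← exp_nat_mul, show ((2 : ℕ) : ℂ) * (π * I / 4) = π / 2 * I by push_cast; ring,
          exp_pi_div_two_mul_I]
      have hc0 : exp (π * I / 4) ≠ 0 := exp_ne_zero _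
      -- The root factor squares to `-iz`; the constant `e^{πi/4}` has square `i` and corrects this
      -- to the denominator `z`, while its inverse is put into the matrix.
      refine ⟨fun z => exp (π * I / 4) * (1 / (-I * (-1 / z)) ^ (1 / 2 : ℂ)),
        ⟨(exp (π * I / 4))⁻¹ • M, exp (π * I / 4) • M, ?_, ?_⟩, ?_, ?_, ?_⟩
      · rw [Matrix.smul_mul, Matrix.mul_smul, smul_smul, inv_mul_cancel₀ hc0, one_smul, hf.mul_self]
      · rw [Matrix.smul_mul, Matrix.mul_smul, smul_smul, mul_inv_cancel₀ hc0, one_smul, hf.mul_self]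
      · intro z hz
        have hz0 : z ≠ 0 := fun h => by simp [h] at hz
        have hre : 0 < (-I * (-1 / z)).re := by simpa using neg_one_div_im_pos hz
        refine ContinuousAt.continuousWithinAt ?_
        refine continuousAt_const.mul (continuousAt_const.div ?_ ?_)
        · refine ContinuousAt.cpow ?_ continuousAt_const (Or.inl hre)
          exact continuousAt_const.mul (continuousAt_const.div continuousAt_id hz0)
        · rw [Ne, cpow_eq_zero_iff]
          simp [hz0]
      · intro z hz
        have hz0 : z ≠ 0 := fun h => by simp [h] at hz
        rw [mul_pow, hc, one_div, inv_pow, ← cpow_nat_mul, den_S]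
        norm_num
        field_simp
        simp
      · intro z hz
        have hz0 : z ≠ 0 := fun h => by simp [h] at hz
        have h2 := hf.trans_S _ (neg_one_div_im_pos hz)
        rw [show -1 / (-1 / z) = z by field_simp] at h2
        rw [mob_S, h2]
        simp only [Matrix.smul_mulVec, smul_smul]
        congr 1
        field_simp
    · obtain ⟨D, hD, hT⟩ := hf.trans_T
      refine ⟨fun _ => 1, ⟨Matrix.diagonal D, Matrix.diagonal fun k => (D k)⁻¹, ?_, ?_⟩,
        continuousOn_const, ?_, ?_⟩
      · rw [Matrix.diagonal_mul_diagonal, ← Matrix.diagonal_one]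
        congr 1
        funext k
        exact mul_inv_cancel₀ (hD k)
      · rw [Matrix.diagonal_mul_diagonal, ← Matrix.diagonal_one]
        congr 1
        funext k
        exact inv_mul_cancel₀ (hD k)
      · intro z _
        rw [den_T, one_pow]
      · intro z hz
        funext k
        rw [mob_T, hT z hz k, one_smul, Matrix.mulVec_diagonal]
  | one =>
    exact ⟨fun _ => 1, 1, continuousOn_const, fun z _ => by rw [den_one, one_pow],
      fun z _ => by simp [mob_one]⟩
  | mul γ₁ γ₂ _ _ h₁ h₂ =>
    obtain ⟨s₁, A₁, hc₁, hs₁, hf₁⟩ := h₁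
    obtain ⟨s₂, A₂, hc₂, hs₂, hf₂⟩ := h₂
    refine ⟨fun z => s₁ (mob γ₂ z) * s₂ z, A₁ * A₂, (hc₁.comp (hcont γ₂) (hmaps γ₂)).mul hc₂,
      fun z hz => ?_, fun z hz => ?_⟩
    · rw [mul_pow, hs₁ _ (mob_im_pos γ₂ hz), hs₂ z hz, den_mul _ _ (den_ne_zero γ₂ hz.ne')]
    · rw [mob_mul γ₁ γ₂ (den_ne_zero γ₂ hz.ne'), hf₁ _ (mob_im_pos γ₂ hz), hf₂ z hz,
        Matrix.mulVec_smul, smul_smul, Matrix.mulVec_mulVec]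
      rfl
  | inv γ _ h =>
    obtain ⟨s, A, hc, hs, hA⟩ := h
    -- The law for `γ⁻¹` comes from inverting that of `γ` at the point `γ⁻¹z`.
    have hinv : ∀ z : ℂ, 0 < z.im → mob γ (mob γ⁻¹ z) = z := fun z hz => by
      rw [← mob_mul γ γ⁻¹ (den_ne_zero γ⁻¹ hz.ne'), mul_inv_cancel, mob_one]
    have hs0 : ∀ z : ℂ, 0 < z.im → s z ≠ 0 := fun z hz h0 => by
      have := hs z hz
      rw [h0, zero_pow two_ne_zero] at this
      exact den_ne_zero γ hz.ne' this.symm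
    refine ⟨fun z => (s (mob γ⁻¹ z))⁻¹, A⁻¹, ?_, fun z hz => ?_, fun z hz => ?_⟩
    · exact (hc.comp (hcont γ⁻¹) (hmaps γ⁻¹)).inv₀ fun z hz => hs0 _ (mob_im_pos γ⁻¹ hz)
    · have h1 := den_mul γ γ⁻¹ (den_ne_zero γ⁻¹ hz.ne')
      rw [mul_inv_cancel, den_one] at h1
      rw [inv_pow, hs _ (mob_im_pos γ⁻¹ hz)]
      exact inv_eq_of_mul_eq_one_right h1.symm
    · have h1 := hA _ (mob_im_pos γ⁻¹ hz)
      rw [hinv z hz] at h1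
      conv_rhs => rw [h1]
      rw [Matrix.mulVec_smul, smul_smul, inv_mul_cancel₀ (hs0 _ (mob_im_pos γ⁻¹ hz)), one_smul,
        Matrix.mulVec_mulVec, ← Units.val_mul, inv_mul_cancel, Units.val_one, Matrix.one_mulVec]

lemma cpow_three_halves_sq (x : ℂ) : (x ^ (3 / 2 : ℂ)) ^ 2 = x ^ 3 := by
  rw [← cpow_nat_mul]
  norm_num

lemma autFactor_eq (γ : SL(2, ℤ)) (w : ℂ) : autFactor (3 / 2) γ w =
    if 0 < γ 1 0 then exp (-(3 * π * I / 4)) * (I * den γ w) ^ (3 / 2 : ℂ)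
    else den γ w ^ (3 / 2 : ℂ) := by
  have h : (((3 / 2 : ℝ) : ℝ) : ℂ) = 3 / 2 := by push_cast; rfl
  rw [autFactor, h, den]
  congr 3
  ring

lemma autFactor_sq (γ : SL(2, ℤ)) (w : ℂ) : autFactor (3 / 2) γ w ^ 2 = den γ w ^ 3 := by
  rw [autFactor_eq]
  split_ifs
  · rw [mul_pow, cpow_three_halves_sq, ← exp_nat_mul]
    have : ((2 : ℕ) : ℂ) * (-(3 * π * I / 4)) = π / 2 * I + -(2 * π * I) := by push_cast; ring
    rw [this, exp_add, exp_pi_div_two_mul_I, exp_neg, exp_two_pi_mul_I, mul_pow, I_pow_three,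
      inv_one, mul_one, neg_mul, mul_neg, ← mul_assoc, I_mul_I]
    ring
  · exact cpow_three_halves_sq _

lemma autFactor_ne_zero (γ : SL(2, ℤ)) {w : ℂ} (hw : den γ w ≠ 0) : autFactor (3 / 2) γ w ≠ 0 := by
  intro h
  have := autFactor_sq γ w
  rw [h, zero_pow two_ne_zero] at this
  exact pow_ne_zero 3 hw this.symm

/-- On the lower half-plane `cw + d` lies in the upper half-plane for `c < 0` and is constant for `c
= 0`; for `c > 0` the rotated number `i(cw + d)` lies in the right half-plane. The cut is never met.
-/
lemma continuousAt_autFactor (γ : SL(2, ℤ)) {w : ℂ} (hw : w.im < 0) :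
    ContinuousAt (autFactor (3 / 2) γ) w := by
  have hd : ContinuousAt (den γ) w := (continuous_den γ).continuousAt
  rw [show autFactor (3 / 2) γ = _ from funext (autFactor_eq γ)]
  rcases lt_trichotomy (γ 1 0) 0 with h | h | h
  · simp only [h.not_gt, if_false]
    refine hd.cpow continuousAt_const (Or.inr ?_)
    rw [den_im]
    exact mul_ne_zero (by exact_mod_cast h.ne) hw.ne
  · have : ∀ w, den γ w = γ 1 1 := fun w => by simp [den, h]
    simp only [this]
    exact continuousAt_const
  · simp only [h, if_true]
    refine continuousAt_const.mul ((continuousAt_const.mul hd).cpow continuousAt_const (Or.inl ?_))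
    change 0 < (I * den γ w).re
    rw [I_mul_re, den_im, neg_pos]
    exact mul_neg_of_pos_of_neg (by exact_mod_cast h) hw

lemma cpow_ne_zero_of_ne {x s : ℂ} (hx : x ≠ 0) : x ^ s ≠ 0 := by
  rw [Ne, cpow_eq_zero_iff]
  simp [hx]

/-- The transformation law of `f(z) / (z - w)^{3/2}`, which defines the multiplier system. -/
lemma WeightHalf.exists_multiplier (hf : WeightHalf f M) (γ : SL(2, ℤ)) :
    ∃ ρ : GL ι ℂ, ∀ z w : ℂ, 0 < z.im → w.im < 0 →
      ((z - w) ^ (3 / 2 : ℂ))⁻¹ • f z = ((den γ z ^ 2)⁻¹ * (autFactor (3 / 2) γ w)⁻¹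
        * ((mob γ z - mob γ w) ^ (3 / 2 : ℂ))⁻¹) • ((ρ : Matrix ι ι ℂ) *ᵥ f (mob γ z)) := by
  obtain ⟨s, A, hc, hs, hA⟩ := hf.exists_transform γ
  set U : Set (ℂ × ℂ) := {z : ℂ | 0 < z.im} ×ˢ {w : ℂ | w.im < 0} with hU
  have hUc : IsPreconnected U := (convex_halfSpace_im_gt 0).isPreconnected.prod
    (convex_halfSpace_im_lt 0).isPreconnected
  have hs0 : ∀ z : ℂ, 0 < z.im → s z ≠ 0 := fun z hz h0 => by
    have := hs z hz
    rw [h0, zero_pow two_ne_zero] at this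
    exact den_ne_zero γ hz.ne' this.symm
  have hzw : ∀ z w : ℂ, 0 < z.im → w.im < 0 → 0 < (z - w).im := fun z w hz hw => by
    rw [sub_im]; linarith
  -- `Q` compares the branches on both sides. From `s² = cz + d`, the square of the automorphy
  -- factor and the formula for `γz - γw` follows `Q² = 1`; being continuous on a connected product,
  -- `Q` is a constant sign `ε`, and `ρ(γ) = ε A⁻¹`.
  set Q : ℂ × ℂ → ℂ := fun p => autFactor (3 / 2) γ p.2 * ((p.1 - p.2) ^ (3 / 2 : ℂ))⁻¹
    * (mob γ p.1 - mob γ p.2) ^ (3 / 2 : ℂ) * den γ p.1 ^ 2 * (s p.1)⁻¹ with hQ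
  have hQc : ContinuousOn Q U := by
    rintro ⟨z, w⟩ ⟨hz, hw⟩
    simp only [mem_ofPred_eq] at hz hw
    have h1 : ContinuousAt (fun p : ℂ × ℂ => autFactor (3 / 2) γ p.2) (z, w) :=
      ContinuousAt.comp (f := Prod.snd) (continuousAt_autFactor γ hw) continuousAt_snd
    have h2 : ContinuousAt (fun p : ℂ × ℂ => ((p.1 - p.2) ^ (3 / 2 : ℂ))⁻¹) (z, w) := by
      refine ContinuousAt.inv₀ ?_ (cpow_ne_zero_of_ne fun h => ?_)
      · exact (continuousAt_fst.sub continuousAt_snd).cpow continuousAt_const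
          (Or.inr (hzw z w hz hw).ne')
      · have := hzw z w hz hw
        simp only at h
        rw [h] at this
        simp at this
    have h3 : ContinuousAt (fun p : ℂ × ℂ => (mob γ p.1 - mob γ p.2) ^ (3 / 2 : ℂ)) (z, w) := by
      refine ContinuousAt.cpow (ContinuousAt.sub ?_ ?_) continuousAt_const
        (Or.inr (hzw _ _ (mob_im_pos γ hz) (mob_im_neg γ hw)).ne')
      · exact ContinuousAt.comp (g := mob γ) (f := Prod.fst) (x := (z, w))
          (hasDerivAt_mob γ (den_ne_zero γ hz.ne')).continuousAt continuousAt_fst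
      · exact ContinuousAt.comp (g := mob γ) (f := Prod.snd) (x := (z, w))
          (hasDerivAt_mob γ (den_ne_zero γ hw.ne)).continuousAt continuousAt_snd
    have h4 : ContinuousAt (fun p : ℂ × ℂ => den γ p.1 ^ 2) (z, w) :=
      (((continuous_den γ).comp continuous_fst).pow 2).continuousAt
    have h5 : ContinuousAt (fun p : ℂ × ℂ => (s p.1)⁻¹) (z, w) := by
      refine ContinuousAt.inv₀ ?_ (hs0 z hz)
      exact ContinuousAt.comp (f := Prod.fst)
        (hc.continuousAt ((isOpen_lt continuous_const continuous_im).mem_nhds hz)) continuousAt_fst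
    exact ((((h1.mul h2).mul h3).mul h4).mul h5).continuousWithinAt
  have hQsq : EqOn (Q ^ 2) ((fun _ : ℂ × ℂ => (1 : ℂ)) ^ 2) U := by
    rintro ⟨z, w⟩ ⟨hz, hw⟩
    simp only [mem_ofPred_eq] at hz hw
    have hd1 := den_ne_zero γ hz.ne'
    have hd2 := den_ne_zero γ hw.ne
    have hne : z - w ≠ 0 := fun h => by
      have := hzw z w hz hw
      rw [h] at this
      simp at this
    simp only [Pi.pow_apply, hQ, one_pow]
    rw [mul_pow, mul_pow, mul_pow, mul_pow, inv_pow, inv_pow, autFactor_sq, cpow_three_halves_sq,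
      cpow_three_halves_sq, hs z hz, mob_sub_mob γ hd1 hd2]
    field_simp
  have hcase := hUc.eq_or_eq_neg_of_sq_eq (g := fun _ => (1 : ℂ)) hQc continuousOn_const hQsq
    (fun {_} _ => one_ne_zero)
  obtain ⟨ε, hε, hQε⟩ : ∃ ε : ℂˣ, (ε : ℂ) ^ 2 = 1 ∧ ∀ p ∈ U, Q p = ε := by
    rcases hcase with h | h
    · exact ⟨1, by simp, fun p hp => by rw [h hp]; simp⟩
    · exact ⟨-1, by simp, fun p hp => by rw [h hp]; simp⟩
  have hε0 : (ε : ℂ) ≠ 0 := ε.ne_zero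
  refine ⟨⟨(ε : ℂ) • ((A⁻¹ : GL ι ℂ) : Matrix ι ι ℂ), (ε : ℂ)⁻¹ • (A : Matrix ι ι ℂ), ?_, ?_⟩,
    fun z w hz hw => ?_⟩
  · rw [Matrix.smul_mul, Matrix.mul_smul, smul_smul, mul_inv_cancel₀ hε0, one_smul,
      ← Units.val_mul, inv_mul_cancel, Units.val_one]
  · rw [Matrix.smul_mul, Matrix.mul_smul, smul_smul, inv_mul_cancel₀ hε0, one_smul,
      ← Units.val_mul, mul_inv_cancel, Units.val_one]
  · have h1 := hQε (z, w) ⟨hz, hw⟩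
    have hd1 := den_ne_zero γ hz.ne'
    have hd2 := den_ne_zero γ hw.ne
    have hne : z - w ≠ 0 := fun h => by
      have := hzw z w hz hw
      rw [h] at this
      simp at this
    have hne' : mob γ z - mob γ w ≠ 0 := by
      rw [mob_sub_mob γ hd1 hd2]
      exact div_ne_zero hne (mul_ne_zero hd1 hd2)
    have k1 := cpow_ne_zero_of_ne (s := 3 / 2) hne
    have k2 := cpow_ne_zero_of_ne (s := 3 / 2) hne'
    have k3 := autFactor_ne_zero γ hd2
    have k4 := hs0 z hz
    rw [hA z hz]
    simp only [Matrix.smul_mulVec, Matrix.mulVec_smul, smul_smul]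
    rw [Matrix.mulVec_mulVec, ← Units.val_mul, inv_mul_cancel, Units.val_one, Matrix.one_mulVec]
    congr 1
    rw [← h1]
    simp only [hQ]
    field_simp

end Modular

/-! ### The cocycle relation, the multiplier at `S`, and decay at the cusps. -/

section Modular

variable {ι : Type*} [Fintype ι] [DecidableEq ι] {f : ℂ → ι → ℂ} {M : Matrix ι ι ℂ}

/-- The multiplier system of weight `3/2` attached to `f`. -/
def WeightHalf.multiplier (hf : WeightHalf f M) (γ : SL(2, ℤ)) : GL ι ℂ :=
  (hf.exists_multiplier γ).choose

lemma WeightHalf.multiplier_spec (hf : WeightHalf f M) (γ : SL(2, ℤ)) {z w : ℂ} (hz : 0 < z.im)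
    (hw : w.im < 0) : ((z - w) ^ (3 / 2 : ℂ))⁻¹ • f z
      = ((den γ z ^ 2)⁻¹ * (autFactor (3 / 2) γ w)⁻¹ * ((mob γ z - mob γ w) ^ (3 / 2 : ℂ))⁻¹)
        • ((hf.multiplier γ : Matrix ι ι ℂ) *ᵥ f (mob γ z)) :=
  (hf.exists_multiplier γ).choose_spec z w hz hw

lemma sub_ne_zero_of_im {z w : ℂ} (hz : 0 < z.im) (hw : w.im < 0) : z - w ≠ 0 := fun h => by
  have : 0 < (z - w).im := by rw [sub_im]; linarith
  rw [h] at this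
  simp at this

/-- The defining law for `γ₁γ₂`, and those for `γ₂` and then `γ₁`, express the same vector through
`f(γ₁γ₂z)`; since this point is arbitrary, `matrix_ext` removes `f`. -/
lemma WeightHalf.isMultiplierSystem (hf : WeightHalf f M) :
    IsMultiplierSystem (3 / 2) hf.multiplier := by
  intro γ₁ γ₂ w hw
  refine hf.matrix_ext fun z' hz' => ?_
  set z := mob (γ₁ * γ₂)⁻¹ z' with hz
  have hzim : 0 < z.im := mob_im_pos _ hz'
  have hz2 : mob (γ₁ * γ₂) z = z' := by
    rw [hz, ← mob_mul _ _ (den_ne_zero _ hz'.ne'), mul_inv_cancel, mob_one]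
  have hd2 := den_ne_zero γ₂ hzim.ne'
  have hz3 : mob γ₁ (mob γ₂ z) = z' := by rw [← mob_mul _ _ hd2, hz2]
  have hw3 : mob (γ₁ * γ₂) w = mob γ₁ (mob γ₂ w) := mob_mul _ _ (den_ne_zero γ₂ hw.ne)
  have h1 := hf.multiplier_spec (γ₁ * γ₂) hzim hw
  have h2 := hf.multiplier_spec γ₂ hzim hw
  have h3 := hf.multiplier_spec γ₁ (mob_im_pos γ₂ hzim) (mob_im_neg γ₂ hw)
  rw [mul_smul, ← Matrix.mulVec_smul, h3, h1, hz2, hz3, hw3, den_mul _ _ hd2, Matrix.mulVec_smul,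
    Matrix.mulVec_mulVec, smul_smul] at h2
  have hd1 := den_ne_zero γ₁ (mob_im_pos γ₂ hzim).ne'
  have hk := cpow_ne_zero_of_ne (s := 3 / 2)
    (sub_ne_zero_of_im hz' (mob_im_neg γ₁ (mob_im_neg γ₂ hw)))
  have h4 := congrArg (fun v => ((den γ₁ (mob γ₂ z) * den γ₂ z) ^ 2
    * (z' - mob γ₁ (mob γ₂ w)) ^ (3 / 2 : ℂ)) • v) h2
  simp only [smul_smul] at h4
  rw [Matrix.smul_mulVec, Matrix.smul_mulVec]
  convert h4 using 2
  · field_simp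
  · field_simp

/-- With `arg x ∈ [0, π]` and `|arg y| < π/2`, a sum of arguments above `π` would make the imaginary
part of `xy` negative. So the logarithms add. -/
lemma mul_cpow_of_im_pos {x y : ℂ} (hx : 0 < x.im) (hy : 0 < y.re) (hxy : 0 < (x * y).im) (s : ℂ) :
    (x * y) ^ s = x ^ s * y ^ s := by
  have hx0 : x ≠ 0 := fun h => by simp [h] at hx
  have hy0 : y ≠ 0 := fun h => by simp [h] at hy
  have hax : 0 ≤ x.arg := arg_nonneg_iff.2 hx.le
  have hax' : x.arg ≤ π := arg_le_pi x
  have hay := abs_lt.1 (abs_arg_lt_pi_div_two_iff.2 (Or.inl hy))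
  have hlog : log (x * y) = log x + log y := by
    refine (log_mul_eq_add_log_iff hx0 hy0).2 ⟨by linarith [Real.pi_pos], ?_⟩
    by_contra hgt
    have e : x * y = ((‖x‖ * ‖y‖ : ℝ) : ℂ) * exp (((x.arg + y.arg : ℝ) : ℂ) * I) := by
      conv_lhs => rw [← norm_mul_exp_arg_mul_I x, ← norm_mul_exp_arg_mul_I y]
      push_cast
      rw [add_mul, exp_add]
      ring
    rw [e, im_ofReal_mul, exp_ofReal_mul_I_im] at hxy
    have hpos : 0 < ‖x‖ * ‖y‖ := mul_pos (norm_pos_iff.2 hx0) (norm_pos_iff.2 hy0)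
    have hsin : Real.sin (x.arg + y.arg) < 0 := by
      rw [← sub_add_cancel (x.arg + y.arg) π, Real.sin_add_pi, neg_lt_zero]
      exact Real.sin_pos_of_pos_of_lt_pi (by linarith) (by linarith [Real.pi_pos])
    nlinarith
  rw [cpow_def_of_ne_zero (mul_ne_zero hx0 hy0), cpow_def_of_ne_zero hx0, cpow_def_of_ne_zero hy0,
    hlog, add_mul, exp_add]

lemma exp_three_quarters : exp (-(3 * π * I / 4)) = -exp (π * I / 4) := by
  rw [show -(3 * π * I / 4) = π * I / 4 - π * I by ring, exp_sub, exp_pi_mul_I]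
  ring

lemma autFactor_S (w : ℂ) :
    autFactor (3 / 2) ModularGroup.S w = -exp (π * I / 4) * (I * w) ^ (3 / 2 : ℂ) := by
  rw [autFactor_eq, den_S, if_pos (by simp [ModularGroup.S]), exp_three_quarters]

lemma WeightHalf.multiplier_S (hf : WeightHalf f M) :
    (hf.multiplier ModularGroup.S : Matrix ι ι ℂ) = exp (π * I / 4) • M := by
  refine hf.matrix_ext fun z' hz' => ?_
  set z := -1 / z' with hzdef
  have hz : 0 < z.im := neg_one_div_im_pos hz'
  have hz0 : z ≠ 0 := fun h => by simp [h] at hz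
  have hz0' : z' ≠ 0 := fun h => by simp [h] at hz'
  have hzz : -1 / z = z' := by rw [hzdef]; field_simp
  -- The fixed point `-i` of `S` is chosen because there `i w = 1` and the automorphy factor is a
  -- plain constant.
  have h1 := hf.multiplier_spec ModularGroup.S hz (w := -I) (by simp)
  have h2 := hf.trans_S z hz
  rw [h2, mob_S, mob_S, den_S, hzz, autFactor_S, show I * -I = 1 by simp, one_cpow, mul_one,
    show -1 / -I = -I by rw [neg_div_neg_eq, one_div, inv_I], smul_smul] at h1
  have hre : 0 < (-I * z).re := by simpa using hz
  have hzI : (0 : ℝ) < (z - -I).im := by simp; linarith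
  have hq : 0 < (z' - -I).im := by simp; linarith
  have hprod : z - -I = (z' - -I) * (-I * z) := by
    rw [← hzz]
    field_simp
    linear_combination z * I_sq
  have h3 : (z - -I) ^ (3 / 2 : ℂ) = (z' - -I) ^ (3 / 2 : ℂ) * (-I * z) ^ (3 / 2 : ℂ) := by
    rw [hprod]
    exact mul_cpow_of_im_pos hq hre (by rw [← hprod]; exact hzI) _
  have hne : -I * z ≠ 0 := mul_ne_zero (neg_ne_zero.2 I_ne_zero) hz0
  have h4 : (-I * z) ^ (3 / 2 : ℂ) * (-I * z) ^ (1 / 2 : ℂ) = -z ^ 2 := by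
    rw [← cpow_add _ _ hne, show (3 / 2 + 1 / 2 : ℂ) = (2 : ℕ) by norm_num, cpow_natCast, mul_pow,
      neg_sq, I_sq]
    ring
  have k1 := cpow_ne_zero_of_ne (s := 3 / 2) (fun h => by rw [h] at hq; simp at hq : z' - -I ≠ 0)
  have k2 := cpow_ne_zero_of_ne (s := 3 / 2) hne
  have k3 := cpow_ne_zero_of_ne (s := 1 / 2) hne
  have k4 : exp (π * I / 4) ≠ 0 := exp_ne_zero _
  have h5 := congrArg (fun v => (-(z ^ 2 * exp (π * I / 4) * (z' - -I) ^ (3 / 2 : ℂ))) • v) h1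
  simp only [smul_smul] at h5
  rw [Matrix.smul_mulVec]
  have e1 : -(z ^ 2 * exp (π * I / 4) * (z' - -I) ^ (3 / 2 : ℂ))
      * ((z ^ 2)⁻¹ * (-exp (π * I / 4))⁻¹ * ((z' - -I) ^ (3 / 2 : ℂ))⁻¹) = 1 := by
    field_simp
  have e2 : -(z ^ 2 * exp (π * I / 4) * (z' - -I) ^ (3 / 2 : ℂ))
      * (((z - -I) ^ (3 / 2 : ℂ))⁻¹ * (1 / (-I * z) ^ (1 / 2 : ℂ))) = exp (π * I / 4) := by
    rw [h3]
    generalize (-I * z) ^ (3 / 2 : ℂ) = P at *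
    generalize (-I * z) ^ (1 / 2 : ℂ) = R at *
    field_simp
    linear_combination -h4
  rw [e1, e2, one_smul] at h5
  exact h5.symm

/-! ### Decay of `f` near the rational points -/

/-- The bottom row is `(denominator, -numerator)` of `x`; the matrix carries the cusp `x` to `∞`. -/
lemma exists_den_eq_zero (x : ℚ) : ∃ δ : SL(2, ℤ), (δ 1 0 : ℚ) * x + δ 1 1 = 0 ∧ δ 1 0 ≠ 0 := by
  have hco : IsCoprime (x.den : ℤ) (-x.num) := by
    rw [IsCoprime.neg_right_iff]
    exact (Int.isCoprime_iff_gcd_eq_one.2 (by rw [Int.gcd, Int.natAbs_natCast]; exact x.reduced)).symm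
  obtain ⟨δ, -, hδ⟩ := ModularGroup.bottom_row_surj (R := ℤ)
    (show ![(x.den : ℤ), -x.num] ∈ {cd : Fin 2 → ℤ | IsCoprime (cd 0) (cd 1)} from hco)
  have h0 : δ 1 0 = x.den := congrFun hδ 0
  have h1 : δ 1 1 = -x.num := congrFun hδ 1
  refine ⟨δ, ?_, by rw [h0]; exact_mod_cast x.den_nz⟩
  rw [h0, h1]
  push_cast
  rw [mul_comm, Rat.mul_den_eq_num]
  ring

lemma exists_exp_neg_le {κ : ℝ} (hκ : 0 < κ) (p : ℝ) :
    ∃ C : ℝ, 0 ≤ C ∧ ∀ x : ℝ, 1 ≤ x → Real.exp (-κ * x) ≤ C * x ^ p := by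
  obtain ⟨n, hn⟩ := exists_nat_ge (-p)
  refine ⟨n.factorial / κ ^ n, by positivity, fun x hx => ?_⟩
  have hx0 : 0 < x := by linarith
  have h1 : (κ * x) ^ n / n.factorial ≤ Real.exp (κ * x) := Real.pow_div_factorial_le_exp _ (by positivity) n
  have h2 : x ^ (-(n : ℝ)) ≤ x ^ p := Real.rpow_le_rpow_of_exponent_le hx (by linarith)
  rw [neg_mul, Real.exp_neg]
  calc (Real.exp (κ * x))⁻¹ ≤ ((κ * x) ^ n / n.factorial)⁻¹ := by
        apply inv_anti₀ (by positivity) h1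
    _ = n.factorial / κ ^ n * x ^ (-(n : ℝ)) := by
        rw [Real.rpow_neg hx0.le, Real.rpow_natCast, mul_pow]
        field_simp
    _ ≤ _ := by gcongr

/-- Near `x` the matrix `δ` moves the point high up, where `f` is exponentially small in `1/t`; for
`t > 1` the decay at `i∞` applies directly. The bound holds on complex discs so that Cauchy's
estimate can extend it to derivatives. -/
lemma WeightHalf.decay_cusp (hf : WeightHalf f M) (x : ℚ) (k : ι) (a : ℝ) :
    ∃ C : ℝ, 0 ≤ C ∧ ∀ t : ℝ, 0 < t → ∀ τ : ℂ, ‖τ - t‖ ≤ t / 2 →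
      ‖f ((x : ℂ) + I * τ) k‖ ≤ C * t ^ a := by
  obtain ⟨δ, hδ, hδ0⟩ := exists_den_eq_zero x
  obtain ⟨s, A, -, hs, hA⟩ := hf.exists_transform δ
  obtain ⟨κ, hκ, hdec⟩ := hf.decay
  set c : ℝ := |(δ 1 0 : ℝ)| with hc
  have hc1 : 1 ≤ c := by
    rw [hc, ← Int.cast_abs]
    exact_mod_cast Int.one_le_abs hδ0
  -- From `Re τ ≥ t/2` and `|τ| ≤ 3t/2` one gets `Im δz = Re τ / (c|τ|)² ≥ δ₀/t`.
  set δ₀ : ℝ := 2 / (9 * c ^ 2) with hδ₀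
  have hδ₀pos : 0 < δ₀ := by positivity
  obtain ⟨C₀, hC₀, hb₀⟩ := hdec δ₀ hδ₀pos
  obtain ⟨C₁, hC₁, hb₁⟩ := hdec (1 / 2) (by norm_num)
  -- The extra power of `t` pays for the factor `|s(z)|⁻¹ ≤ 2/t`.
  obtain ⟨E₀, hE₀, he₀⟩ := exists_exp_neg_le (mul_pos hκ hδ₀pos) (-(a + 1))
  obtain ⟨E₁, hE₁, he₁⟩ := exists_exp_neg_le (half_pos hκ) a
  set B : ℝ := ∑ l, ‖((A⁻¹ : GL ι ℂ) : Matrix ι ι ℂ) k l‖ with hB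
  have hB0 : 0 ≤ B := Finset.sum_nonneg fun l _ => norm_nonneg _
  refine ⟨2 * B * C₀ * E₀ + C₁ * E₁, by positivity, fun t ht τ hτ => ?_⟩
  have hta : 0 ≤ t ^ a := (Real.rpow_pos_of_pos ht a).le
  have hre : t / 2 ≤ τ.re := by
    have h1 := (abs_le.1 ((abs_re_le_norm (τ - t)).trans hτ)).1
    rw [sub_re, ofReal_re] at h1
    linarith
  have hn1 : t / 2 ≤ ‖τ‖ := hre.trans (re_le_norm τ)
  have hn2 : ‖τ‖ ≤ 3 * t / 2 := by
    have h1 := norm_add_le (τ - t) (t : ℂ)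
    rw [sub_add_cancel, norm_real, Real.norm_of_nonneg ht.le] at h1
    linarith
  set z : ℂ := (x : ℂ) + I * τ with hz
  have hzim : z.im = τ.re := by simp [hz]
  have hzpos : 0 < z.im := by rw [hzim]; linarith
  rcases le_or_gt t 1 with ht1 | ht1
  · have hden : den δ z = (δ 1 0 : ℂ) * (I * τ) := by
      have : (δ 1 0 : ℂ) * x + δ 1 1 = 0 := by exact_mod_cast hδ
      rw [den, hz]
      linear_combination this
    have hdn : ‖den δ z‖ = c * ‖τ‖ := by
      rw [hden, norm_mul, norm_mul, norm_I, one_mul, hc]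
      congr 1
      exact norm_intCast _
    have him : δ₀ / t ≤ (mob δ z).im := by
      rw [mob_im δ hzpos.ne', hzim, normSq_eq_norm_sq, hdn, hδ₀, div_div, div_le_div_iff₀ (by positivity)
        (by nlinarith [mul_pos (lt_of_lt_of_le one_pos hc1) (lt_of_lt_of_le (half_pos ht) hn1)])]
      have h1 : ‖τ‖ ^ 2 ≤ (3 * t / 2) ^ 2 := by gcongr
      calc 2 * (c * ‖τ‖) ^ 2 = 2 * c ^ 2 * ‖τ‖ ^ 2 := by ring
        _ ≤ 2 * c ^ 2 * (3 * t / 2) ^ 2 := by gcongr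
        _ = t / 2 * (9 * c ^ 2 * t) := by ring
        _ ≤ _ := by gcongr
    have hsn : t / 2 ≤ ‖s z‖ := by
      have h1 : ‖s z‖ ^ 2 = c * ‖τ‖ := by rw [← norm_pow, hs z hzpos, hdn]
      have h2 : (t / 2) ^ 2 ≤ ‖s z‖ ^ 2 := by
        rw [h1]
        calc (t / 2) ^ 2 ≤ 1 * (t / 2) := by nlinarith
          _ ≤ c * ‖τ‖ := by gcongr
      exact (pow_le_pow_iff_left₀ (by positivity) (norm_nonneg _) two_ne_zero).1 h2
    have hs0 : s z ≠ 0 := norm_pos_iff.1 (by linarith)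
    have hfz : f z = (s z)⁻¹ • (((A⁻¹ : GL ι ℂ) : Matrix ι ι ℂ) *ᵥ f (mob δ z)) := by
      rw [hA z hzpos, Matrix.mulVec_smul, smul_smul, inv_mul_cancel₀ hs0, one_smul,
        Matrix.mulVec_mulVec, ← Units.val_mul, inv_mul_cancel, Units.val_one, Matrix.one_mulVec]
    have hδt : δ₀ ≤ δ₀ / t := by rw [le_div_iff₀ ht]; nlinarith
    have hmv : ‖(((A⁻¹ : GL ι ℂ) : Matrix ι ι ℂ) *ᵥ f (mob δ z)) k‖
        ≤ B * (C₀ * Real.exp (-κ * (δ₀ / t))) := by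
      rw [Matrix.mulVec, dotProduct, hB, Finset.sum_mul]
      refine (norm_sum_le _ _).trans (Finset.sum_le_sum fun l _ => ?_)
      rw [norm_mul]
      refine mul_le_mul_of_nonneg_left ((hb₀ _ (hδt.trans him) l).trans ?_) (norm_nonneg _)
      refine mul_le_mul_of_nonneg_left (Real.exp_le_exp.2 ?_) hC₀
      nlinarith
    have hexp : Real.exp (-κ * (δ₀ / t)) ≤ E₀ * t ^ (a + 1) := by
      have h1 := he₀ t⁻¹ ((one_le_inv₀ ht).2 ht1)
      rw [Real.inv_rpow ht.le, Real.rpow_neg ht.le, inv_inv] at h1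
      refine le_trans (le_of_eq ?_) h1
      congr 1
      rw [div_eq_mul_inv]
      ring
    rw [hfz, Pi.smul_apply, norm_smul, norm_inv]
    calc ‖s z‖⁻¹ * ‖(((A⁻¹ : GL ι ℂ) : Matrix ι ι ℂ) *ᵥ f (mob δ z)) k‖
        ≤ (t / 2)⁻¹ * (B * (C₀ * (E₀ * t ^ (a + 1)))) := by
          gcongr
          exact hmv.trans (by gcongr)
      _ = 2 * B * C₀ * E₀ * t ^ a := by
          rw [Real.rpow_add ht, Real.rpow_one]
          field_simp
      _ ≤ _ := by
          have : 0 ≤ C₁ * E₁ := by positivity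
          nlinarith
  · have h1 := hb₁ z (by rw [hzim]; linarith) k
    have h2 : Real.exp (-κ * z.im) ≤ E₁ * t ^ a := by
      refine le_trans (Real.exp_le_exp.2 ?_) (he₁ t ht1.le)
      rw [hzim]
      nlinarith
    calc ‖f z k‖ ≤ C₁ * (E₁ * t ^ a) := h1.trans (by gcongr)
      _ ≤ _ := by
        have : 0 ≤ 2 * B * C₀ * E₀ := by positivity
        nlinarith

end Modular

/-! ### Rapidly decaying functions on `(0, ∞)` and their Stieltjes transforms -/

lemma integrableOn_Ioi_of_rpow_bounds {E : Type*} [NormedAddCommGroup E] {g : ℝ → E}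
    (hg : AEStronglyMeasurable g (volume.restrict (Ioi 0))) {a b C₁ C₂ : ℝ} (ha : -1 < a)
    (hb : b < -1) (h₁ : ∀ t, 0 < t → t ≤ 1 → ‖g t‖ ≤ C₁ * t ^ a)
    (h₂ : ∀ t, 1 < t → ‖g t‖ ≤ C₂ * t ^ b) : IntegrableOn g (Ioi 0) := by
  rw [← Ioc_union_Ioi_eq_Ioi (zero_le_one : (0 : ℝ) ≤ 1), integrableOn_union]
  constructor
  · have hi : IntegrableOn (fun t : ℝ => C₁ * t ^ a) (Ioc 0 1) := by
      have := (intervalIntegral.intervalIntegrable_rpow' (a := 0) (b := 1) ha).const_mul C₁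
      rwa [intervalIntegrable_iff_integrableOn_Ioc_of_le zero_le_one] at this
    refine hi.mono' (hg.mono_measure (Measure.restrict_mono Ioc_subset_Ioi_self le_rfl)) ?_
    exact (ae_restrict_iff' measurableSet_Ioc).2 (Eventually.of_forall fun t ht => h₁ t ht.1 ht.2)
  · have hi : IntegrableOn (fun t : ℝ => C₂ * t ^ b) (Ioi 1) :=
      (integrableOn_Ioi_rpow_of_lt hb one_pos).const_mul C₂
    refine hi.mono' (hg.mono_measure (Measure.restrict_mono (Ioi_subset_Ioi zero_le_one) le_rfl)) ?_
    exact (ae_restrict_iff' measurableSet_Ioi).2 (Eventually.of_forall fun t ht => h₂ t ht)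

/-- Continuous functions on `(0, ∞)` that are bounded by every power of the variable. -/
structure Rapid (F : ℝ → ℂ) : Prop where
  cont : ContinuousOn F (Ioi 0)
  bound : ∀ a : ℝ, ∃ C : ℝ, 0 ≤ C ∧ ∀ t, 0 < t → ‖F t‖ ≤ C * t ^ a

lemma Rapid.integrableOn {F : ℝ → ℂ} (hF : Rapid F) : IntegrableOn F (Ioi 0) := by
  obtain ⟨C₁, -, h₁⟩ := hF.bound 0
  obtain ⟨C₂, -, h₂⟩ := hF.bound (-2)
  exact integrableOn_Ioi_of_rpow_bounds (hF.cont.aestronglyMeasurable measurableSet_Ioi)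
    (by norm_num) (by norm_num) (fun t ht _ => h₁ t ht) (fun t ht => h₂ t (by linarith))

lemma Rapid.mul {F k : ℝ → ℂ} (hF : Rapid F) (hk : ContinuousOn k (Ioi 0)) {B e : ℝ} (hB : 0 ≤ B)
    (hb : ∀ t, 0 < t → ‖k t‖ ≤ B * t ^ e) : Rapid fun t => F t * k t where
  cont := hF.cont.mul hk
  bound a := by
    obtain ⟨C, hC, h⟩ := hF.bound (a - e)
    refine ⟨C * B, by positivity, fun t ht => ?_⟩
    rw [norm_mul]
    calc ‖F t‖ * ‖k t‖ ≤ (C * t ^ (a - e)) * (B * t ^ e) := by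
          gcongr
          · exact h t ht
          · exact hb t ht
      _ = C * B * (t ^ (a - e) * t ^ e) := by ring
      _ = _ := by rw [← Real.rpow_add ht, sub_add_cancel]

lemma Rapid.tendsto_zero {F : ℝ → ℂ} (hF : Rapid F) : Tendsto F (𝓝[>] 0) (𝓝 0) := by
  obtain ⟨C, -, h⟩ := hF.bound 1
  have h0 : Tendsto (fun t : ℝ => C * t ^ (1 : ℝ)) (𝓝[>] 0) (𝓝 0) := by
    simp only [Real.rpow_one]
    have : Tendsto (fun t : ℝ => C * t) (𝓝 0) (𝓝 (C * 0)) := tendsto_id.const_mul C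
    rw [mul_zero] at this
    exact this.mono_left nhdsWithin_le_nhds
  exact squeeze_zero_norm' (eventually_nhdsWithin_of_forall fun t ht => h t ht) h0

lemma Rapid.tendsto_atTop {F : ℝ → ℂ} (hF : Rapid F) : Tendsto F atTop (𝓝 0) := by
  obtain ⟨C, -, h⟩ := hF.bound (-1)
  have h0 : Tendsto (fun t : ℝ => C * t ^ (-1 : ℝ)) atTop (𝓝 0) := by
    simpa using (tendsto_rpow_neg_atTop one_pos).const_mul C
  exact squeeze_zero_norm' ((eventually_gt_atTop 0).mono fun t ht => h t ht) h0

/-- The points `v` for which `t + v` is never in `(-∞, 0]` for `t > 0`. -/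
def Good (v : ℂ) : Prop := 0 ≤ v.re ∨ v.im ≠ 0

lemma Good.mem_slitPlane {v : ℂ} (hv : Good v) {t : ℝ} (ht : 0 < t) : (t : ℂ) + v ∈ slitPlane := by
  rcases hv with h | h
  · exact Or.inl (by rw [add_re, ofReal_re]; linarith)
  · exact Or.inr (by rw [add_im, ofReal_im, zero_add]; exact h)

lemma good_zero : Good 0 := Or.inl le_rfl

/-- The kernel `(t + v)^{-s}`. -/
def kern (s : ℝ) (v : ℂ) (t : ℝ) : ℂ := ((t : ℂ) + v) ^ ((-s : ℝ) : ℂ)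

lemma norm_kern (s : ℝ) (v : ℂ) (t : ℝ) : ‖kern s v t‖ = ‖(t : ℂ) + v‖ ^ (-s) :=
  norm_cpow_real _ _

lemma kern_zero (s : ℝ) {t : ℝ} (ht : 0 < t) : kern s 0 t = ((t ^ (-s) : ℝ) : ℂ) := by
  rw [kern, add_zero, ofReal_cpow ht.le]

lemma norm_kern_le_of_re {s : ℝ} (hs : 0 ≤ s) {v : ℂ} (hv : 0 ≤ v.re) {t : ℝ} (ht : 0 < t) :
    ‖kern s v t‖ ≤ t ^ (-s) := by
  rw [norm_kern]
  refine Real.rpow_le_rpow_of_nonpos ht ?_ (by linarith)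
  refine le_trans ?_ (re_le_norm _)
  rw [add_re, ofReal_re]
  linarith

lemma norm_kern_le_of_im {s : ℝ} (hs : 0 ≤ s) {v : ℂ} {ε : ℝ} (hε : 0 < ε) (hv : ε ≤ |v.im|)
    (t : ℝ) : ‖kern s v t‖ ≤ ε ^ (-s) := by
  rw [norm_kern]
  refine Real.rpow_le_rpow_of_nonpos hε ?_ (by linarith)
  refine hv.trans (le_trans (le_of_eq ?_) (abs_im_le_norm _))
  rw [add_im, ofReal_im, zero_add]

lemma Good.exists_kern_bound {s : ℝ} (hs : 0 ≤ s) {v : ℂ} (hv : Good v) :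
    ∃ B e : ℝ, 0 ≤ B ∧ ∀ t, 0 < t → ‖kern s v t‖ ≤ B * t ^ e := by
  rcases hv with h | h
  · exact ⟨1, -s, zero_le_one, fun t ht => by rw [one_mul]; exact norm_kern_le_of_re hs h ht⟩
  · exact ⟨|v.im| ^ (-s), 0, by positivity, fun t ht => by
      rw [Real.rpow_zero, mul_one]; exact norm_kern_le_of_im hs (abs_pos.2 h) le_rfl t⟩

lemma Good.hasDerivAt_kern (s : ℝ) {v : ℂ} (hv : Good v) {t : ℝ} (ht : 0 < t) :
    HasDerivAt (fun v => kern s v t) (-s * kern (s + 1) v t) v := by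
  have h := ((hasDerivAt_id v).const_add (t : ℂ)).cpow_const (c := ((-s : ℝ) : ℂ))
    (hv.mem_slitPlane ht)
  refine h.congr_deriv ?_
  rw [kern, mul_one]
  push_cast
  rw [neg_add]
  rfl

lemma Good.hasDerivAt_kern' (s : ℝ) {v : ℂ} (hv : Good v) {t : ℝ} (ht : 0 < t) :
    HasDerivAt (kern s v) (-s * kern (s + 1) v t) t := by
  have h := (((hasDerivAt_id (t : ℂ)).add_const v).cpow_const (c := ((-s : ℝ) : ℂ))
    (hv.mem_slitPlane ht)).comp_ofReal
  refine h.congr_deriv ?_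
  rw [kern, mul_one]
  push_cast
  rw [neg_add]
  rfl

lemma Good.continuousOn_kern (s : ℝ) {v : ℂ} (hv : Good v) : ContinuousOn (kern s v) (Ioi 0) :=
  fun _ ht => (hv.hasDerivAt_kern' s ht).continuousAt.continuousWithinAt

lemma Rapid.mul_kern {F : ℝ → ℂ} (hF : Rapid F) {s : ℝ} (hs : 0 ≤ s) {v : ℂ} (hv : Good v) :
    Rapid fun t => F t * kern s v t := by
  obtain ⟨B, e, hB, h⟩ := hv.exists_kern_bound hs
  exact hF.mul (hv.continuousOn_kern s) hB h

/-- The generalized Stieltjes transform `∫ F(t) (t + v)^{-s} dt`. -/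
def stieltjes (F : ℝ → ℂ) (s : ℝ) (v : ℂ) : ℂ := ∫ t in Ioi (0 : ℝ), F t * kern s v t

lemma Rapid.integrable_norm_mul_rpow {F : ℝ → ℂ} (hF : Rapid F) (B e : ℝ) :
    IntegrableOn (fun t => ‖F t‖ * (B * t ^ e)) (Ioi 0) := by
  have h1 : Rapid fun t => F t * (t ^ e : ℝ) :=
    hF.mul (e := e) (B := 1) (continuous_ofReal.comp_continuousOn
      (continuousOn_id.rpow_const fun t ht => Or.inl (ne_of_gt ht))) zero_le_one
      fun t ht => by rw [norm_real, Real.norm_of_nonneg (Real.rpow_pos_of_pos ht _).le, one_mul]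
  refine IntegrableOn.congr_fun (h1.integrableOn.norm.mul_const B) (fun t ht => ?_) measurableSet_Ioi
  simp only [norm_mul, norm_real, Real.norm_of_nonneg (Real.rpow_pos_of_pos (mem_Ioi.1 ht) _).le]
  ring

lemma Rapid.hasDerivAt_stieltjes {F : ℝ → ℂ} (hF : Rapid F) {s : ℝ} (hs : 0 ≤ s) {v : ℂ}
    (hv : v ∈ slitPlane) : HasDerivAt (stieltjes F s) (-s * stieltjes F (s + 1) v) v := by
  have hgood : ∀ u, u ∈ slitPlane → Good u := fun u hu => hu.imp le_of_lt id
  -- A neighbourhood with a uniform power bound for the kernel: the right half-plane if `Re v > 0`,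
  -- otherwise the points whose imaginary part stays away from zero.
  obtain ⟨U, hU, B, e, hUg, hb⟩ : ∃ U ∈ 𝓝 v, ∃ B e : ℝ, (∀ u ∈ U, Good u) ∧
      ∀ u ∈ U, ∀ t, 0 < t → ‖kern (s + 1) u t‖ ≤ B * t ^ e := by
    rcases hv with h | h
    · refine ⟨{u | 0 < u.re}, (isOpen_lt continuous_const continuous_re).mem_nhds h, 1, -(s + 1),
        fun u hu => Or.inl (le_of_lt hu), fun u hu t ht => ?_⟩
      rw [one_mul]
      exact norm_kern_le_of_re (by linarith) (le_of_lt hu) ht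
    · have hpos := abs_pos.2 h
      refine ⟨{u | |v.im| / 2 < |u.im|},
        (isOpen_lt continuous_const continuous_im.abs).mem_nhds (half_lt_self hpos),
        (|v.im| / 2) ^ (-(s + 1)), 0, fun u (hu : |v.im| / 2 < |u.im|) =>
          Or.inr (abs_pos.1 ((half_pos hpos).trans hu)), fun u (hu : |v.im| / 2 < |u.im|) t ht => ?_⟩
      rw [Real.rpow_zero, mul_one]
      exact norm_kern_le_of_im (by linarith) (half_pos hpos) hu.le t
  have h := hasDerivAt_integral_of_dominated_loc_of_deriv_le (μ := volume.restrict (Ioi (0 : ℝ)))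
    (F := fun v t => F t * kern s v t) (F' := fun v t => F t * (-s * kern (s + 1) v t))
    (bound := fun t => s * (‖F t‖ * (B * t ^ e))) hU ?_ (hF.mul_kern hs (hgood v hv)).integrableOn
    ?_ ?_ ((hF.integrable_norm_mul_rpow B e).const_mul s) ?_
  · refine h.2.congr_deriv ?_
    rw [stieltjes, ← integral_const_mul]
    congr 1
    funext t
    ring
  · filter_upwards [hU] with u hu
    exact (hF.mul_kern hs (hUg u hu)).cont.aestronglyMeasurable measurableSet_Ioi
  · exact (hF.cont.mul (continuousOn_const.mul
      ((hgood v hv).continuousOn_kern (s + 1)))).aestronglyMeasurable measurableSet_Ioi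
  · refine (ae_restrict_iff' measurableSet_Ioi).2 (Eventually.of_forall fun t ht u hu => ?_)
    rw [norm_mul, norm_mul, norm_neg, norm_real, Real.norm_of_nonneg hs]
    calc ‖F t‖ * (s * ‖kern (s + 1) u t‖) ≤ ‖F t‖ * (s * (B * t ^ e)) := by
          gcongr
          exact hb u hu t ht
      _ = _ := by ring
  · refine (ae_restrict_iff' measurableSet_Ioi).2 (Eventually.of_forall fun t ht u hu => ?_)
    exact ((hUg u hu).hasDerivAt_kern s ht).const_mul (F t)

lemma Rapid.continuousOn_stieltjes {F : ℝ → ℂ} (hF : Rapid F) {s : ℝ} (hs : 0 ≤ s) :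
    ContinuousOn (stieltjes F s) {v | 0 ≤ v.re} := by
  intro v hv
  refine continuousWithinAt_of_dominated (bound := fun t => ‖F t‖ * (1 * t ^ (-s))) ?_ ?_
    (hF.integrable_norm_mul_rpow 1 (-s)) ?_
  · filter_upwards [self_mem_nhdsWithin] with u hu
    exact (hF.mul_kern hs (Or.inl hu)).cont.aestronglyMeasurable measurableSet_Ioi
  · filter_upwards [self_mem_nhdsWithin] with u hu
    refine (ae_restrict_iff' measurableSet_Ioi).2 (Eventually.of_forall fun t ht => ?_)
    rw [norm_mul, one_mul]
    gcongr
    exact norm_kern_le_of_re hs hu ht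
  · refine (ae_restrict_iff' measurableSet_Ioi).2 (Eventually.of_forall fun t ht => ?_)
    exact continuousWithinAt_const.mul
      (Good.hasDerivAt_kern s (Or.inl hv) ht).continuousAt.continuousWithinAt

/-- On the line `v = i(y - y₀)` the kernel is at most `t^{-s}` even at the branch point `v = 0`, and
the rapid decay of `F` absorbs this singularity. Hence smoothness across `y₀`. -/
lemma Rapid.hasDerivAt_stieltjes_line {F : ℝ → ℂ} (hF : Rapid F) {s : ℝ} (hs : 0 ≤ s) (y₀ y : ℝ) :
    HasDerivAt (fun y : ℝ => stieltjes F s (I * (y - y₀ : ℝ)))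
      (-s * I * stieltjes F (s + 1) (I * (y - y₀ : ℝ))) y := by
  have hgood : ∀ y : ℝ, Good (I * (y - y₀ : ℝ)) := fun y => Or.inl (by simp)
  have h := hasDerivAt_integral_of_dominated_loc_of_deriv_le (μ := volume.restrict (Ioi (0 : ℝ)))
    (F := fun (y : ℝ) t => F t * kern s (I * (y - y₀ : ℝ)) t)
    (F' := fun (y : ℝ) t => F t * (-s * kern (s + 1) (I * (y - y₀ : ℝ)) t * I))
    (bound := fun t => s * (‖F t‖ * (1 * t ^ (-(s + 1))))) (s := univ) (x₀ := y) univ_mem ?_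
    (hF.mul_kern hs (hgood y)).integrableOn
    ?_ ?_ ((hF.integrable_norm_mul_rpow 1 (-(s + 1))).const_mul s) ?_
  · refine h.2.congr_deriv ?_
    rw [stieltjes, ← integral_const_mul]
    congr 1
    funext t
    ring
  · exact Eventually.of_forall fun u =>
      (hF.mul_kern hs (hgood u)).cont.aestronglyMeasurable measurableSet_Ioi
  · exact (hF.cont.mul ((continuousOn_const.mul
      ((hgood y).continuousOn_kern (s + 1))).mul continuousOn_const)).aestronglyMeasurable
      measurableSet_Ioi
  · refine (ae_restrict_iff' measurableSet_Ioi).2 (Eventually.of_forall fun t ht u _ => ?_)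
    rw [norm_mul, norm_mul, norm_mul, norm_neg, norm_real, Real.norm_of_nonneg hs, norm_I, mul_one]
    calc ‖F t‖ * (s * ‖kern (s + 1) (I * (u - y₀ : ℝ)) t‖) ≤ ‖F t‖ * (s * (1 * t ^ (-(s + 1)))) := by
          rw [one_mul]
          gcongr
          exact norm_kern_le_of_re (by linarith) (by simp) ht
      _ = _ := by ring
  · refine (ae_restrict_iff' measurableSet_Ioi).2 (Eventually.of_forall fun t ht u _ => ?_)
    have h1 : HasDerivAt (fun y : ℝ => I * ((y - y₀ : ℝ) : ℂ)) I u := by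
      simpa using (((hasDerivAt_id u).sub_const y₀).ofReal_comp).const_mul I
    exact (((hgood u).hasDerivAt_kern s ht).comp u h1).const_mul (F t)

lemma Rapid.contDiff_stieltjes_line {F : ℝ → ℂ} (hF : Rapid F) (y₀ : ℝ) :
    ∀ (n : ℕ) {s : ℝ}, 0 ≤ s → ContDiff ℝ n fun y : ℝ => stieltjes F s (I * (y - y₀ : ℝ)) := by
  intro n
  induction n with
  | zero =>
    intro s hs
    exact contDiff_zero.2 (continuous_iff_continuousAt.2 fun y =>
      (hF.hasDerivAt_stieltjes_line hs y₀ y).continuousAt)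
  | succ n ih =>
    intro s hs
    have hd : deriv (fun y : ℝ => stieltjes F s (I * (y - y₀ : ℝ)))
        = fun y : ℝ => -s * I * stieltjes F (s + 1) (I * (y - y₀ : ℝ)) :=
      funext fun y => (hF.hasDerivAt_stieltjes_line hs y₀ y).deriv
    rw [Nat.cast_add, Nat.cast_one, contDiff_succ_iff_deriv]
    refine ⟨fun y => (hF.hasDerivAt_stieltjes_line hs y₀ y).differentiableAt, fun h => ?_, ?_⟩
    · exact absurd h (by exact_mod_cast WithTop.natCast_ne_top n)
    · rw [hd]
      exact contDiff_const.mul (ih (by linarith))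

/-- A rapidly decaying smooth function on `(0, ∞)` with its derivatives. -/
structure RapidSeq (F : ℕ → ℝ → ℂ) : Prop where
  deriv : ∀ m t, 0 < t → HasDerivAt (F m) (F (m + 1) t) t
  bound : ∀ m (a : ℝ), ∃ C : ℝ, 0 ≤ C ∧ ∀ t, 0 < t → ‖F m t‖ ≤ C * t ^ a

lemma RapidSeq.rapid {F : ℕ → ℝ → ℂ} (hF : RapidSeq F) (m : ℕ) : Rapid (F m) :=
  ⟨fun t ht => (hF.deriv m t ht).continuousAt.continuousWithinAt, hF.bound m⟩

/-- Integration by parts in the Stieltjes transform. -/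
lemma RapidSeq.stieltjes_succ {F : ℕ → ℝ → ℂ} (hF : RapidSeq F) (m : ℕ) {s : ℝ} (hs : 0 ≤ s)
    {v : ℂ} (hv : Good v) : stieltjes (F (m + 1)) s v = s * stieltjes (F m) (s + 1) v := by
  have h1 := (hF.rapid m).mul_kern (by linarith : 0 ≤ s + 1) hv
  have h2 := (hF.rapid (m + 1)).mul_kern hs hv
  have h3 := (hF.rapid m).mul_kern hs hv
  have h := integral_Ioi_mul_deriv_eq_deriv_mul (a := 0) (u := F m) (v := kern s v)
    (u' := F (m + 1)) (v' := fun t => -s * kern (s + 1) v t) (a' := 0) (b' := 0)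
    (fun t ht => hF.deriv m t ht) (fun t ht => hv.hasDerivAt_kern' s ht) ?_ h2.integrableOn
    h3.tendsto_zero h3.tendsto_atTop
  · have e : ∫ t in Ioi (0 : ℝ), F m t * (-s * kern (s + 1) v t) = -s * stieltjes (F m) (s + 1) v := by
      rw [stieltjes, ← integral_const_mul]
      congr 1
      funext t
      ring
    rw [e, sub_zero, zero_sub] at h
    rw [stieltjes]
    linear_combination h
  · refine IntegrableOn.congr_fun (h1.integrableOn.const_mul (-s : ℂ)) (fun t _ => ?_)
      measurableSet_Ioi
    simp only [Pi.mul_apply]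
    ring

/-! ### Taylor expansions -/

/-- Induction through the mean value inequality: the derivative's remainder is at most `B yⁿ` on
`[0, y]`, and the length of the interval gives one more power. No `1/n!` is kept, as only the order
matters. -/
lemma norm_taylor_le (n : ℕ) : ∀ {Y B : ℝ} (F : ℕ → ℝ → ℂ),
    (∀ m t, 0 ≤ t → HasDerivWithinAt (F m) (F (m + 1) t) (Ici 0) t) →
    (∀ t ∈ Icc 0 Y, ‖F n t‖ ≤ B) → ∀ y ∈ Icc 0 Y,
      ‖F 0 y - ∑ m ∈ Finset.range n, (y : ℂ) ^ m * (F m 0 / m.factorial)‖ ≤ B * y ^ n := by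
  induction n with
  | zero =>
    intro Y B F hd hB y hy
    simpa using hB y hy
  | succ n ih =>
    intro Y B F hd hB y hy
    have h0 := hy.1
    have key := norm_image_sub_le_of_norm_deriv_le_segment' (a := 0) (b := y)
      (f := fun t : ℝ => F 0 t - ∑ m ∈ Finset.range (n + 1), (t : ℂ) ^ m * (F m 0 / m.factorial))
      (f' := fun t : ℝ => F 1 t - ∑ m ∈ Finset.range n, (t : ℂ) ^ m * (F (m + 1) 0 / m.factorial))
      (C := B * y ^ n) (fun t ht => ?_) (fun t ht => ?_) y ⟨h0, le_rfl⟩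
    · simp only [sub_zero] at key
      convert key using 1
      · rw [Finset.sum_range_succ' (fun m => (((0 : ℝ) : ℂ)) ^ m * (F m 0 / m.factorial))]
        simp
      · ring
    · refine ((hd 0 t ht.1).mono Icc_subset_Ici_self).sub ?_
      have : HasDerivAt (fun t : ℝ => ∑ m ∈ Finset.range (n + 1), (t : ℂ) ^ m * (F m 0 / m.factorial))
          (∑ m ∈ Finset.range (n + 1), ((m : ℂ) * (t : ℂ) ^ (m - 1)) * (F m 0 / m.factorial)) t := by
        refine HasDerivAt.fun_sum fun m _ => HasDerivAt.mul_const ?_ _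
        exact (hasDerivAt_pow m (t : ℂ)).comp_ofReal
      refine (this.congr_deriv ?_).hasDerivWithinAt
      rw [Finset.sum_range_succ']
      simp only [Nat.cast_zero, zero_mul, add_zero, Nat.add_sub_cancel]
      refine Finset.sum_congr rfl fun m _ => ?_
      rw [Nat.factorial_succ]
      have h1 : ((m + 1 : ℕ) : ℂ) ≠ 0 := Nat.cast_ne_zero.2 (by omega)
      have h2 : ((m.factorial : ℕ) : ℂ) ≠ 0 := Nat.cast_ne_zero.2 m.factorial_ne_zero
      push_cast at h1 ⊢
      field_simp
    · have := ih (Y := y) (B := B) (fun m => F (m + 1)) (fun m => hd (m + 1))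
        (fun s hs => hB s ⟨hs.1, hs.2.trans hy.2⟩) t ⟨ht.1, ht.2.le⟩
      refine this.trans ?_
      have hB0 : 0 ≤ B := (norm_nonneg _).trans (hB y hy)
      have := ht.1
      gcongr
      exact ht.2.le

lemma integral_Ioi_comp_add (g : ℝ → ℂ) (y : ℝ) :
    ∫ u in Ioi (0 : ℝ), g (y + u) = ∫ t in Ioi y, g t := by
  have h := (measurePreserving_add_left volume y).setIntegral_preimage_emb
    (MeasurableEquiv.addLeft y).measurableEmbedding g (Ioi y)
  rw [← h]
  congr 2
  ext u
  simp

/-! ### One asymptotic expansion shared by two transforms. -/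

namespace RapidSeq

variable {F : ℕ → ℝ → ℂ}

/-- The coefficients of the common expansion at `0` of the two transforms below. -/
def coeff (F : ℕ → ℝ → ℂ) (m : ℕ) : ℂ := 2 * stieltjes (F (m + 1)) (1 / 2) 0 / m.factorial

lemma coeff_zero (hF : RapidSeq F) : coeff F 0 = stieltjes (F 0) (3 / 2) 0 := by
  rw [coeff, zero_add, hF.stieltjes_succ 0 (by norm_num) good_zero]
  norm_num
  ring

/-- Differentiation raises the exponent to `3/2` and integration by parts lowers it again, so all
derivatives are transforms with the integrable exponent `1/2`. The endpoint follows from continuity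
of the derivative. -/
lemma hasDerivWithinAt_stieltjes (hF : RapidSeq F) (m : ℕ) {t : ℝ} (ht : 0 ≤ t) :
    HasDerivWithinAt (fun t : ℝ => stieltjes (F m) (1 / 2) t) (-stieltjes (F (m + 1)) (1 / 2) t)
      (Ici 0) t := by
  have hpos : ∀ t : ℝ, 0 < t → HasDerivAt (fun t : ℝ => stieltjes (F m) (1 / 2) t)
      (-stieltjes (F (m + 1)) (1 / 2) t) t := fun t ht => by
    have h := ((hF.rapid m).hasDerivAt_stieltjes (s := 1 / 2) (by norm_num)
      (v := t) (Or.inl (by simpa using ht))).comp_ofReal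
    refine h.congr_deriv ?_
    rw [hF.stieltjes_succ m (by norm_num) (Or.inl (by simpa using ht.le)), neg_mul]
  have hcont : ∀ j, ContinuousOn (fun t : ℝ => stieltjes (F j) (1 / 2) t) (Ici 0) := fun j =>
    ((hF.rapid j).continuousOn_stieltjes (by norm_num)).comp continuous_ofReal.continuousOn
      fun t ht => by simpa using ht
  rcases ht.eq_or_lt with rfl | ht
  · refine hasDerivWithinAt_Ici_of_tendsto_deriv (s := Ioi 0)
      (fun t ht => (hpos t ht).differentiableAt.differentiableWithinAt)
      ((hcont m 0 self_mem_Ici).mono Ioi_subset_Ici_self) self_mem_nhdsWithin ?_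
    refine Tendsto.congr' ?_ (((hcont (m + 1) 0 self_mem_Ici).mono Ioi_subset_Ici_self).neg)
    filter_upwards [self_mem_nhdsWithin] with t ht
    exact (hpos t ht).deriv.symm
  · exact (hpos t ht).hasDerivWithinAt

/-- The expansion of `∫_y^∞ F(t) (t + y)^{-3/2} dt` as `y → 0`. -/
lemma expansion_neg (hF : RapidSeq F) (n : ℕ) :
    (fun y : ℝ => (∫ t in Ioi y, F 0 t * kern (3 / 2) y t)
      - ∑ m ∈ Finset.range n, (-y : ℂ) ^ m * coeff F m) =O[𝓝[>] 0] fun y : ℝ => y ^ n := by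
  obtain ⟨C, hC, hb⟩ := (hF.rapid 0).bound (n + 3 / 2)
  -- These are the successive derivatives of the full integral `∫_0^∞ F(t) (t + y)^{-3/2} dt`.
  let H : ℕ → ℝ → ℂ := fun m t => (-1) ^ m * (2 * stieltjes (F (m + 1)) (1 / 2) t)
  have hH : ∀ m t, 0 ≤ t → HasDerivWithinAt (H m) (H (m + 1) t) (Ici 0) t := fun m t ht => by
    refine (((hF.hasDerivWithinAt_stieltjes (m + 1) ht).const_mul 2).const_mul
      ((-1) ^ m)).congr_deriv ?_
    simp only [H]
    ring
  obtain ⟨B, hB⟩ := isCompact_Icc.exists_bound_of_continuousOn (s := Icc (0 : ℝ) 1)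
    (f := H n) fun t ht => ((hH n t ht.1).continuousWithinAt).mono Icc_subset_Ici_self
  refine Asymptotics.IsBigO.of_bound (C + B) ?_
  filter_upwards [Ioo_mem_nhdsGT one_pos] with y hy
  have hy0 := hy.1
  have hgood : Good (y : ℂ) := Or.inl (by simpa using hy0.le)
  have h1 := norm_taylor_le n H hH hB y ⟨hy.1.le, hy.2.le⟩
  have hint := ((hF.rapid 0).mul_kern (s := 3 / 2) (by norm_num) hgood).integrableOn
  have h2 : ∫ t in Ioi y, F 0 t * kern (3 / 2) y t
      = H 0 y - ∫ t in Ioc 0 y, F 0 t * kern (3 / 2) y t := by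
    have h3 : stieltjes (F 0) (3 / 2) y = H 0 y := by
      simp only [H]
      rw [zero_add, hF.stieltjes_succ 0 (by norm_num) hgood]
      norm_num
      ring
    rw [← h3, stieltjes, ← Ioc_union_Ioi_eq_Ioi hy0.le, setIntegral_union
      (Set.Ioc_disjoint_Ioi le_rfl) measurableSet_Ioi (hint.mono_set Ioc_subset_Ioi_self)
      (hint.mono_set (Ioi_subset_Ioi hy0.le))]
    ring
  -- The missing piece over `(0, y)` has order beyond `yⁿ`: `F` is bounded by `C t^{n+3/2}` and the
  -- kernel by `t^{-3/2}`.
  have h4 : ‖∫ t in Ioc 0 y, F 0 t * kern (3 / 2) y t‖ ≤ C * y ^ n * y := by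
    have := norm_setIntegral_le_of_norm_le_const (μ := volume) (s := Ioc 0 y)
      (f := fun t => F 0 t * kern (3 / 2) y t) (C := C * y ^ n) (by simp) fun t ht => ?_
    · simpa [Real.volume_real_Ioc_of_le hy0.le] using this
    · rw [norm_mul]
      calc ‖F 0 t‖ * ‖kern (3 / 2) y t‖ ≤ C * t ^ (n + 3 / 2 : ℝ) * t ^ (-(3 / 2) : ℝ) := by
            gcongr
            · have := ht.1
              positivity
            · exact hb t ht.1
            · exact norm_kern_le_of_re (by norm_num) (by simpa using hy0.le) ht.1
        _ = C * t ^ n := by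
            rw [mul_assoc, ← Real.rpow_add ht.1, add_neg_cancel_right, Real.rpow_natCast]
        _ ≤ C * y ^ n := by
            have := ht.1
            gcongr
            exact ht.2
  have h5 : ∑ m ∈ Finset.range n, (-y : ℂ) ^ m * coeff F m
      = ∑ m ∈ Finset.range n, (y : ℂ) ^ m * (H m 0 / m.factorial) := by
    refine Finset.sum_congr rfl fun m _ => ?_
    simp only [H, coeff, ofReal_zero]
    rw [neg_pow]
    ring
  rw [h2, h5, Real.norm_of_nonneg (by positivity), sub_right_comm]
  calc _ ≤ B * y ^ n + C * y ^ n * y := (norm_sub_le _ _).trans (add_le_add h1 h4)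
    _ ≤ B * y ^ n + C * y ^ n * 1 := by
        gcongr
        exact hy.2.le
    _ = _ := by ring

/-- The expansion of `2 ∫_0^∞ F'(y + u) u^{-1/2} du` as `y → 0`. -/
lemma expansion_pos (hF : RapidSeq F) (n : ℕ) :
    (fun y : ℝ => 2 * (∫ u in Ioi (0 : ℝ), F 1 (y + u) * kern (1 / 2) 0 u)
      - ∑ m ∈ Finset.range n, (y : ℂ) ^ m * coeff F m) =O[𝓝[>] 0] fun y : ℝ => y ^ n := by
  obtain ⟨C₁, hC₁, hb₁⟩ := (hF.rapid (n + 1)).bound 0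
  obtain ⟨C₂, hC₂, hb₂⟩ := (hF.rapid (n + 1)).bound (-1)
  -- `F'(y + u)` is Taylor-expanded in `y` at base point `u` under the integral. The remainder is
  -- dominated using a constant near `u = 0` and `1/u` at infinity.
  let K : ℝ → ℝ := fun u => min C₁ (C₂ * u⁻¹) * u ^ (-(1 / 2) : ℝ)
  have hK : IntegrableOn K (Ioi 0) := by
    refine integrableOn_Ioi_of_rpow_bounds (a := -(1 / 2)) (b := -(3 / 2)) (C₁ := C₁) (C₂ := C₂)
      (by fun_prop) (by norm_num) (by norm_num) (fun t ht _ => ?_) fun t ht => ?_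
    · have : 0 ≤ min C₁ (C₂ * t⁻¹) := by positivity
      rw [Real.norm_of_nonneg (by positivity)]
      exact mul_le_mul_of_nonneg_right (min_le_left _ _) (by positivity)
    · have ht0 : 0 < t := by linarith
      have : 0 ≤ min C₁ (C₂ * t⁻¹) := by positivity
      rw [Real.norm_of_nonneg (by positivity)]
      refine (mul_le_mul_of_nonneg_right (min_le_right _ _) (by positivity)).trans (le_of_eq ?_)
      rw [mul_assoc, ← Real.rpow_neg_one, ← Real.rpow_add ht0]
      norm_num
  have hpt : ∀ y, 0 < y → ∀ u, 0 < u → ‖(F 1 (y + u) - ∑ m ∈ Finset.range n,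
      (y : ℂ) ^ m * (F (m + 1) u / m.factorial)) * kern (1 / 2) 0 u‖ ≤ y ^ n * K u := by
    intro y hy u hu
    have h1 := norm_taylor_le n (Y := y) (B := min C₁ (C₂ * u⁻¹)) (fun m t => F (m + 1) (t + u))
      (fun m t ht => ?_) (fun t ht => ?_) y ⟨hy.le, le_rfl⟩
    · rw [norm_mul, kern_zero _ hu, norm_real, Real.norm_of_nonneg (by positivity)]
      simp only [zero_add] at h1
      calc _ ≤ (min C₁ (C₂ * u⁻¹) * y ^ n) * u ^ (-(1 / 2) : ℝ) := by gcongr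
        _ = _ := by simp only [K]; ring
    · exact ((hF.deriv (m + 1) (t + u) (by linarith)).comp_add_const t u).hasDerivWithinAt
    · have ht0 : 0 < t + u := by linarith [ht.1]
      refine le_min ?_ ((hb₂ _ ht0).trans ?_)
      · simpa using hb₁ _ ht0
      · rw [Real.rpow_neg_one]
        gcongr
        linarith [ht.1]
  refine Asymptotics.IsBigO.of_bound (2 * ∫ u in Ioi 0, K u) ?_
  filter_upwards [self_mem_nhdsWithin] with y hy
  have hy0 : 0 < y := hy
  have hmeas : ContinuousOn (fun u => (F 1 (y + u) - ∑ m ∈ Finset.range n,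
      (y : ℂ) ^ m * (F (m + 1) u / m.factorial)) * kern (1 / 2) 0 u) (Ioi 0) := by
    refine ContinuousOn.mul (ContinuousOn.sub ?_ (continuousOn_finsetSum _ fun m _ =>
      continuousOn_const.mul ((hF.rapid (m + 1)).cont.div_const _))) (good_zero.continuousOn_kern _)
    exact (hF.rapid 1).cont.comp (by fun_prop) fun u hu => by
      have : 0 < u := hu
      exact mem_Ioi.2 (by linarith)
  have hint : IntegrableOn (fun u => (F 1 (y + u) - ∑ m ∈ Finset.range n,
      (y : ℂ) ^ m * (F (m + 1) u / m.factorial)) * kern (1 / 2) 0 u) (Ioi 0) := (hK.const_mul (y ^ n)).mono'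
    (hmeas.aestronglyMeasurable measurableSet_Ioi)
    ((ae_restrict_iff' measurableSet_Ioi).2 (Eventually.of_forall fun u hu => hpt y hy0 u hu))
  have hint' : ∀ m, IntegrableOn (fun u => F (m + 1) u * kern (1 / 2) 0 u) (Ioi 0) := fun m =>
    ((hF.rapid (m + 1)).mul_kern (by norm_num) good_zero).integrableOn
  have hsum : IntegrableOn (fun u => ∑ m ∈ Finset.range n, (y : ℂ) ^ m / m.factorial *
      (F (m + 1) u * kern (1 / 2) 0 u)) (Ioi 0) :=
    integrable_finsetSum _ fun m _ => (hint' m).const_mul _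
  have h6 : ∫ u in Ioi (0 : ℝ), F 1 (y + u) * kern (1 / 2) 0 u
      = (∫ u in Ioi (0 : ℝ), (F 1 (y + u) - ∑ m ∈ Finset.range n,
          (y : ℂ) ^ m * (F (m + 1) u / m.factorial)) * kern (1 / 2) 0 u)
        + ∑ m ∈ Finset.range n, (y : ℂ) ^ m / m.factorial * stieltjes (F (m + 1)) (1 / 2) 0 := by
    simp only [stieltjes, ← integral_const_mul]
    rw [← integral_finsetSum _ fun m _ => (hint' m).const_mul _, ← integral_add hint hsum]
    congr 1
    funext u
    rw [sub_mul, Finset.sum_mul, sub_add_eq_add_sub, eq_sub_iff_add_eq]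
    congr 1
    exact Finset.sum_congr rfl fun m _ => by ring
  have h7 : ∑ m ∈ Finset.range n, (y : ℂ) ^ m * coeff F m
      = 2 * ∑ m ∈ Finset.range n, (y : ℂ) ^ m / m.factorial * stieltjes (F (m + 1)) (1 / 2) 0 := by
    rw [Finset.mul_sum]
    refine Finset.sum_congr rfl fun m _ => ?_
    rw [coeff]
    ring
  rw [h6, h7, mul_add, add_sub_cancel_right, norm_mul, Real.norm_of_nonneg (by positivity)]
  have h8 := norm_integral_le_of_norm_le (hK.const_mul (y ^ n)) ((ae_restrict_iff'
    measurableSet_Ioi).2 (Eventually.of_forall fun u hu => hpt y hy0 u hu))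
  rw [integral_const_mul] at h8
  calc _ ≤ ‖(2 : ℂ)‖ * (y ^ n * ∫ u in Ioi 0, K u) := by gcongr
    _ = _ := by rw [norm_ofNat]; ring

end RapidSeq

/-! ### Derivatives of a holomorphic function along `(0, ∞)` -/

/-- Cauchy's estimate on the disc of radius `t/2` costs a factor of order `t^{-m}`, so the bound for
the function is taken with exponent `a + m`. -/
lemma rapidSeq_iteratedDeriv {φ : ℂ → ℂ} (hd : DifferentiableOn ℂ φ {τ | 0 < τ.re})
    (hb : ∀ a : ℝ, ∃ C : ℝ, 0 ≤ C ∧ ∀ t : ℝ, 0 < t → ∀ τ : ℂ, ‖τ - t‖ ≤ t / 2 →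
      ‖φ τ‖ ≤ C * t ^ a) : RapidSeq fun m t => iteratedDeriv m φ (t : ℂ) where
  deriv m t ht := by
    have ho : IsOpen {τ : ℂ | 0 < τ.re} := isOpen_lt continuous_const continuous_re
    have h := ((hd.analyticOnNhd ho).iterated_deriv m (t : ℂ)
      (show 0 < (t : ℂ).re by simpa using ht)).differentiableAt.hasDerivAt.comp_ofReal
    simpa only [iteratedDeriv_succ, iteratedDeriv_eq_iterate] using h
  bound m a := by
    obtain ⟨C, hC, h⟩ := hb (a + m)
    refine ⟨m.factorial * C * 2 ^ m, by positivity, fun t ht => ?_⟩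
    have hcl : DiffContOnCl ℂ φ (Metric.ball (t : ℂ) (t / 2)) := by
      refine (hd.mono fun τ hτ => ?_).diffContOnCl
      have h1 := Metric.closure_ball_subset_closedBall hτ
      rw [mem_closedBall_iff_norm] at h1
      have h2 := (abs_le.1 ((abs_re_le_norm _).trans h1)).1
      rw [sub_re, ofReal_re] at h2
      show 0 < τ.re
      linarith
    have h1 := norm_iteratedDeriv_le_of_forall_mem_sphere_norm_le m (half_pos ht) hcl
      fun τ hτ => h t ht τ (mem_sphere_iff_norm.1 hτ).le
    refine h1.trans (le_of_eq ?_)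
    rw [Real.rpow_add ht, Real.rpow_natCast, div_pow]
    have := ht.ne'
    field_simp

/-! ### Half-integral Gaussian integrals -/

/-- This is `Γ(1/2) = √π`. With the factor `c` in front, the case `c = 0`, which occurs for the term
`n = 0`, is included. -/
lemma integral_mul_exp_neg_mul_rpow {c : ℝ} (hc : 0 ≤ c) :
    IntegrableOn (fun u : ℝ => c * (u ^ (-(1 / 2) : ℝ) * Real.exp (-(c * u)))) (Ioi 0) ∧
      ∫ u in Ioi (0 : ℝ), c * (u ^ (-(1 / 2) : ℝ) * Real.exp (-(c * u))) = √(π * c) := by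
  rcases hc.eq_or_lt with rfl | hc
  · simp
  have h1 : (1 / 2 : ℝ) - 1 = -(1 / 2) := by norm_num
  have h := Real.integral_rpow_mul_exp_neg_mul_Ioi (a := 1 / 2) (by norm_num) hc
  have hi := integrableOn_rpow_mul_exp_neg_mul_rpow (s := -(1 / 2)) (p := 1) (b := c) (by norm_num) one_pos hc
  rw [h1] at h
  simp only [Real.rpow_one, neg_mul] at hi
  refine ⟨hi.const_mul c, ?_⟩
  rw [integral_const_mul, h, Real.Gamma_one_half_eq, ← Real.sqrt_eq_rpow, Real.sqrt_div zero_le_one,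
    Real.sqrt_one, Real.sqrt_mul Real.pi_pos.le]
  have : √c ≠ 0 := (Real.sqrt_pos.2 hc).ne'
  field_simp
  rw [Real.sq_sqrt hc.le]

/-! ### Restriction to a vertical ray -/

section ray

variable {ι : Type*}

/-- The `m`-th derivative of `τ ↦ f_k(x + i τ)` at the positive real number `t`. -/
def ray (f : ℂ → ι → ℂ) (x : ℚ) (k : ι) (m : ℕ) (t : ℝ) : ℂ :=
  iteratedDeriv m (fun τ : ℂ => f (x + I * τ) k) t

@[simp] lemma ray_zero (f : ℂ → ι → ℂ) (x : ℚ) (k : ι) (t : ℝ) :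
    ray f x k 0 t = f (x + I * t) k := by
  rw [ray, iteratedDeriv_zero]

lemma WeightHalf.rapidSeq_ray [Fintype ι] [DecidableEq ι] {f : ℂ → ι → ℂ}
    {M : Matrix ι ι ℂ} (hf : WeightHalf f M) (x : ℚ) (k : ι) : RapidSeq (ray f x k) := by
  refine rapidSeq_iteratedDeriv (fun τ hτ => ?_) (hf.decay_cusp x k)
  have h1 : DifferentiableAt ℂ (fun z => f z k) ((x : ℂ) + I * τ) :=
    hf.diff _ (by simpa using hτ) k
  exact (DifferentiableAt.comp (g := fun z => f z k) (f := fun τ : ℂ => (x : ℂ) + I * τ) τ h1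
    (by fun_prop)).differentiableWithinAt

end ray

/-! ### The characters and the two integrals along vertical lines. -/

section

variable {pp pm : ℕ}

/-- The constant `1 / (2 π √(2 p₊ p₋))`. -/
def rayConst (pp pm : ℕ) : ℂ := ((1 / (2 * π * √(2 * (pp * pm))) : ℝ) : ℂ)

lemma I_mul_cpow {r : ℝ} (hr : 0 < r) (s : ℂ) : (I * r) ^ s = exp (π * I / 2 * s) * (r : ℂ) ^ s := by
  rw [mul_comm, ofReal_pos_mul_cpow hr I_ne_zero, mul_comm, cpow_def_of_ne_zero I_ne_zero, log_I]
  congr 3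
  ring

lemma exp_three_pi_div_four : exp (3 * π * I / 4) = I * exp (π * I / 4) := by
  have : (3 * π * I / 4 : ℂ) = π / 2 * I + π * I / 4 := by ring
  rw [this, exp_add, exp_pi_div_two_mul_I]

/-- The factor `i` of `dz` together with `√(2i)` produces exactly the phase `i^{3/2}` of the kernel,
so a real constant remains, the same as for the characters. -/
lemma eichlerConst_mul (hpp : 2 ≤ pp) (hpm : 2 ≤ pm) :
    eichlerConst pp pm * I = rayConst pp pm * exp (3 * π * I / 4) := by
  have h1 : (2 * I : ℂ) ^ (1 / 2 : ℂ) = √2 * exp (π * I / 4) := by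
    have : (2 * I : ℂ) = I * (2 : ℝ) := by norm_num [mul_comm]
    rw [this, I_mul_cpow two_pos, sqrt_eq_cpow zero_le_two, mul_comm]
    congr 2
    ring
  rw [eichlerConst, h1, exp_three_pi_div_four, rayConst]
  have hN : (0 : ℝ) < pp * pm := by positivity
  rw [Real.sqrt_mul (by norm_num : (0 : ℝ) ≤ 2) (pp * pm)]
  have h2 : ((√2 : ℝ) : ℂ) ≠ 0 := ofReal_ne_zero.2 (by positivity)
  have h3 : ((√(pp * pm) : ℝ) : ℂ) ≠ 0 := ofReal_ne_zero.2 (by positivity)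
  have h4 : ((√2 : ℝ) : ℂ) ^ 2 = 2 := by rw [← ofReal_pow, Real.sq_sqrt (by norm_num)]; norm_num
  have h5 : (π : ℂ) ≠ 0 := ofReal_ne_zero.2 Real.pi_ne_zero
  generalize exp (π * I / 4) = e
  push_cast
  generalize ((√(pp * pm) : ℝ) : ℂ) = q at h3 ⊢
  generalize ((√2 : ℝ) : ℂ) = p at h2 h4 ⊢
  field_simp
  linear_combination 2 * e * h4

/-- On the path, `z - w = i(t + 2y)`; measured from the real point `x` the height is `y + t`, so the
kernel is `(height + y)^{-3/2}`. -/
lemma eichlerG_ray (hpp : 2 ≤ pp) (hpm : 2 ≤ pm) (x : ℚ) (k : kacTable pp pm) {y : ℝ} (hy : 0 < y) :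
    eichlerG pp pm (x - y * I) k = rayConst pp pm *
      ∫ t in Ioi y, ray (cuspVec pp pm) x k 0 t * kern (3 / 2) y t := by
  rw [← integral_Ioi_comp_add (fun t => ray (cuspVec pp pm) x k 0 t * kern (3 / 2) y t), eichlerG,
    ← integral_const_mul, ← integral_const_mul]
  refine setIntegral_congr_fun measurableSet_Ioi fun t ht => ?_
  have ht : 0 < t := ht
  have hpos : 0 < t + 2 * y := by linarith
  have h1 : (starRingEnd ℂ) ((x : ℂ) - y * I) + I * t = x + I * ((y + t : ℝ) : ℂ) := by
    simp
    ring
  have h2 : (x : ℂ) + I * ((y + t : ℝ) : ℂ) - (x - y * I) = I * ((t + 2 * y : ℝ) : ℂ) := by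
    push_cast
    ring
  have h3 : kern (3 / 2) y (y + t) = (((t + 2 * y : ℝ) : ℂ) ^ (3 / 2 : ℂ))⁻¹ := by
    rw [kern, ← cpow_neg]
    congr 1
    · push_cast
      ring
    · push_cast
      ring
  have h4 : exp (π * I / 2 * (3 / 2)) = exp (3 * π * I / 4) := by congr 1; ring
  simp only [eichlerIntegrand]
  rw [h1, h2, ray_zero, h3, I_mul_cpow hpos, h4]
  have h5 := exp_ne_zero (3 * π * I / 4)
  have h6 := eichlerConst_mul hpp hpm
  generalize exp (3 * π * I / 4) = e at *
  generalize ((t + 2 * y : ℝ) : ℂ) ^ (3 / 2 : ℂ) = q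
  rw [div_eq_mul_inv, mul_inv]
  have : e * e⁻¹ = 1 := mul_inv_cancel₀ h5
  linear_combination cuspVec pp pm (x + I * ((y + t : ℝ) : ℂ)) k * q⁻¹ * (e⁻¹ * h6 + rayConst pp pm * this)

/-- Since `-i(it - w) = t + iw`, the branch chosen in `cutPow` is the principal branch of the
Stieltjes kernel at `v = iw`. -/
lemma errorIntegrand_eq (w : ℂ) (k : kacTable pp pm) (t : ℝ) :
    errorIntegrand pp pm w k t
      = I / exp (3 * π * I / 4) * (ray (cuspVec pp pm) 0 k 0 t * kern (3 / 2) (I * w) t) := by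
  have h1 : -I * (I * t - w) = (t : ℂ) + I * w := by
    linear_combination (-(t : ℂ)) * I_mul_I
  have h2 : kern (3 / 2) (I * w) t = (((t : ℂ) + I * w) ^ (3 / 2 : ℂ))⁻¹ := by
    rw [kern, ← cpow_neg]
    push_cast
    rfl
  rw [errorIntegrand, cutPow, h1, ray_zero, h2, Rat.cast_zero, zero_add, div_eq_mul_inv, mul_inv]
  ring

lemma good_I_mul {w : ℂ} (hw : ¬(w.re = 0 ∧ 0 ≤ w.im)) : Good (I * w) := by
  by_cases h : w.re = 0
  · refine Or.inl ?_
    have : ¬ 0 ≤ w.im := fun h' => hw ⟨h, h'⟩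
    simp
    linarith
  · exact Or.inr (by simpa using h)

lemma integrableOn_errorIntegrand (hf : WeightHalf (cuspVec pp pm) (minimalS pp pm)) {w : ℂ}
    (hw : ¬(w.re = 0 ∧ 0 ≤ w.im)) (k : kacTable pp pm) :
    IntegrableOn (errorIntegrand pp pm w k) (Ioi 0) := by
  rw [show errorIntegrand pp pm w k = _ from funext (errorIntegrand_eq w k)]
  exact ((((hf.rapidSeq_ray 0 k).rapid 0).mul_kern (by norm_num)
    (good_I_mul hw)).integrableOn).const_mul _

lemma errorG_eq (hpp : 2 ≤ pp) (hpm : 2 ≤ pm) (w : ℂ) (k : kacTable pp pm) :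
    errorG pp pm w k = rayConst pp pm * stieltjes (ray (cuspVec pp pm) 0 k 0) (3 / 2) (I * w) := by
  rw [errorG, show errorIntegrand pp pm w k = _ from funext (errorIntegrand_eq w k),
    integral_const_mul, stieltjes, ← mul_assoc, ← mul_div_assoc, eichlerConst_mul hpp hpm,
    mul_div_cancel_right₀ _ (exp_ne_zero _)]

lemma ray_one (hpp : 2 ≤ pp) (hpm : 2 ≤ pm) (x : ℚ) (k : kacTable pp pm) {t : ℝ} (ht : 0 < t) :
    ray (cuspVec pp pm) x k 1 t = ∑' n : ℤ, -(thetaCoeff pp pm k n : ℂ)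
      * ((π * n ^ 2 / (2 * (pp * pm)) : ℝ) * qSq pp pm (x + I * t) n) := by
  have hN : (0 : ℝ) < pp * pm := by positivity
  have hz : 0 < ((x : ℂ) + I * t).im := by simpa using ht
  have h1 := hasDerivAt_thetaSeries hN (a := fun n => (thetaCoeff pp pm k n : ℂ)) (j := 0)
      (by simpa using abs_thetaCoeff_le pp pm k) hz
  have h2 : HasDerivAt (fun τ : ℂ => (x : ℂ) + I * τ) I t := by
    simpa using ((hasDerivAt_id (t : ℂ)).const_mul I).const_add (x : ℂ)
  have h3 := h1.comp (t : ℂ) h2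
  have h4 : (fun τ : ℂ => cuspVec pp pm ((x : ℂ) + I * τ) k) =ᶠ[𝓝 (t : ℂ)]
      thetaSeries (pp * pm) (fun n => (thetaCoeff pp pm k n : ℂ)) ∘ fun τ : ℂ => (x : ℂ) + I * τ := by
    filter_upwards [(isOpen_lt continuous_const continuous_re).mem_nhds
      (show (0 : ℝ) < (t : ℂ).re by simpa using ht)] with τ hτ
    exact cuspVec_eq_thetaSeries hpp hpm k (by simpa using hτ)
  rw [ray, iteratedDeriv_one, (h3.congr_of_eventuallyEq h4).deriv, ← tsum_mul_right]
  refine tsum_congr fun n => ?_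
  have hp : (pp : ℂ) ≠ 0 := Nat.cast_ne_zero.2 (by omega)
  have hm : (pm : ℂ) ≠ 0 := Nat.cast_ne_zero.2 (by omega)
  unfold qSq
  generalize qPow ((x : ℂ) + I * t) _ = q
  push_cast
  field_simp
  linear_combination (4 * (thetaCoeff pp pm k n : ℂ) * n ^ 2 * q) * I_mul_I

/-- The modified characters on a vertical line as half-integrals of the derivative of `f`. -/
lemma chiTilde_ray (hpp : 2 ≤ pp) (hpm : 2 ≤ pm) (x : ℚ) (k : kacTable pp pm) {y : ℝ} (hy : 0 < y) :
    chiTilde pp pm k.1.1 k.1.2 (x + y * I) = rayConst pp pm *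
      (2 * ∫ u in Ioi (0 : ℝ), ray (cuspVec pp pm) x k 1 (y + u) * kern (1 / 2) 0 u) := by
  have hN : (0 : ℝ) < pp * pm := by positivity
  have hz : 0 < ((x : ℂ) + I * y).im := by simpa using hy
  set z : ℂ := x + I * y with hzdef
  set c : ℤ → ℝ := fun n => π * n ^ 2 / (2 * (pp * pm)) with hc
  have hc0 : ∀ n, 0 ≤ c n := fun n => by positivity
  set a : ℤ → ℂ := fun n => -(thetaCoeff pp pm k n : ℂ) * qSq pp pm z n with ha
  set T : ℤ → ℝ → ℂ := fun n u =>
    a n * ((c n * (u ^ (-(1 / 2) : ℝ) * Real.exp (-(c n * u))) : ℝ) : ℂ) with hT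
  have hint : ∀ n, IntegrableOn (T n) (Ioi 0) := fun n =>
    ((integral_mul_exp_neg_mul_rpow (hc0 n)).1.ofReal).const_mul _
  have hval : ∀ n, ∫ u in Ioi (0 : ℝ), T n u = a n * (√(π * c n) : ℝ) := fun n => by
    rw [integral_const_mul, integral_complex_ofReal, (integral_mul_exp_neg_mul_rpow (hc0 n)).2]
  have hnorm : ∀ n, ∫ u in Ioi (0 : ℝ), ‖T n u‖ = ‖a n‖ * √(π * c n) := fun n => by
    rw [← (integral_mul_exp_neg_mul_rpow (hc0 n)).2, ← integral_const_mul]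
    refine setIntegral_congr_fun measurableSet_Ioi fun u hu => ?_
    have hu : 0 < u := hu
    have := hc0 n
    simp only [hT, norm_mul, norm_real]
    rw [Real.norm_of_nonneg this, Real.norm_of_nonneg (by positivity),
      Real.norm_of_nonneg (by positivity)]
  -- The derivative of `f` contributes `n²` and the half-integral takes it to `√(n²)`: here the
  -- absolute value in `χ̃` appears.
  have hsqrt : ∀ n, √(π * c n) = π / √(2 * (pp * pm)) * |(n : ℝ)| := fun n => by
    have : π * c n = (π / √(2 * (pp * pm)) * |(n : ℝ)|) ^ 2 := by
      rw [mul_pow, div_pow, Real.sq_sqrt (by positivity), sq_abs, hc]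
      ring
    rw [this, Real.sqrt_sq (by positivity)]
  have hchi := hasSum_chiTilde hpp hpm k hz
  -- The exchange of sum and integral is justified by the absolute convergence of the series for
  -- `χ̃` itself.
  have hsum : Summable fun n => ∫ u in Ioi (0 : ℝ), ‖T n u‖ := by
    refine (hchi.summable.norm.mul_left (2 * (pp * pm) * (π / √(2 * (pp * pm))))).congr fun n => ?_
    rw [hnorm, hsqrt, ha]
    simp only [norm_mul, norm_neg, norm_real, Real.norm_eq_abs, abs_abs, norm_div, norm_one,
      Complex.norm_natCast, Complex.norm_ofNat]
    have hp : (pp : ℝ) ≠ 0 := by positivity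
    have hm : (pm : ℝ) ≠ 0 := by positivity
    field_simp
  have h1 := hasSum_integral_of_summable_integral_norm hint hsum
  have h2 : ∫ u in Ioi (0 : ℝ), ∑' n, T n u
      = ∫ u in Ioi (0 : ℝ), ray (cuspVec pp pm) x k 1 (y + u) * kern (1 / 2) 0 u := by
    refine setIntegral_congr_fun measurableSet_Ioi fun u hu => ?_
    have hu : 0 < u := hu
    rw [ray_one hpp hpm x k (by linarith), ← tsum_mul_right]
    refine tsum_congr fun n => ?_
    have h3 : qSq pp pm (x + I * ((y + u : ℝ) : ℂ)) n
        = qSq pp pm z n * ((Real.exp (-(c n * u)) : ℝ) : ℂ) := by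
      rw [qSq, qPow, qSq, qPow, ofReal_exp, ← exp_add, hzdef, hc]
      congr 1
      have hp : (pp : ℂ) ≠ 0 := Nat.cast_ne_zero.2 (by omega)
      have hm : (pm : ℂ) ≠ 0 := Nat.cast_ne_zero.2 (by omega)
      push_cast
      field_simp
      ring_nf
      simp
      ring
    rw [show (π * (n : ℝ) ^ 2 / (2 * (pp * pm)) : ℝ) = c n from rfl, h3, kern_zero _ hu, hT, ha]
    push_cast
    ring
  have h4 := hchi.neg.unique ((h1.mul_left (rayConst pp pm * 2)).congr_fun fun n => ?_)
  · rw [neg_neg, h2] at h4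
    rw [← mul_assoc, ← h4, hzdef, mul_comm I]
  · rw [hval, hsqrt, ha, rayConst]
    have hp : (pp : ℂ) ≠ 0 := Nat.cast_ne_zero.2 (by omega)
    have hm : (pm : ℂ) ≠ 0 := Nat.cast_ne_zero.2 (by omega)
    have hs : ((√(2 * (pp * pm)) : ℝ) : ℂ) ≠ 0 := ofReal_ne_zero.2 (by positivity)
    have hs2 : ((√(2 * (pp * pm)) : ℝ) : ℂ) ^ 2 = 2 * (pp * pm) := by
      rw [← ofReal_pow, Real.sq_sqrt (by positivity)]
      push_cast
      ring
    have h5 : (π : ℂ) ≠ 0 := ofReal_ne_zero.2 Real.pi_ne_zero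
    rw [ofReal_div, ofReal_mul, ofReal_mul, ofReal_mul, ofReal_div]
    generalize ((√(2 * (pp * pm)) : ℝ) : ℂ) = s at hs hs2 ⊢
    beta_reduce
    generalize ((|(n : ℝ)| : ℝ) : ℂ) = r
    generalize qSq pp pm z n = q
    push_cast
    field_simp
    linear_combination -(thetaCoeff pp pm k n : ℂ) * r * q * hs2

end

/-! ### Primitives of exponentially decaying holomorphic functions on the upper half-plane -/

/-- Holomorphic functions on the upper half-plane decaying exponentially towards `i∞`. -/
structure DecayUpper (g : ℂ → ℂ) (κ : ℝ) : Prop where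
  diff : ∀ z : ℂ, 0 < z.im → DifferentiableAt ℂ g z
  pos : 0 < κ
  decay : ∀ δ : ℝ, 0 < δ → ∃ C : ℝ, 0 ≤ C ∧ ∀ z : ℂ, δ ≤ z.im → ‖g z‖ ≤ C * Real.exp (-κ * z.im)

/-- The integral of `g` from `z` to `i∞` along the vertical ray. -/
def upInt (g : ℂ → ℂ) (z : ℂ) : ℂ := ∫ t in Ioi (0 : ℝ), g (z + I * t) * I

namespace DecayUpper

variable {g : ℂ → ℂ} {κ : ℝ}

lemma deriv_decay (hg : DecayUpper g κ) {δ : ℝ} (hδ : 0 < δ) :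
    ∃ C : ℝ, 0 ≤ C ∧ ∀ z : ℂ, δ ≤ z.im → ‖deriv g z‖ ≤ C * Real.exp (-κ * z.im) := by
  obtain ⟨C, hC, h⟩ := hg.decay (δ / 2) (half_pos hδ)
  have hκ := hg.pos
  refine ⟨C * Real.exp (κ * (δ / 2)) / (δ / 2), by positivity, fun z hz => ?_⟩
  have him : ∀ w, ‖w - z‖ ≤ δ / 2 → z.im - δ / 2 ≤ w.im := fun w hw => by
    have h2 := (abs_le.1 ((abs_im_le_norm _).trans hw)).1
    rw [sub_im] at h2
    linarith
  have hd : DiffContOnCl ℂ g (Metric.ball z (δ / 2)) := by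
    refine DifferentiableOn.diffContOnCl fun w hw => (hg.diff w ?_).differentiableWithinAt
    have h1 := Metric.closure_ball_subset_closedBall hw
    rw [mem_closedBall_iff_norm] at h1
    linarith [him w h1]
  refine (norm_deriv_le_of_forall_mem_sphere_norm_le (half_pos hδ) hd
    (C := C * Real.exp (κ * (δ / 2)) * Real.exp (-κ * z.im)) fun w hw => ?_).trans
    (le_of_eq (by ring))
  have h1 := him w (mem_sphere_iff_norm.1 hw).le
  refine (h w (by linarith)).trans ?_
  rw [mul_assoc, ← Real.exp_add]
  gcongr
  nlinarith

lemma integrableOn_exp (hg : DecayUpper g κ) (y : ℝ) :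
    IntegrableOn (fun t : ℝ => Real.exp (-κ * (y + t))) (Ioi 0) := by
  refine IntegrableOn.congr_fun ((integrableOn_exp_mul_Ioi (neg_lt_zero.2 hg.pos) 0).const_mul
    (Real.exp (-κ * y))) (fun t _ => ?_) measurableSet_Ioi
  rw [← Real.exp_add]
  ring_nf

lemma continuousOn_ray (hg : DecayUpper g κ) {z : ℂ} (hz : 0 ≤ z.im) :
    ContinuousOn (fun t : ℝ => g (z + I * t) * I) (Ioi 0) := fun t ht => by
  have h1 : ContinuousAt g (z + I * t) := (hg.diff _ (by
    have : 0 < t := ht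
    simp
    linarith)).continuousAt
  exact (ContinuousAt.mul (ContinuousAt.comp (f := fun t : ℝ => z + I * t) h1 (by fun_prop))
    continuousAt_const).continuousWithinAt

lemma integrableOn (hg : DecayUpper g κ) {z : ℂ} (hz : 0 < z.im) :
    IntegrableOn (fun t : ℝ => g (z + I * t) * I) (Ioi 0) := by
  obtain ⟨C, hC, h⟩ := hg.decay z.im hz
  refine ((hg.integrableOn_exp z.im).const_mul C).mono'
    ((hg.continuousOn_ray hz.le).aestronglyMeasurable measurableSet_Ioi)
    ((ae_restrict_iff' measurableSet_Ioi).2 (Eventually.of_forall fun t ht => ?_))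
  have ht : 0 < t := ht
  have h1 : (z + I * t).im = z.im + t := by simp
  rw [norm_mul, norm_I, mul_one, ← h1]
  exact h _ (by linarith)

lemma norm_upInt_le (hg : DecayUpper g κ) {δ : ℝ} (hδ : 0 < δ) :
    ∃ C : ℝ, 0 ≤ C ∧ ∀ z : ℂ, δ ≤ z.im → ‖upInt g z‖ ≤ C * Real.exp (-κ * z.im) := by
  obtain ⟨C, hC, h⟩ := hg.decay δ hδ
  have hκ := hg.pos
  refine ⟨C / κ, by positivity, fun z hz => ?_⟩
  have h1 := norm_integral_le_of_norm_le (f := fun t : ℝ => g (z + I * t) * I)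
    ((hg.integrableOn_exp z.im).const_mul C)
    ((ae_restrict_iff' measurableSet_Ioi).2 (Eventually.of_forall fun t ht => ?_))
  · refine h1.trans (le_of_eq ?_)
    have h2 : ∀ t, C * Real.exp (-κ * (z.im + t)) = C * Real.exp (-κ * z.im) * Real.exp (-κ * t) :=
      fun t => by rw [mul_add, Real.exp_add, mul_assoc]
    simp only [h2]
    rw [integral_const_mul, integral_exp_mul_Ioi (neg_lt_zero.2 hκ)]
    simp
    ring
  · have ht : 0 < t := ht
    have h1 : (z + I * t).im = z.im + t := by simp
    rw [norm_mul, norm_I, mul_one, ← h1]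
    exact h _ (by linarith)

/-- Under the integral the `z`-derivative is also the derivative along the ray, so the fundamental
theorem leaves `-g(z)`, the other end contributing zero by decay. -/
lemma hasDerivAt_upInt (hg : DecayUpper g κ) {z : ℂ} (hz : 0 < z.im) :
    HasDerivAt (upInt g) (-g z) z := by
  obtain ⟨C, hC, h⟩ := hg.deriv_decay (half_pos hz)
  have hκ := hg.pos
  have ho : IsOpen {w : ℂ | 0 < w.im} := isOpen_lt continuous_const continuous_im
  have hd : DifferentiableOn ℂ g {w | 0 < w.im} := fun w hw => (hg.diff w hw).differentiableWithinAt
  have hdc : ContinuousOn (deriv g) {w | 0 < w.im} := (hd.deriv ho).continuousOn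
  have hline : ∀ t : ℝ, 0 < t → HasDerivAt (fun t : ℝ => g (z + I * t)) (deriv g (z + I * t) * I) t :=
    fun t ht => by
      have h1 := (hg.diff (z + I * t) (by simp; linarith)).hasDerivAt
      have h2 : HasDerivAt (fun t : ℂ => z + I * t) I t := by
        simpa using ((hasDerivAt_id (t : ℂ)).const_mul I).const_add z
      exact (h1.comp (t : ℂ) h2).comp_ofReal
  have hmeas : AEStronglyMeasurable (fun t : ℝ => deriv g (z + I * t) * I)
      (volume.restrict (Ioi 0)) := by
    refine ContinuousOn.aestronglyMeasurable ?_ measurableSet_Ioi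
    refine ContinuousOn.mul (hdc.comp (by fun_prop) fun t ht => ?_) continuousOn_const
    have ht : 0 < t := ht
    show 0 < (z + I * t).im
    simp
    linarith
  have hbd : ∀ t ∈ Ioi (0 : ℝ), ∀ w ∈ {w : ℂ | z.im / 2 < w.im},
      ‖deriv g (w + I * t) * I‖ ≤ C * Real.exp (-κ * (z.im / 2 + t)) := fun t ht w hw => by
    have ht : 0 < t := ht
    have hw : z.im / 2 < w.im := hw
    have h1 : (w + I * t).im = w.im + t := by simp
    rw [norm_mul, norm_I, mul_one]
    refine (h _ (by linarith)).trans ?_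
    rw [h1]
    gcongr C * Real.exp ?_
    nlinarith
  have hint' := (hg.integrableOn_exp (z.im / 2)).const_mul C
  have key := hasDerivAt_integral_of_dominated_loc_of_deriv_le (μ := volume.restrict (Ioi (0 : ℝ)))
    (F := fun (w : ℂ) (t : ℝ) => g (w + I * t) * I) (F' := fun w t => deriv g (w + I * t) * I)
    (bound := fun t => C * Real.exp (-κ * (z.im / 2 + t))) (s := {w | z.im / 2 < w.im})
    ((isOpen_lt continuous_const continuous_im).mem_nhds (half_lt_self hz)) ?_
    (hg.integrableOn hz) hmeas
    ((ae_restrict_iff' measurableSet_Ioi).2 (Eventually.of_forall hbd)) hint'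
    ((ae_restrict_iff' measurableSet_Ioi).2 (Eventually.of_forall fun t ht w hw => ?_))
  · refine key.2.congr_deriv ?_
    have h1 := integral_Ioi_of_hasDerivAt_of_tendsto (a := (0 : ℝ)) (m := 0)
      (f := fun t : ℝ => g (z + I * t)) (f' := fun t => deriv g (z + I * t) * I) ?_
      (fun t ht => hline t ht) ?_ ?_
    · simpa using h1
    · have h1 : ContinuousAt g (z + I * (0 : ℝ)) := (hg.diff _ (by simpa using hz)).continuousAt
      exact (ContinuousAt.comp (f := fun t : ℝ => z + I * t) h1 (by fun_prop)).continuousWithinAt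
    · refine hint'.mono' hmeas ((ae_restrict_iff' measurableSet_Ioi).2
        (Eventually.of_forall fun t ht => hbd t ht z (half_lt_self hz)))
    · obtain ⟨C', hC', h'⟩ := hg.decay z.im hz
      refine squeeze_zero_norm' (a := fun t => C' * Real.exp (-κ * (z.im + t))) ?_ ?_
      · filter_upwards [eventually_gt_atTop 0] with t ht
        have h1 : (z + I * t).im = z.im + t := by simp
        rw [← h1]
        exact h' _ (by linarith)
      · rw [show (0 : ℝ) = C' * 0 by ring]
        refine Tendsto.const_mul _ (Real.tendsto_exp_atBot.comp ?_)
        exact (tendsto_atTop_add_const_left _ _ tendsto_id).const_mul_atTop_of_neg (by linarith)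
  · filter_upwards [(isOpen_lt continuous_const continuous_im).mem_nhds (half_lt_self hz)] with w hw
    exact (hg.continuousOn_ray ((half_pos hz).le.trans (le_of_lt hw))).aestronglyMeasurable
      measurableSet_Ioi
  · have ht : 0 < t := ht
    have hw : z.im / 2 < w.im := hw
    have h1 := (hg.diff (w + I * t) (by simp; linarith)).hasDerivAt
    have h2 : HasDerivAt (fun w : ℂ => w + I * t) 1 w := (hasDerivAt_id w).add_const _
    simpa using (h1.comp w h2).mul_const I

end DecayUpper

/-! ### The Eichler integral on the lower half-plane -/

lemma WeightHalf.exists_decayUpper {ι : Type*} [Fintype ι] {f : ℂ → ι → ℂ}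
    {M : Matrix ι ι ℂ} (hf : WeightHalf f M) :
    ∃ κ : ℝ, ∀ w : ℂ, w.im < 0 → ∀ k,
      DecayUpper (fun z => ((z - w) ^ (3 / 2 : ℂ))⁻¹ * f z k) κ := by
  obtain ⟨κ, hκ, hdec⟩ := hf.decay
  refine ⟨κ, fun w hw k => ⟨fun z hz => ?_, hκ, fun δ hδ => ?_⟩⟩
  · have h1 : z - w ∈ slitPlane := Or.inr (by rw [sub_im]; linarith)
    exact (((differentiableAt_id.sub_const w).cpow_const h1).inv
      (cpow_ne_zero_of_ne (sub_ne_zero_of_im hz hw))).mul (hf.diff z hz k)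
  · obtain ⟨C, hC, h⟩ := hdec δ hδ
    have hpos : 0 < -w.im := by linarith
    refine ⟨(-w.im) ^ (-(3 / 2) : ℝ) * C, by positivity, fun z hz => ?_⟩
    rw [norm_mul, mul_assoc]
    refine mul_le_mul ?_ (h z hz k) (norm_nonneg _) (by positivity)
    have h1 : ‖((z - w) ^ (3 / 2 : ℂ))⁻¹‖ = ‖z - w‖ ^ (-(3 / 2) : ℝ) := by
      have : (3 / 2 : ℂ) = ((3 / 2 : ℝ) : ℂ) := by push_cast; rfl
      rw [norm_inv, this, norm_cpow_real, Real.rpow_neg (norm_nonneg _)]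
    rw [h1]
    refine Real.rpow_le_rpow_of_nonpos hpos ?_ (by norm_num)
    refine le_trans ?_ ((le_abs_self _).trans (abs_im_le_norm (z - w)))
    rw [sub_im]
    linarith

section Lower

variable {ι : Type*} [Fintype ι] [DecidableEq ι] {f : ℂ → ι → ℂ} {M : Matrix ι ι ℂ}

/-- The primitive `∫_z^{i∞} f(u) (u - w)^{-3/2} du`. -/
def eichlerPrim (f : ℂ → ι → ℂ) (w z : ℂ) (k : ι) : ℂ :=
  upInt (fun u => ((u - w) ^ (3 / 2 : ℂ))⁻¹ * f u k) z

/-- The matrix `(c w + d)^{-3/2} ρ(γ)` of the slash operator. -/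
def WeightHalf.slash (hf : WeightHalf f M) (γ : SL(2, ℤ)) (w : ℂ) : Matrix ι ι ℂ :=
  (autFactor (3 / 2) γ w)⁻¹ • (hf.multiplier γ : Matrix ι ι ℂ)

lemma WeightHalf.slash_mul (hf : WeightHalf f M) (γ₁ γ₂ : SL(2, ℤ)) {w : ℂ} (hw : w.im < 0) :
    hf.slash (γ₁ * γ₂) w = hf.slash γ₂ w * hf.slash γ₁ (mob γ₂ w) := by
  rw [slash, hf.isMultiplierSystem γ₁ γ₂ w hw, slash, slash, Matrix.smul_mul, Matrix.mul_smul,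
    smul_smul]

/-- The `z`-derivative vanishes: this is the law defining `ρ`, with `d(γz) = dz/(cz + d)²`. It
replaces any deformation of contours. -/
lemma WeightHalf.eichlerPrim_sub_const (hf : WeightHalf f M) (γ : SL(2, ℤ)) {w : ℂ} (hw : w.im < 0)
    {z z' : ℂ} (hz : 0 < z.im) (hz' : 0 < z'.im) :
    eichlerPrim f w z - hf.slash γ w *ᵥ eichlerPrim f (mob γ w) (mob γ z)
      = eichlerPrim f w z' - hf.slash γ w *ᵥ eichlerPrim f (mob γ w) (mob γ z') := by
  obtain ⟨κ, hκ⟩ := hf.exists_decayUpper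
  funext k
  have ho : IsOpen {w : ℂ | 0 < w.im} := isOpen_lt continuous_const continuous_im
  have hder : ∀ z : ℂ, 0 < z.im → HasDerivAt (fun z => (eichlerPrim f w z
      - hf.slash γ w *ᵥ eichlerPrim f (mob γ w) (mob γ z)) k) 0 z := fun z hz => by
    have h1 := (hκ w hw k).hasDerivAt_upInt hz
    have h2 : ∀ l, HasDerivAt (fun z => hf.slash γ w k l * eichlerPrim f (mob γ w) (mob γ z) l)
        (hf.slash γ w k l * (-(((mob γ z - mob γ w) ^ (3 / 2 : ℂ))⁻¹ * f (mob γ z) l)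
          * (1 / den γ z ^ 2))) z := fun l =>
      ((HasDerivAt.comp z ((hκ _ (mob_im_neg γ hw) l).hasDerivAt_upInt (mob_im_pos γ hz))
        (hasDerivAt_mob γ (den_ne_zero γ hz.ne')))).const_mul _
    refine (h1.sub (HasDerivAt.fun_sum fun l (_ : l ∈ Finset.univ) => h2 l)).congr_deriv ?_
    have h3 := congrFun (hf.multiplier_spec γ hz hw) k
    simp only [Pi.smul_apply, smul_eq_mul, Matrix.mulVec, dotProduct] at h3
    rw [h3, Finset.mul_sum, ← Finset.sum_neg_distrib, ← Finset.sum_sub_distrib]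
    refine Finset.sum_eq_zero fun l _ => ?_
    simp only [WeightHalf.slash, Matrix.smul_apply, smul_eq_mul]
    ring
  exact ho.is_const_of_deriv_eq_zero (convex_halfSpace_im_gt 0).isPreconnected
    (fun z hz => (hder z hz).differentiableAt.differentiableWithinAt)
    (fun z hz => (hder z hz).deriv) hz hz'

lemma WeightHalf.tendsto_eichlerPrim (hf : WeightHalf f M) {w : ℂ} (hw : w.im < 0) {α : Type*}
    {l : Filter α} {u : α → ℂ} (hu : Tendsto (fun a => (u a).im) l atTop) :
    Tendsto (fun a => eichlerPrim f w (u a)) l (𝓝 0) := by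
  obtain ⟨κ, hκ⟩ := hf.exists_decayUpper
  rw [tendsto_pi_nhds]
  intro k
  obtain ⟨C, hC, h⟩ := (hκ w hw k).norm_upInt_le one_pos
  refine squeeze_zero_norm' (a := fun a => C * Real.exp (-κ * (u a).im)) ?_ ?_
  · filter_upwards [hu.eventually_ge_atTop 1] with a ha
    exact h _ ha
  · rw [show (0 : ℝ) = C * 0 by ring]
    exact Tendsto.const_mul _ (Real.tendsto_exp_atBot.comp
      (hu.const_mul_atTop_of_neg (by linarith [(hκ w hw k).pos])))

/-- The normalised Eichler integral from the rational point `x`. -/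
def eichlerAt (f : ℂ → ι → ℂ) (x : ℚ) (w : ℂ) (k : ι) : ℂ :=
  stieltjes (ray f x k 0) (3 / 2) (I * (w - x))

/-- The normalised Eichler integral from `w̄`. -/
def eichlerLower (f : ℂ → ι → ℂ) (w : ℂ) : ι → ℂ :=
  (exp (3 * π * I / 4) / I) • eichlerPrim f w (starRingEnd ℂ w)

lemma inv_cpow_sub_ray {x w : ℂ} {t : ℝ} (h : 0 < ((t : ℂ) + I * (w - x)).re)
    (h' : ((x + I * t) - w).im > 0) :
    ((x + I * t - w) ^ (3 / 2 : ℂ))⁻¹ = (exp (3 * π * I / 4))⁻¹ * kern (3 / 2) (I * (w - x)) t := by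
  have h1 : x + I * t - w = I * ((t : ℂ) + I * (w - x)) := by
    linear_combination (x - w) * I_mul_I
  have h2 : I ^ (3 / 2 : ℂ) = exp (3 * π * I / 4) := by
    rw [cpow_def_of_ne_zero I_ne_zero, log_I]
    congr 1
    ring
  rw [h1] at h' ⊢
  rw [mul_cpow_of_im_pos (by simp) h h', h2, mul_inv, kern, ← cpow_neg]
  push_cast
  rfl

/-- Rapid decay of `f` at `x` makes the integrand integrable down to the cusp, so the lower end of
the path may be moved into it. -/
lemma WeightHalf.tendsto_eichlerPrim_rat (hf : WeightHalf f M) (x : ℚ) {w : ℂ} (hw : w.im < 0) :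
    Tendsto (fun ε : ℝ => eichlerPrim f w (x + I * ε)) (𝓝[>] 0)
      (𝓝 ((I / exp (3 * π * I / 4)) • eichlerAt f x w)) := by
  rw [tendsto_pi_nhds]
  intro k
  have hre : 0 < (I * (w - x)).re := by simpa using hw
  set q : ℝ → ℂ := fun t => I / exp (3 * π * I / 4) * (ray f x k 0 t * kern (3 / 2) (I * (w - x)) t)
  have hq : IntegrableOn q (Ioi 0) := (((hf.rapidSeq_ray x k).rapid 0).mul_kern (by norm_num)
    (Or.inl hre.le)).integrableOn.const_mul _
  have h1 : ∀ ε : ℝ, 0 < ε → eichlerPrim f w (x + I * ε) k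
      = (∫ t in Ioi 0, q t) - ∫ t in (0 : ℝ)..ε, q t := fun ε hε => by
    rw [← intervalIntegral.integral_interval_add_Ioi hq (hq.mono_set (Ioi_subset_Ioi hε.le)),
      add_sub_cancel_left, ← integral_Ioi_comp_add]
    refine setIntegral_congr_fun measurableSet_Ioi fun t ht => ?_
    have ht : 0 < t := ht
    have h2 : (x : ℂ) + I * ε + I * t = x + I * ((ε + t : ℝ) : ℂ) := by push_cast; ring
    simp only [q]
    rw [h2, inv_cpow_sub_ray ?_ ?_, ray_zero]
    · ring
    · rw [add_re, ofReal_re]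
      linarith
    · simp
      linarith
  have h3 : Tendsto (fun ε : ℝ => (∫ t in Ioi 0, q t) - ∫ t in (0 : ℝ)..ε, q t) (𝓝[>] 0)
      (𝓝 ((∫ t in Ioi 0, q t) - ∫ t in (0 : ℝ)..0, q t)) := by
    have h4 := intervalIntegral.continuousOn_primitive_interval (μ := volume) (a := 0) (b := 1)
      (f := q) ?_
    · refine Tendsto.const_sub _ ?_
      have h5 := h4 0 (by simp)
      refine (h5.mono_left ?_)
      rw [uIcc_of_le zero_le_one]
      exact nhdsWithin_le_of_mem (mem_of_superset (Ioo_mem_nhdsGT one_pos) Ioo_subset_Icc_self)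
    · rw [uIcc_of_le zero_le_one, integrableOn_Icc_iff_integrableOn_Ioc]
      exact hq.mono_set Ioc_subset_Ioi_self
  have h6 : ∫ t in Ioi 0, q t = ((I / exp (3 * π * I / 4)) • eichlerAt f x w) k :=
    integral_const_mul _ _
  rw [intervalIntegral.integral_same, sub_zero] at h3
  nth_rewrite 2 [h6] at h3
  exact h3.congr' (eventually_nhdsWithin_of_forall fun ε hε => (h1 ε hε).symm)

/-- The period of the Eichler integral. -/
def eichlerPeriod (f : ℂ → ι → ℂ) (γ : SL(2, ℤ)) (w : ℂ) : ι → ℂ :=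
  if γ 1 0 = 0 then 0 else eichlerAt f (-(γ 1 1 : ℚ) / γ 1 0) w

/-- The difference is independent of the base point `z`, which is `w̄` on the left. Moving `z` so
that `γz → i∞` kills the second term. If `c = 0` the first vanishes as well; otherwise `z` tends to
`-d/c` and the integral from that cusp is left. -/
lemma WeightHalf.eichlerLower_sub (hf : WeightHalf f M) (γ : SL(2, ℤ)) {w : ℂ} (hw : w.im < 0) :
    eichlerLower f w - hf.slash γ w *ᵥ eichlerLower f (mob γ w) = eichlerPeriod f γ w := by
  have hc : 0 < (starRingEnd ℂ w).im := by simpa using hw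
  have h0 : ∀ z : ℂ, 0 < z.im → eichlerLower f w - hf.slash γ w *ᵥ eichlerLower f (mob γ w)
      = (exp (3 * π * I / 4) / I) • (eichlerPrim f w z
        - hf.slash γ w *ᵥ eichlerPrim f (mob γ w) (mob γ z)) := fun z hz => by
    rw [hf.eichlerPrim_sub_const γ hw hz hc, eichlerLower, eichlerLower, mob_conj, smul_sub,
      Matrix.mulVec_smul]
  have hcont : Continuous fun v : ι → ℂ => hf.slash γ w *ᵥ v := by fun_prop
  rw [eichlerPeriod]
  split_ifs with h
  · have hd : ∀ z, den γ z = γ 1 1 := fun z => by rw [den, h]; simp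
    have him : Tendsto (fun T : ℝ => (I * T : ℂ).im) atTop atTop := by
      simpa using! tendsto_id (α := ℝ)
    have hn : 0 < normSq (γ 1 1 : ℂ) := by
      rw [← hd I]
      exact normSq_pos.2 (den_ne_zero γ (by simp))
    have him' : Tendsto (fun T : ℝ => (mob γ (I * T : ℂ)).im) atTop atTop := by
      refine (him.atTop_div_const hn).congr' ?_
      filter_upwards [eventually_gt_atTop 0] with T hT
      rw [mob_im γ (by simpa using hT.ne'), hd]
    have h1 := ((hf.tendsto_eichlerPrim hw him).sub (((hcont.tendsto 0).comp
      (hf.tendsto_eichlerPrim (mob_im_neg γ hw) him')))).const_smul (exp (3 * π * I / 4) / I)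
    rw [Matrix.mulVec_zero, sub_zero, smul_zero] at h1
    refine tendsto_nhds_unique (Tendsto.congr' ?_ tendsto_const_nhds) h1
    filter_upwards [eventually_gt_atTop 0] with T hT
    exact h0 _ (by simpa using hT)
  · set x : ℚ := -(γ 1 1 : ℚ) / γ 1 0 with hx
    have hcne : (γ 1 0 : ℂ) ≠ 0 := by exact_mod_cast h
    have hd : ∀ ε : ℝ, den γ (x + I * ε) = I * (γ 1 0 * ε : ℝ) := fun ε => by
      rw [den, hx]
      push_cast
      field_simp
      ring
    have hcr : (0 : ℝ) < (γ 1 0 : ℝ) ^ 2 := by positivity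
    have him' : Tendsto (fun ε : ℝ => (mob γ (x + I * ε : ℂ)).im) (𝓝[>] 0) atTop := by
      refine (tendsto_inv_nhdsGT_zero.atTop_div_const hcr).congr' ?_
      filter_upwards [self_mem_nhdsWithin] with ε hε
      have hε : 0 < ε := hε
      rw [mob_im γ (by simpa using hε.ne'), hd]
      simp only [map_mul, normSq_I, normSq_ofReal, add_im, ratCast_im, mul_im, I_re, I_im, ofReal_re,
        ofReal_im]
      field_simp
      simp
    have h1 := ((hf.tendsto_eichlerPrim_rat x hw).sub (((hcont.tendsto 0).comp
      (hf.tendsto_eichlerPrim (mob_im_neg γ hw) him')))).const_smul (exp (3 * π * I / 4) / I)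
    have h2 : exp (3 * π * I / 4) / I * (I / exp (3 * π * I / 4)) = 1 := by
      have := exp_ne_zero (3 * π * I / 4)
      field_simp
    rw [Matrix.mulVec_zero, sub_zero, smul_smul, h2, one_smul] at h1
    refine tendsto_nhds_unique (Tendsto.congr' ?_ tendsto_const_nhds) h1
    filter_upwards [self_mem_nhdsWithin] with ε hε
    exact h0 _ (by simpa using hε)

end Lower

/-! ### Passage to the rational points -/

/-- On the negative axis the principal branch takes its values from above. -/
lemma continuousWithinAt_cpow_const_of_im_nonneg {z : ℂ} (hz : z ≠ 0) (s : ℂ) :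
    ContinuousWithinAt (fun z : ℂ => z ^ s) {z | 0 ≤ z.im} z := by
  by_cases h : z ∈ slitPlane
  · exact (continuousAt_cpow_const h).continuousWithinAt
  · rw [mem_slitPlane_iff, not_or, not_lt, not_not] at h
    have hre : z.re < 0 := lt_of_le_of_ne h.1 fun h' => hz (Complex.ext h' h.2)
    have h1 : ContinuousWithinAt (fun z : ℂ => exp (log z * s)) {z | 0 ≤ z.im} z :=
      ((continuousWithinAt_log_of_re_neg_of_im_zero hre h.2).mul continuousWithinAt_const).cexp
    refine h1.congr_of_eventuallyEq ?_ (cpow_def_of_ne_zero hz s)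
    filter_upwards [mem_nhdsWithin_of_mem_nhds (isOpen_ne.mem_nhds hz)] with u hu
    exact cpow_def_of_ne_zero hu s

/-- For `c ≤ 0` the map `cw + d` sends the closed lower half-plane into the closed upper one, the
side from which the power is continuous. For `c > 0` the rotation by `i` takes a nonzero real
denominator off the cut. -/
lemma continuousWithinAt_autFactor (γ : SL(2, ℤ)) {w : ℂ} (hw : w.im = 0) (hd : den γ w ≠ 0) :
    ContinuousWithinAt (autFactor (3 / 2) γ) {w | w.im ≤ 0} w := by
  have hdc : ContinuousAt (den γ) w := (continuous_den γ).continuousAt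
  have him : (den γ w).im = 0 := by rw [den_im, hw, mul_zero]
  rw [show autFactor (3 / 2) γ = _ from funext (autFactor_eq γ)]
  split_ifs with h
  · refine ContinuousAt.continuousWithinAt (continuousAt_const.mul ?_)
    refine ContinuousAt.comp (g := fun z : ℂ => z ^ (3 / 2 : ℂ)) (f := fun w => I * den γ w)
      (continuousAt_cpow_const (Or.inr ?_)) (continuousAt_const.mul hdc)
    have : (I * den γ w).im = (den γ w).re := by simp
    rw [this]
    exact fun h' => hd (Complex.ext h' him)
  · refine ContinuousWithinAt.comp (g := fun z : ℂ => z ^ (3 / 2 : ℂ)) (t := {z | 0 ≤ z.im})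
      (continuousWithinAt_cpow_const_of_im_nonneg hd _) hdc.continuousWithinAt fun u hu => ?_
    show 0 ≤ (den γ u).im
    rw [den_im]
    have h2 : (γ 1 0 : ℝ) ≤ 0 := by exact_mod_cast not_lt.1 h
    exact mul_nonneg_of_nonpos_of_nonpos h2 hu

section Rational

variable {ι : Type*} [Fintype ι] [DecidableEq ι] {f : ℂ → ι → ℂ} {M : Matrix ι ι ℂ}

lemma WeightHalf.continuousWithinAt_eichlerAt (hf : WeightHalf f M) (x : ℚ) {w : ℂ}
    (hw : w.im ≤ 0) : ContinuousWithinAt (eichlerAt f x) {w | w.im ≤ 0} w := by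
  refine continuousWithinAt_pi.2 fun k => ?_
  have h1 := ((hf.rapidSeq_ray x k).rapid 0).continuousOn_stieltjes (s := 3 / 2) (by norm_num)
  have hre : ∀ w : ℂ, w.im ≤ 0 → 0 ≤ (I * (w - x)).re := fun w hw => by simpa using hw
  exact (h1 _ (hre w hw)).comp (f := fun w : ℂ => I * (w - x))
    (Continuous.continuousWithinAt (by fun_prop)) fun u hu => hre u hu

/-- The value of the Eichler integral at a rational point. -/
def eichlerRat (f : ℂ → ι → ℂ) (x : ℚ) : ι → ℂ := eichlerAt f x x

lemma mob_ratCast (γ : SL(2, ℤ)) (x : ℚ) : mob γ (x : ℂ) = ((mob γ x : ℚ) : ℂ) := by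
  simp [mob]

lemma mob_eq_of_den_eq {γ : SL(2, ℤ)} {x : ℚ} (h : (γ 1 0 : ℚ) * x + γ 1 1 = 0)
    (hc : γ 1 0 ≠ 0) : -(γ 1 1 : ℚ) / γ 1 0 = x := by
  have hc' : (γ 1 0 : ℚ) ≠ 0 := by exact_mod_cast hc
  field_simp
  linarith

/-- If `δ` sends `γx` to `∞`, then `δγ` sends `x` to `∞`. Combining the period relations of `δγ` and
`δ` through the cocycle gives that of `γ`, with integrals starting from `x` and `γx`. -/
lemma WeightHalf.eichlerLower_sub_rat (hf : WeightHalf f M) (γ : SL(2, ℤ)) (x : ℚ)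
    (hx : (γ 1 0 : ℚ) * x + γ 1 1 ≠ 0) {w : ℂ} (hw : w.im < 0) :
    eichlerPeriod f γ w
      = eichlerAt f x w - hf.slash γ w *ᵥ eichlerAt f (mob γ x) (mob γ w) := by
  obtain ⟨δ, hδ, hδ0⟩ := exists_den_eq_zero (mob γ x)
  have hden : ((δ * γ) 1 0 : ℚ) * x + ((δ * γ) 1 1 : ℤ) = 0 := by
    have h1 : (δ 1 0 : ℚ) * (γ 0 0 * x + γ 0 1) + δ 1 1 * (γ 1 0 * x + γ 1 1) = 0 := by
      have h2 : mob γ x * (γ 1 0 * x + γ 1 1) = γ 0 0 * x + γ 0 1 := div_mul_cancel₀ _ hx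
      rw [← h2]
      linear_combination (γ 1 0 * x + γ 1 1 : ℚ) * hδ
    rw [sl_mul_apply, sl_mul_apply]
    push_cast
    linear_combination h1
  have hc : (δ * γ) 1 0 ≠ 0 := by
    intro h0
    rw [h0] at hden
    have h1 : (δ * γ) 1 1 = 0 := by
      simpa using hden
    have h2 := det_eq (R := ℤ) (δ * γ)
    simp [h0, h1] at h2
  have h1 := hf.eichlerLower_sub (δ * γ) hw
  have h2 := hf.eichlerLower_sub δ (mob_im_neg γ hw)
  rw [eichlerPeriod, if_neg hc, mob_eq_of_den_eq hden hc] at h1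
  rw [eichlerPeriod, if_neg hδ0, mob_eq_of_den_eq hδ hδ0] at h2
  rw [← hf.eichlerLower_sub γ hw, ← h1, ← h2, hf.slash_mul δ γ hw,
    mob_mul δ γ (den_ne_zero γ hw.ne), Matrix.mulVec_sub, Matrix.mulVec_mulVec]
  abel

/-- Limit `w → x` from below in `eichlerLower_sub_rat`. The integrals from `x` and `γx` stay
continuous even at their own cusps because `f` decays rapidly there. -/
lemma WeightHalf.eichlerRat_sub (hf : WeightHalf f M) (γ : SL(2, ℤ)) (x : ℚ)
    (hx : (γ 1 0 : ℚ) * x + γ 1 1 ≠ 0) :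
    eichlerRat f x - hf.slash γ x *ᵥ eichlerRat f (mob γ x) = eichlerPeriod f γ x := by
  have hd : den γ x ≠ 0 := by
    rw [den]
    exact_mod_cast hx
  have him : ((x : ℂ)).im = 0 := by simp
  have hsub : {w : ℂ | w.im < 0} ⊆ {w : ℂ | w.im ≤ 0} := fun w hw => le_of_lt (α := ℝ) hw
  have hne : (𝓝[{w : ℂ | w.im < 0}] (x : ℂ)).NeBot := by
    rw [← mem_closure_iff_nhdsWithin_neBot, closure_setOfPred_im_lt]
    exact him.le
  have h1 : Tendsto (eichlerPeriod f γ) (𝓝[{w : ℂ | w.im < 0}] (x : ℂ))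
      (𝓝 (eichlerPeriod f γ x)) := by
    unfold eichlerPeriod
    split_ifs with h
    · exact tendsto_const_nhds
    · exact (hf.continuousWithinAt_eichlerAt _ him.le).mono hsub
  have h2 : ∀ k l, Tendsto (fun w => hf.slash γ w k l) (𝓝[{w : ℂ | w.im < 0}] (x : ℂ))
      (𝓝 (hf.slash γ x k l)) := fun k l =>
    (((continuousWithinAt_autFactor γ him hd).mono hsub).inv₀ (autFactor_ne_zero γ hd)).mul_const _
  have h3 : Tendsto (fun w => eichlerAt f (mob γ x) (mob γ w)) (𝓝[{w : ℂ | w.im < 0}] (x : ℂ))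
      (𝓝 (eichlerRat f (mob γ x))) := by
    rw [eichlerRat, ← mob_ratCast]
    refine ((hf.continuousWithinAt_eichlerAt (mob γ x) (w := mob γ (x : ℂ)) ?_).mono hsub).comp
      (hasDerivAt_mob γ hd).continuousAt.continuousWithinAt fun w hw => mob_im_neg γ hw
    rw [mob_ratCast, ratCast_im]
  have h4 : Tendsto (fun w => eichlerAt f x w - hf.slash γ w *ᵥ eichlerAt f (mob γ x) (mob γ w))
      (𝓝[{w : ℂ | w.im < 0}] (x : ℂ))
      (𝓝 (eichlerRat f x - hf.slash γ x *ᵥ eichlerRat f (mob γ x))) := by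
    refine Tendsto.sub ((hf.continuousWithinAt_eichlerAt x him.le).mono hsub) ?_
    refine tendsto_pi_nhds.2 fun k => tendsto_finsetSum _ fun l _ => ?_
    exact (h2 k l).mul (tendsto_pi_nhds.1 h3 l)
  refine tendsto_nhds_unique h4 (h1.congr' ?_)
  filter_upwards [self_mem_nhdsWithin] with w hw
  exact hf.eichlerLower_sub_rat γ x hx hw

lemma WeightHalf.contDiff_eichlerPeriod (hf : WeightHalf f M) (γ : SL(2, ℤ)) :
    ContDiff ℝ ∞ fun y : ℝ => eichlerPeriod f γ y := by
  unfold eichlerPeriod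
  split_ifs with h
  · exact contDiff_const
  · refine contDiff_pi.2 fun k => contDiff_infty.2 fun n => ?_
    have h1 := ((hf.rapidSeq_ray (-(γ 1 1 : ℚ) / γ 1 0) k).rapid 0).contDiff_stieltjes_line
      (-(γ 1 1 : ℝ) / γ 1 0) n (s := 3 / 2) (by norm_num)
    simpa [eichlerAt] using h1

lemma WeightHalf.analyticOnNhd_eichlerPeriod (hf : WeightHalf f M) (γ : SL(2, ℤ)) :
    AnalyticOnNhd ℝ (fun y : ℝ => eichlerPeriod f γ y)
      {x : ℝ | (γ 1 0 : ℝ) * x + (γ 1 1 : ℝ) ≠ 0} := by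
  unfold eichlerPeriod
  split_ifs with h
  · exact analyticOnNhd_const
  · intro y hy
    refine AnalyticAt.pi fun k => ?_
    have hs : IsOpen slitPlane := isOpen_slitPlane
    have h1 : AnalyticOnNhd ℂ (stieltjes (ray f (-(γ 1 1 : ℚ) / γ 1 0) k 0) (3 / 2)) slitPlane :=
      DifferentiableOn.analyticOnNhd (fun v hv =>
        (((hf.rapidSeq_ray _ k).rapid 0).hasDerivAt_stieltjes (s := 3 / 2) (by norm_num)
          hv).differentiableAt.differentiableWithinAt) hs
    have hmem : I * ((y : ℂ) - ((-(γ 1 1 : ℚ) / γ 1 0 : ℚ) : ℂ)) ∈ slitPlane := by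
      refine Or.inr ?_
      have hc : (γ 1 0 : ℝ) ≠ 0 := by exact_mod_cast h
      have h2 : (I * ((y : ℂ) - ((-(γ 1 1 : ℚ) / γ 1 0 : ℚ) : ℂ))).im
          = y - (-(γ 1 1 : ℝ) / γ 1 0) := by
        rw [I_mul_im, sub_re, ofReal_re, ratCast_re]
        push_cast
        rfl
      rw [h2]
      intro h3
      apply hy
      have : y = -(γ 1 1 : ℝ) / γ 1 0 := by linarith
      rw [this]
      field_simp
      ring
    have h3 : AnalyticAt ℝ (fun y : ℝ => I * ((y : ℂ) - ((-(γ 1 1 : ℚ) / γ 1 0 : ℚ) : ℂ))) y :=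
      analyticAt_const.mul ((ofRealCLM.analyticAt y).sub analyticAt_const)
    exact AnalyticAt.comp (f := fun y : ℝ => I * ((y : ℂ) - ((-(γ 1 1 : ℚ) / γ 1 0 : ℚ) : ℂ)))
      (h1 _ hmem).restrictScalars h3

end Rational

/-! ### Boundary values of the Stieltjes transform on the cut -/

lemma integrableOn_rpow_mul_min {C₁ C₂ e : ℝ} (h₁ : 0 ≤ C₁) (h₂ : 0 ≤ C₂) (he : -1 < e) (he' : e < 1) :
    IntegrableOn (fun u : ℝ => min C₁ (C₂ * u ^ (-2 : ℝ)) * u ^ e) (Ioi 0) := by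
  refine integrableOn_Ioi_of_rpow_bounds (a := e) (b := -2 + e) (C₁ := C₁) (C₂ := C₂)
    (by fun_prop) he (by linarith) (fun t ht _ => ?_) fun t ht => ?_
  · rw [Real.norm_of_nonneg (by positivity)]
    exact mul_le_mul_of_nonneg_right (min_le_left _ _) (by positivity)
  · have ht0 : 0 < t := by linarith
    rw [Real.norm_of_nonneg (by positivity)]
    refine (mul_le_mul_of_nonneg_right (min_le_right _ _) (by positivity)).trans (le_of_eq ?_)
    rw [mul_assoc, ← Real.rpow_add ht0]

/-- The half-integral `∫_0^∞ F'(y + u) u^{-1/2} du`. -/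
def halfInt (F : ℕ → ℝ → ℂ) (y : ℝ) : ℂ := ∫ u in Ioi (0 : ℝ), F 1 (y + u) * kern (1 / 2) 0 u

namespace RapidSeq

variable {F H : ℕ → ℝ → ℂ}

/-- One integrable majorant in `u` that serves all arguments `t ≥ u`, hence all shifts `a + u` with
`a ≥ 0`. -/
lemma exists_bound_min (hF : RapidSeq F) (m : ℕ) : ∃ C₁ C₂ : ℝ, 0 ≤ C₁ ∧ 0 ≤ C₂ ∧
    ∀ t u, 0 < u → u ≤ t → ‖F m t‖ ≤ min C₁ (C₂ * u ^ (-2 : ℝ)) := by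
  obtain ⟨C₁, hC₁, h₁⟩ := hF.bound m 0
  obtain ⟨C₂, hC₂, h₂⟩ := hF.bound m (-2)
  refine ⟨C₁, C₂, hC₁, hC₂, fun t u hu htu => le_min ?_ ?_⟩
  · simpa using h₁ t (by linarith)
  · exact (h₂ t (by linarith)).trans
      (mul_le_mul_of_nonneg_left (Real.rpow_le_rpow_of_nonpos hu htu (by norm_num)) hC₂)

lemma integrableOn_shift (hF : RapidSeq F) (m : ℕ) {a e : ℝ} (ha : 0 ≤ a) (he : -1 < e) (he' : e < 1) :
    IntegrableOn (fun u : ℝ => F m (a + u) * ((u ^ e : ℝ) : ℂ)) (Ioi 0) := by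
  obtain ⟨C₁, C₂, hC₁, hC₂, hb⟩ := hF.exists_bound_min m
  refine (integrableOn_rpow_mul_min hC₁ hC₂ he he').mono' ?_
    ((ae_restrict_iff' measurableSet_Ioi).2 (Eventually.of_forall fun u hu => ?_))
  · refine ContinuousOn.aestronglyMeasurable (ContinuousOn.mul ?_ ?_) measurableSet_Ioi
    · exact (hF.rapid m).cont.comp (by fun_prop) fun u hu => by
        have : 0 < u := hu
        exact mem_Ioi.2 (by linarith)
    · exact continuous_ofReal.comp_continuousOn
        (continuousOn_id.rpow_const fun u hu => Or.inl (ne_of_gt hu))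
  · have hu : 0 < u := hu
    rw [norm_mul, norm_real, Real.norm_of_nonneg (by positivity)]
    gcongr
    exact hb _ u hu (by linarith)

/-- The integrand is the derivative of `H(a + u) u^{1/2}`, which vanishes at both ends. -/
lemma integral_total_deriv (hH : RapidSeq H) {a : ℝ} (ha : 0 < a) :
    ∫ u in Ioi (0 : ℝ), (1 / 2 * (H 0 (a + u) * ((u ^ (-(1 / 2) : ℝ) : ℝ) : ℂ))
      + H 1 (a + u) * ((u ^ (1 / 2 : ℝ) : ℝ) : ℂ)) = 0 := by
  have hshift : ∀ u, 0 ≤ u → HasDerivAt (fun u => H 0 (a + u)) (H 1 (a + u)) u := fun u hu =>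
    (hH.deriv 0 (a + u) (by linarith)).comp_const_add a u
  have h := integral_Ioi_of_hasDerivAt_of_tendsto (a := (0 : ℝ)) (m := 0)
    (f := fun u : ℝ => H 0 (a + u) * ((u ^ (1 / 2 : ℝ) : ℝ) : ℂ))
    (f' := fun u : ℝ => 1 / 2 * (H 0 (a + u) * ((u ^ (-(1 / 2) : ℝ) : ℝ) : ℂ))
      + H 1 (a + u) * ((u ^ (1 / 2 : ℝ) : ℝ) : ℂ)) ?_ ?_ ?_ ?_
  · rw [h]
    simp
  · exact ((hshift 0 le_rfl).continuousAt.mul (continuous_ofReal.continuousAt.comp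
      (Real.continuousAt_rpow_const 0 _ (Or.inr (by norm_num))))).continuousWithinAt
  · intro u hu
    have hu : 0 < u := hu
    have h1 := (Real.hasDerivAt_rpow_const (p := 1 / 2) (Or.inl hu.ne')).ofReal_comp
    refine ((hshift u hu.le).mul h1).congr_deriv ?_
    have : (1 / 2 - 1 : ℝ) = -(1 / 2) := by norm_num
    rw [this]
    push_cast
    ring
  · exact ((hH.integrableOn_shift 0 ha.le (by norm_num) (by norm_num)).const_mul _).add
      (hH.integrableOn_shift 1 ha.le (by norm_num) (by norm_num))
  · obtain ⟨C₁, C₂, hC₁, hC₂, hb⟩ := hH.exists_bound_min 0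
    refine squeeze_zero_norm' (a := fun u => C₂ * u ^ (-(3 / 2) : ℝ)) ?_ ?_
    · filter_upwards [eventually_gt_atTop 0] with u hu
      rw [norm_mul, norm_real, Real.norm_of_nonneg (by positivity)]
      calc _ ≤ C₂ * u ^ (-2 : ℝ) * u ^ (1 / 2 : ℝ) := by
            gcongr
            exact (hb _ u hu (by linarith)).trans (min_le_right _ _)
        _ = _ := by
            rw [mul_assoc, ← Real.rpow_add hu]
            norm_num
    · simpa using (tendsto_rpow_neg_atTop (y := 3 / 2) (by norm_num)).const_mul C₂

lemma one_eq_of_inv (hF : RapidSeq F) (hH : RapidSeq H)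
    (hFH : ∀ t, 0 < t → F 0 t = ((t ^ (-(1 / 2) : ℝ) : ℝ) : ℂ) * H 0 t⁻¹) {s : ℝ} (hs : 0 < s) :
    F 1 s⁻¹ = -((s ^ (3 / 2 : ℝ) : ℝ) : ℂ) * (1 / 2 * H 0 s + s * H 1 s) := by
  have ht : 0 < s⁻¹ := inv_pos.2 hs
  have h1 := (Real.hasDerivAt_rpow_const (p := -(1 / 2)) (Or.inl ht.ne')).ofReal_comp
  have h2 : HasDerivAt (fun t : ℝ => H 0 t⁻¹) (-((s⁻¹ ^ 2)⁻¹ : ℝ) • H 1 s⁻¹⁻¹) s⁻¹ :=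
    HasDerivAt.scomp s⁻¹ (hH.deriv 0 s⁻¹⁻¹ (inv_pos.2 ht)) (hasDerivAt_inv ht.ne')
  have h3 : HasDerivAt (F 0) _ s⁻¹ := (h1.mul h2).congr_of_eventuallyEq
    (by filter_upwards [Ioi_mem_nhds ht] with t ht using hFH t ht)
  rw [(hF.deriv 0 _ ht).unique h3, inv_inv, inv_pow, inv_inv]
  have e1 : s⁻¹ ^ (-(1 / 2) - 1 : ℝ) = s ^ (3 / 2 : ℝ) := by
    rw [Real.inv_rpow hs.le, ← Real.rpow_neg hs.le]
    norm_num
  have e2 : s⁻¹ ^ (-(1 / 2) : ℝ) = s ^ (1 / 2 : ℝ) := by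
    rw [Real.inv_rpow hs.le, ← Real.rpow_neg hs.le]
    norm_num
  have e3 : s ^ (3 / 2 : ℝ) = s ^ (1 / 2 : ℝ) * s := by
    rw [← Real.rpow_add_one hs.ne']
    norm_num
  rw [e1, e2, e3, real_smul]
  push_cast
  ring

/-- The part of the boundary value of the Stieltjes transform coming from `(0, y)`. -/
lemma integral_Ioo_eq (hF : RapidSeq F) (hH : RapidSeq H)
    (hFH : ∀ t, 0 < t → F 0 t = ((t ^ (-(1 / 2) : ℝ) : ℝ) : ℂ) * H 0 t⁻¹) {y : ℝ} (hy : 0 < y) :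
    ∫ r in Ioo 0 y, F 1 (y - r) * ((r ^ (-(1 / 2) : ℝ) : ℝ) : ℂ)
      = -((y ^ (-(3 / 2) : ℝ) : ℝ) : ℂ) * halfInt H y⁻¹ := by
  have ha : 0 < y⁻¹ := inv_pos.2 hy
  -- This is `r = y - t` with `t = 1/(y⁻¹ + u)`: inversion takes `(0, y)` to `(y⁻¹, ∞)`.
  set φ : ℝ → ℝ := fun u => y - (y⁻¹ + u)⁻¹ with hφ
  have himg : φ '' Ioi 0 = Ioo 0 y := by
    ext r
    constructor
    · rintro ⟨u, hu, rfl⟩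
      have hu : 0 < u := hu
      have h1 : (y⁻¹ + u)⁻¹ < y := by
        rw [inv_lt_comm₀ (by positivity) hy]
        linarith
      have h2 : 0 < (y⁻¹ + u)⁻¹ := by positivity
      exact ⟨by simp only [hφ]; linarith, by simp only [hφ]; linarith⟩
    · rintro ⟨h0, h1⟩
      refine ⟨(y - r)⁻¹ - y⁻¹, ?_, ?_⟩
      · have : y⁻¹ < (y - r)⁻¹ := by
          apply inv_strictAnti₀ <;> linarith
        exact mem_Ioi.2 (by linarith)
      · simp [hφ]
  have hder : ∀ u ∈ Ioi (0 : ℝ), HasDerivWithinAt φ (((y⁻¹ + u) ^ 2)⁻¹) (Ioi 0) u := fun u hu => by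
    have hu : 0 < u := hu
    have h1 : y⁻¹ + u ≠ 0 := by positivity
    have h2 := (((hasDerivAt_id u).const_add y⁻¹).inv h1).const_sub y
    refine (h2.congr_deriv ?_).hasDerivWithinAt
    rw [id, neg_div, neg_neg, one_div]
  have hinj : InjOn φ (Ioi 0) := fun u _ u' _ h => by
    simpa [hφ] using h
  rw [← himg, integral_image_eq_integral_abs_deriv_smul measurableSet_Ioi hder hinj]
  -- After the substitution the integrand is a total derivative, which integrates to zero, plus a
  -- multiple of the half-integrand of `H` at `y⁻¹`.
  have hpt : ∀ u ∈ Ioi (0 : ℝ), |((y⁻¹ + u) ^ 2)⁻¹| • (F 1 (y - φ u) * ((φ u ^ (-(1 / 2) : ℝ) : ℝ) : ℂ))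
      = -((y ^ (-(1 / 2) : ℝ) : ℝ) : ℂ) * ((1 / 2 * (H 0 (y⁻¹ + u) * ((u ^ (-(1 / 2) : ℝ) : ℝ) : ℂ))
          + H 1 (y⁻¹ + u) * ((u ^ (1 / 2 : ℝ) : ℝ) : ℂ)))
        - ((y ^ (-(3 / 2) : ℝ) : ℝ) : ℂ) * (H 1 (y⁻¹ + u) * ((u ^ (-(1 / 2) : ℝ) : ℝ) : ℂ)) := by
    intro u hu
    have hu : 0 < u := hu
    set s := y⁻¹ + u with hs
    have hs0 : 0 < s := by positivity
    have h1 : y - φ u = s⁻¹ := by simp [hφ, hs]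
    have h2 : φ u = u * y * s⁻¹ := by
      have : s * y = 1 + u * y := by rw [hs, add_mul, inv_mul_cancel₀ hy.ne']
      have h3 : y = (1 + u * y) * s⁻¹ := by
        rw [← this]
        field_simp
      rw [hφ]
      simp only
      rw [← hs]
      linear_combination h3
    have e1 : φ u ^ (-(1 / 2) : ℝ) = u ^ (-(1 / 2) : ℝ) * y ^ (-(1 / 2) : ℝ) * s ^ (1 / 2 : ℝ) := by
      rw [h2, Real.mul_rpow (by positivity) (by positivity), Real.mul_rpow hu.le hy.le,
        Real.inv_rpow hs0.le, ← Real.rpow_neg hs0.le, neg_neg]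
    have e2 : s ^ (3 / 2 : ℝ) * s ^ (1 / 2 : ℝ) = s ^ 2 := by
      rw [← Real.rpow_add hs0, ← Real.rpow_natCast]
      norm_num
    have e3 : y ^ (-(3 / 2) : ℝ) = y ^ (-(1 / 2) : ℝ) * y⁻¹ := by
      rw [← Real.rpow_neg_one y, ← Real.rpow_add hy]
      norm_num
    have e4 : u ^ (1 / 2 : ℝ) = u ^ (-(1 / 2) : ℝ) * u := by
      rw [← Real.rpow_add_one hu.ne']
      norm_num
    rw [h1, hF.one_eq_of_inv hH hFH hs0, e1, e3, e4, abs_of_pos (by positivity), real_smul]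
    have e5 : ((s : ℝ) : ℂ) = (y⁻¹ : ℝ) + u := by rw [hs]; push_cast; rfl
    have e6 : (((s ^ 2)⁻¹ : ℝ) : ℂ) * (((s ^ (3 / 2 : ℝ) : ℝ) : ℂ) * ((s ^ (1 / 2 : ℝ) : ℝ) : ℂ)) = 1 := by
      rw [← ofReal_mul, ← ofReal_mul, e2, inv_mul_cancel₀ (by positivity), ofReal_one]
    rw [ofReal_mul (u ^ (-(1 / 2) : ℝ) * y ^ (-(1 / 2) : ℝ)), ofReal_mul (u ^ (-(1 / 2) : ℝ)),
      ofReal_mul (y ^ (-(1 / 2) : ℝ)), ofReal_mul (u ^ (-(1 / 2) : ℝ))]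
    generalize ((s ^ (3 / 2 : ℝ) : ℝ) : ℂ) = s3 at *
    generalize ((s ^ (1 / 2 : ℝ) : ℝ) : ℂ) = s1 at *
    generalize ((u ^ (-(1 / 2) : ℝ) : ℝ) : ℂ) = u1 at *
    generalize ((y ^ (-(1 / 2) : ℝ) : ℝ) : ℂ) = y1 at *
    generalize (((s ^ 2)⁻¹ : ℝ) : ℂ) = s2 at *
    linear_combination (-(1 / 2 * H 0 s + s * H 1 s) * u1 * y1) * e6 - (H 1 s * u1 * y1) * e5
  rw [setIntegral_congr_fun measurableSet_Ioi hpt]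
  have hi0 := hH.integrableOn_shift 0 (e := -(1 / 2)) ha.le (by norm_num) (by norm_num)
  have hi1 := hH.integrableOn_shift 1 (e := 1 / 2) ha.le (by norm_num) (by norm_num)
  have hi2 := hH.integrableOn_shift 1 (e := -(1 / 2)) ha.le (by norm_num) (by norm_num)
  have hi3 : IntegrableOn (fun u => 1 / 2 * (H 0 (y⁻¹ + u) * ((u ^ (-(1 / 2) : ℝ) : ℝ) : ℂ))
      + H 1 (y⁻¹ + u) * ((u ^ (1 / 2 : ℝ) : ℝ) : ℂ)) (Ioi 0) := (hi0.const_mul _).add hi1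
  rw [integral_sub (hi3.const_mul _) (hi2.const_mul _), integral_const_mul,
    hH.integral_total_deriv ha, mul_zero, zero_sub, integral_const_mul, neg_mul, halfInt]
  congr 2
  refine setIntegral_congr_fun measurableSet_Ioi fun u hu => ?_
  rw [kern_zero _ hu]

/-- Extension of `F'` by zero. -/
def extendZero (F : ℕ → ℝ → ℂ) : ℝ → ℂ := (Ioi 0).indicator (F 1)

lemma extendZero_of_pos {t : ℝ} (ht : 0 < t) : extendZero F t = F 1 t := indicator_of_mem ht _

lemma extendZero_of_nonpos {t : ℝ} (ht : t ≤ 0) : extendZero F t = 0 :=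
  indicator_of_notMem (not_lt.2 ht) _

/-- Continuity at `0` comes from `|F'(t)| ≤ C t`. The extension fixes the range of integration while
the singular point moves. -/
lemma continuous_extendZero (hF : RapidSeq F) : Continuous (extendZero F) := by
  rw [continuous_iff_continuousAt]
  intro t
  rcases lt_trichotomy t 0 with ht | rfl | ht
  · refine continuousAt_const (y := (0 : ℂ)).congr ?_
    filter_upwards [Iio_mem_nhds ht] with u hu
    exact (extendZero_of_nonpos (le_of_lt hu)).symm
  · obtain ⟨C, hC, h⟩ := hF.bound 1 1
    rw [ContinuousAt, extendZero_of_nonpos le_rfl]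
    refine squeeze_zero_norm (a := fun t => C * |t|) (fun t => ?_) ?_
    · rcases lt_or_ge 0 t with ht | ht
      · rw [extendZero_of_pos ht, abs_of_pos ht]
        simpa using h t ht
      · rw [extendZero_of_nonpos ht, norm_zero]
        positivity
    · have : Continuous fun t : ℝ => C * |t| := by fun_prop
      simpa using this.tendsto 0
  · refine (hF.deriv 1 t ht).continuousAt.congr ?_
    filter_upwards [Ioi_mem_nhds ht] with u hu
    exact (extendZero_of_pos hu).symm

/-- The variable `r = t + Re v` puts the singularity of the kernel at `r = 0` for every `v`; the
integral is then split there, with `r` reversed on the negative side. -/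
lemma stieltjes_eq_add (hF : RapidSeq F) {v : ℂ} (hv : v.im ≠ 0) :
    stieltjes (F 1) (1 / 2) v
      = (∫ r in Ioi (0 : ℝ), extendZero F (r - v.re) * kern (1 / 2) (I * v.im) r)
        + ∫ r in Ioi (0 : ℝ), extendZero F (-r - v.re) * kern (1 / 2) (I * v.im) (-r) := by
  have hint := ((hF.rapid 1).mul_kern (s := 1 / 2) (by norm_num) (Or.inr hv : Good v)).integrableOn
  have h1 : (Ioi (0 : ℝ)).indicator (fun t => F 1 t * kern (1 / 2) v t)
      = fun t => extendZero F t * kern (1 / 2) v t := by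
    funext t
    rw [extendZero, ← indicator_mul_left]
  have hint' : Integrable fun t => extendZero F t * kern (1 / 2) v t := by
    rw [← h1, integrable_indicator_iff measurableSet_Ioi]
    exact hint
  have h2 : ∀ r : ℝ, kern (1 / 2) v (r - v.re) = kern (1 / 2) (I * v.im) r := fun r => by
    rw [kern, kern]
    congr 1
    push_cast
    linear_combination -re_add_im v
  have hint'' : Integrable fun r => extendZero F (r - v.re) * kern (1 / 2) (I * v.im) r := by
    simp only [← h2]
    exact hint'.comp_sub_right v.re
  have h3 : stieltjes (F 1) (1 / 2) v
      = ∫ r, extendZero F (r - v.re) * kern (1 / 2) (I * v.im) r := by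
    simp only [← h2]
    rw [integral_sub_right_eq_self (fun t => extendZero F t * kern (1 / 2) v t), ← h1,
      integral_indicator measurableSet_Ioi, stieltjes]
  have h4 := integral_comp_neg_Ioi 0 fun r => extendZero F (r - v.re) * kern (1 / 2) (I * v.im) r
  rw [neg_zero] at h4
  rw [h3, h4, add_comm, intervalIntegral.integral_Iic_add_Ioi hint''.integrableOn
    hint''.integrableOn]

lemma norm_kern_le_abs {e r : ℝ} (hr : r ≠ 0) : ‖kern (1 / 2) (I * e) r‖ ≤ |r| ^ (-(1 / 2) : ℝ) := by
  rw [norm_kern]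
  refine Real.rpow_le_rpow_of_nonpos (abs_pos.2 hr) ?_ (by norm_num)
  have := abs_re_le_norm ((r : ℂ) + I * e)
  simpa using this

lemma continuous_kern_im {r : ℝ} (hr : 0 < r) {e : ℝ} :
    ContinuousAt (fun v : ℂ => kern (1 / 2) (I * v.im) r) e := by
  unfold kern
  refine ContinuousAt.comp (g := fun z : ℂ => z ^ ((-(1 / 2) : ℝ) : ℂ))
    (f := fun v : ℂ => (r : ℂ) + I * v.im) (continuousAt_cpow_const (Or.inl ?_)) ?_
  · simpa using hr
  · exact Continuous.continuousAt (by fun_prop)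

/-- Below the cut the argument tends to `-π`, so the power `-1/2` acquires the factor `e^{πi/2} =
i`. -/
lemma tendsto_kern_neg {r : ℝ} (hr : 0 < r) (x : ℝ) :
    Tendsto (fun v : ℂ => kern (1 / 2) (I * v.im) (-r)) (𝓝[{v | v.im < 0}] (x : ℂ))
      (𝓝 (I * ((r ^ (-(1 / 2) : ℝ) : ℝ) : ℂ))) := by
  have h1 := tendsto_log_nhdsWithin_im_neg_of_re_neg_of_im_zero (z := ((-r : ℝ) : ℂ))
    (by simpa using hr) (ofReal_im _)
  have h2 : Tendsto (fun v : ℂ => ((-r : ℝ) : ℂ) + I * v.im) (𝓝[{v | v.im < 0}] (x : ℂ))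
      (𝓝[{v | v.im < 0}] ((-r : ℝ) : ℂ)) := by
    refine tendsto_nhdsWithin_iff.2 ⟨?_, ?_⟩
    · have : Continuous fun v : ℂ => ((-r : ℝ) : ℂ) + I * v.im := by fun_prop
      have h3 := this.tendsto (x : ℂ)
      simp only [ofReal_im, ofReal_zero, mul_zero, add_zero] at h3
      exact h3.mono_left nhdsWithin_le_nhds
    · filter_upwards [self_mem_nhdsWithin] with v hv
      have hv : v.im < 0 := hv
      show (((-r : ℝ) : ℂ) + I * v.im).im < 0
      simpa using hv
  have h3 := ((h1.comp h2).mul_const ((-(1 / 2) : ℝ) : ℂ)).cexp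
  have h4 : exp ((Real.log ‖((-r : ℝ) : ℂ)‖ - π * I) * ((-(1 / 2) : ℝ) : ℂ))
      = I * ((r ^ (-(1 / 2) : ℝ) : ℝ) : ℂ) := by
    rw [norm_real, norm_neg, Real.norm_of_nonneg hr.le, Real.rpow_def_of_pos hr, ofReal_exp]
    conv_rhs => rw [← exp_pi_div_two_mul_I, ← exp_add]
    congr 1
    push_cast
    ring
  rw [h4] at h3
  refine h3.congr' ?_
  filter_upwards [self_mem_nhdsWithin] with v hv
  have hv : v.im < 0 := hv
  rw [kern, cpow_def_of_ne_zero]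
  · rfl
  · intro h
    have := congrArg im h
    simp at this
    exact hv.ne this

/-- The boundary value of the Stieltjes transform on the lower side of the cut. -/
lemma tendsto_stieltjes_cut (hF : RapidSeq F) (hH : RapidSeq H)
    (hFH : ∀ t, 0 < t → F 0 t = ((t ^ (-(1 / 2) : ℝ) : ℝ) : ℂ) * H 0 t⁻¹) {y : ℝ} (hy : 0 < y) :
    Tendsto (fun v : ℂ => stieltjes (F 0) (3 / 2) v) (𝓝[{v | v.im < 0}] ((-y : ℝ) : ℂ))
      (𝓝 (2 * halfInt F y - 2 * I * ((y ^ (-(3 / 2) : ℝ) : ℝ) : ℂ) * halfInt H y⁻¹)) := by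
  obtain ⟨C₁, C₂, hC₁, hC₂, hb⟩ := hF.exists_bound_min 1
  have hcont := hF.continuous_extendZero
  have hre : ∀ r, Tendsto (fun v : ℂ => extendZero F (r - v.re)) (𝓝[{v | v.im < 0}] ((-y : ℝ) : ℂ))
      (𝓝 (extendZero F (r + y))) := fun r => by
    have : Continuous fun v : ℂ => extendZero F (r - v.re) := by fun_prop
    have h1 := this.tendsto ((-y : ℝ) : ℂ)
    rw [ofReal_re, sub_neg_eq_add] at h1
    exact h1.mono_left nhdsWithin_le_nhds
  have hnear : ∀ᶠ v : ℂ in 𝓝[{v | v.im < 0}] ((-y : ℝ) : ℂ), v.re < 0 ∧ -(2 * y) < v.re := by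
    have h1 : ∀ᶠ v : ℂ in 𝓝 ((-y : ℝ) : ℂ), v.re < 0 ∧ -(2 * y) < v.re :=
      ((isOpen_lt continuous_re continuous_const).inter
        (isOpen_lt continuous_const continuous_re)).mem_nhds (by
          constructor
          · show (((-y : ℝ) : ℂ)).re < 0
            rw [ofReal_re]; linarith
          · show -(2 * y) < (((-y : ℝ) : ℂ)).re
            rw [ofReal_re]; linarith)
    exact h1.filter_mono nhdsWithin_le_nhds
  have hkc : ∀ e : ℝ, e ≠ 0 → ∀ σ : ℝ, Continuous fun r : ℝ => kern (1 / 2) (I * e) (σ * r) :=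
    fun e he σ => by
      unfold kern
      refine continuous_iff_continuousAt.2 fun r => ContinuousAt.comp
        (g := fun z : ℂ => z ^ ((-(1 / 2) : ℝ) : ℂ)) (f := fun r : ℝ => ((σ * r : ℝ) : ℂ) + I * e)
        (continuousAt_cpow_const (Or.inr ?_)) (Continuous.continuousAt (by fun_prop))
      simpa using he
  -- The part beyond the singular point tends to the half-integral of `F` at `y`.
  have hlim1 : Tendsto (fun v : ℂ => ∫ r in Ioi (0 : ℝ),
      extendZero F (r - v.re) * kern (1 / 2) (I * v.im) r) (𝓝[{v | v.im < 0}] ((-y : ℝ) : ℂ))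
      (𝓝 (halfInt F y)) := by
    have h0 : halfInt F y = ∫ r in Ioi (0 : ℝ), extendZero F (r + y) * kern (1 / 2) 0 r :=
      setIntegral_congr_fun measurableSet_Ioi fun r hr => by
        have hr : 0 < r := hr
        rw [extendZero_of_pos (by linarith), add_comm]
    rw [h0]
    refine tendsto_integral_filter_of_dominated_convergence
      (fun r => min C₁ (C₂ * r ^ (-2 : ℝ)) * r ^ (-(1 / 2) : ℝ)) ?_ ?_
      (integrableOn_rpow_mul_min hC₁ hC₂ (by norm_num) (by norm_num)) ?_
    · filter_upwards [self_mem_nhdsWithin] with v hv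
      have h1 := hkc v.im (ne_of_lt hv) 1
      simp only [one_mul] at h1
      exact Continuous.aestronglyMeasurable ((hcont.comp (by fun_prop)).mul h1)
    · filter_upwards [hnear] with v hv
      refine (ae_restrict_iff' measurableSet_Ioi).2 (Eventually.of_forall fun r hr => ?_)
      have hr : 0 < r := hr
      have h1 := norm_kern_le_abs (e := v.im) hr.ne'
      rw [abs_of_pos hr] at h1
      rw [norm_mul, extendZero_of_pos (by linarith)]
      gcongr
      exact hb _ r hr (by linarith)
    · refine (ae_restrict_iff' measurableSet_Ioi).2 (Eventually.of_forall fun r hr => ?_)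
      have h1 := (continuous_kern_im hr (e := -y)).tendsto
      simp only [ofReal_im, ofReal_zero, mul_zero] at h1
      exact (hre r).mul (h1.mono_left nhdsWithin_le_nhds)
  -- The part before the singular point lives on `(0, y)` in the limit and is evaluated by
  -- inversion.
  have hlim2 : Tendsto (fun v : ℂ => ∫ r in Ioi (0 : ℝ),
      extendZero F (-r - v.re) * kern (1 / 2) (I * v.im) (-r)) (𝓝[{v | v.im < 0}] ((-y : ℝ) : ℂ))
      (𝓝 (I * (-((y ^ (-(3 / 2) : ℝ) : ℝ) : ℂ) * halfInt H y⁻¹))) := by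
    have h0 : I * (-((y ^ (-(3 / 2) : ℝ) : ℝ) : ℂ) * halfInt H y⁻¹)
        = ∫ r in Ioi (0 : ℝ), extendZero F (-r + y) * (I * ((r ^ (-(1 / 2) : ℝ) : ℝ) : ℂ)) := by
      rw [← hF.integral_Ioo_eq hH hFH hy, ← integral_const_mul,
        setIntegral_eq_of_subset_of_forall_sdiff_eq_zero
          (f := fun r : ℝ => extendZero F (-r + y) * (I * ((r ^ (-(1 / 2) : ℝ) : ℝ) : ℂ)))
          measurableSet_Ioi
          (Ioo_subset_Ioi_self : Ioo 0 y ⊆ Ioi 0)]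
      · refine setIntegral_congr_fun measurableSet_Ioo fun r hr => ?_
        have h1 := hr.2
        rw [extendZero_of_pos (by linarith), neg_add_eq_sub]
        ring
      · intro r hr
        have h1 : y ≤ r := by
          by_contra h
          exact hr.2 ⟨hr.1, not_le.1 h⟩
        rw [extendZero_of_nonpos (by linarith), zero_mul]
    rw [h0]
    -- For `v` near `-y` the extension vanishes once `r > 2y`, so an integrable bound on a bounded
    -- interval is enough.
    have hK : IntegrableOn (fun r : ℝ => (Ioc 0 (2 * y)).indicator
        (fun r => C₁ * r ^ (-(1 / 2) : ℝ)) r) (Ioi 0) := by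
      have h1 := (intervalIntegral.intervalIntegrable_rpow' (a := 0) (b := 2 * y)
        (r := -(1 / 2)) (by norm_num)).const_mul C₁
      rw [intervalIntegrable_iff_integrableOn_Ioc_of_le (by linarith)] at h1
      exact ((integrable_indicator_iff measurableSet_Ioc).2 h1).integrableOn
    refine tendsto_integral_filter_of_dominated_convergence _ ?_ ?_ hK ?_
    · filter_upwards [self_mem_nhdsWithin] with v hv
      have h1 := hkc v.im (ne_of_lt hv) (-1)
      simp only [neg_one_mul] at h1
      exact Continuous.aestronglyMeasurable ((hcont.comp (by fun_prop)).mul h1)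
    · filter_upwards [hnear] with v hv
      refine (ae_restrict_iff' measurableSet_Ioi).2 (Eventually.of_forall fun r hr => ?_)
      have hr : 0 < r := hr
      rcases le_or_gt (-r - v.re) 0 with h | h
      · rw [extendZero_of_nonpos h, zero_mul, norm_zero]
        exact indicator_nonneg (fun r hr => by
          have := hr.1
          positivity) r
      · have h1 := norm_kern_le_abs (e := v.im) (neg_ne_zero.2 hr.ne')
        rw [abs_neg, abs_of_pos hr] at h1
        rw [norm_mul, extendZero_of_pos h, indicator_of_mem (show r ∈ Ioc 0 (2 * y) from
          ⟨hr, by linarith [hv.2]⟩)]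
        gcongr
        exact (hb _ _ h le_rfl).trans (min_le_left _ _)
    · refine (ae_restrict_iff' measurableSet_Ioi).2 (Eventually.of_forall fun r hr => ?_)
      exact (hre (-r)).mul (tendsto_kern_neg hr (-y))
  have h := (hlim1.add hlim2).const_mul 2
  refine (h.congr' ?_).trans_eq ?_
  · filter_upwards [self_mem_nhdsWithin] with v hv
    have hv : v.im < 0 := hv
    rw [← hF.stieltjes_eq_add hv.ne, hF.stieltjes_succ 0 (by norm_num) (Or.inr hv.ne)]
    norm_num
    ring
  · congr 1
    ring

end RapidSeq

/-! ### A uniqueness lemma -/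

/-- The square of half-side `r` about `c = iy - r` has its right edge on the imaginary axis and
stays in the upper half-plane as `r < y`. The product of `E` over the four quarter-turns about `c`
vanishes on all edges, hence by the maximum principle at the centre, where it is `E(c)⁴`. -/
lemma eq_zero_near_boundary {E : ℂ → ℂ} (hc : ContinuousOn E {w | w.re ≤ 0 ∧ 0 < w.im})
    (hd : DifferentiableOn ℂ E {w | w.re < 0 ∧ 0 < w.im})
    (h0 : ∀ w : ℂ, w.re = 0 → 0 < w.im → E w = 0) {r y : ℝ} (hr : 0 < r) (hy : r < y) :
    E (y * I - r) = 0 := by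
  set c : ℂ := y * I - r with hcdef
  have hcre : c.re = -r := by simp [hcdef]
  have hcim : c.im = y := by simp [hcdef]
  set U : Set ℂ := {ζ | |ζ.re| < r ∧ |ζ.im| < r} with hU
  have hUo : IsOpen U := (isOpen_lt continuous_re.abs continuous_const).inter
    (isOpen_lt continuous_im.abs continuous_const)
  set K : Set ℂ := {ζ | |ζ.re| ≤ r ∧ |ζ.im| ≤ r} with hK
  have hKc : IsClosed K := (isClosed_le continuous_re.abs continuous_const).inter
    (isClosed_le continuous_im.abs continuous_const)
  have hUK : closure U ⊆ K := closure_minimal (fun ζ hζ => ⟨hζ.1.le, hζ.2.le⟩) hKc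
  have hUb : Bornology.IsBounded U := by
    refine (Metric.isBounded_closedBall (x := (0 : ℂ)) (r := r + r)).subset fun ζ hζ => ?_
    rw [mem_closedBall_zero_iff]
    exact (norm_le_abs_re_add_abs_im ζ).trans (add_le_add hζ.1.le hζ.2.le)
  have hrot : ∀ σ ∈ ({1, I, -1, -I} : Set ℂ), (∀ ζ ∈ K, σ * ζ ∈ K) ∧ ∀ ζ ∈ U, σ * ζ ∈ U := by
    rintro σ (rfl | rfl | rfl | rfl) <;>
      exact ⟨fun ζ hζ => by simpa [hK, and_comm] using hζ, fun ζ hζ => by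
        simpa [hU, and_comm] using hζ⟩
  have hcont : ∀ σ ∈ ({1, I, -1, -I} : Set ℂ), ContinuousOn (fun ζ => E (c + σ * ζ)) K := by
    intro σ hσ
    refine hc.comp (by fun_prop) fun ζ hζ => ?_
    have h1 := (hrot σ hσ).1 ζ hζ
    refine ⟨?_, ?_⟩
    · rw [add_re, hcre]
      linarith [(abs_le.1 h1.1).2]
    · rw [add_im, hcim]
      linarith [(abs_le.1 h1.2).1]
  have hdiff : ∀ σ ∈ ({1, I, -1, -I} : Set ℂ), DifferentiableOn ℂ (fun ζ => E (c + σ * ζ)) U := by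
    intro σ hσ
    refine hd.comp (by fun_prop) fun ζ hζ => ?_
    have h1 := (hrot σ hσ).2 ζ hζ
    refine ⟨?_, ?_⟩
    · rw [add_re, hcre]
      linarith [(abs_lt.1 h1.1).2]
    · rw [add_im, hcim]
      linarith [(abs_lt.1 h1.2).1]
  have hP : DiffContOnCl ℂ (fun ζ => E (c + 1 * ζ) * E (c + I * ζ) * E (c + -1 * ζ) * E (c + -I * ζ)) U :=
    ⟨(((hdiff 1 (by simp)).mul (hdiff I (by simp))).mul (hdiff (-1) (by simp))).mul
      (hdiff (-I) (by simp)), ((((hcont 1 (by simp)).mul (hcont I (by simp))).mul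
      (hcont (-1) (by simp))).mul (hcont (-I) (by simp))).mono hUK⟩
  have hzero : ∀ σ ∈ ({1, I, -1, -I} : Set ℂ), ∀ ζ ∈ K, (σ * ζ).re = r → E (c + σ * ζ) = 0 := by
    intro σ hσ ζ hζ h
    have h1 := (hrot σ hσ).1 ζ hζ
    refine h0 _ ?_ ?_
    · rw [add_re, hcre, h, neg_add_cancel]
    · rw [add_im, hcim]
      linarith [(abs_le.1 h1.2).1]
  have hmem : (0 : ℂ) ∈ U := by simp [hU, hr]
  have key := Complex.norm_le_of_forall_mem_frontier_norm_le hUb hP (C := 0) (fun ζ hζ => ?_)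
    (subset_closure hmem)
  · have h1 := norm_le_zero_iff.1 key
    simpa using h1
  · rw [hUo.frontier_eq] at hζ
    have hζK := hUK hζ.1
    rw [norm_le_zero_iff]
    rcases hζK.1.lt_or_eq with h1 | h1
    · rcases hζK.2.lt_or_eq with h2 | h2
      · exact absurd ⟨h1, h2⟩ hζ.2
      · rcases eq_or_eq_neg_of_abs_eq h2 with h3 | h3
        · rw [hzero (-I) (by simp) ζ hζK (by simpa using h3), mul_zero]
        · rw [hzero I (by simp) ζ hζK (by simp [h3]), mul_zero, zero_mul, zero_mul]
    · rcases eq_or_eq_neg_of_abs_eq h1 with h3 | h3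
      · rw [hzero 1 (by simp) ζ hζK (by simpa using h3), zero_mul, zero_mul, zero_mul]
      · rw [hzero (-1) (by simp) ζ hζK (by simp [h3]), mul_zero, zero_mul]

/-- A holomorphic function on the open second quadrant that tends to zero at the positive imaginary
axis vanishes. -/
lemma eq_zero_of_boundary {E : ℂ → ℂ} (hc : ContinuousOn E {w | w.re ≤ 0 ∧ 0 < w.im})
    (hd : DifferentiableOn ℂ E {w | w.re < 0 ∧ 0 < w.im})
    (h0 : ∀ w : ℂ, w.re = 0 → 0 < w.im → E w = 0) {w : ℂ} (hw : w.re < 0) (hw' : 0 < w.im) :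
    E w = 0 := by
  have ho : IsOpen {w : ℂ | w.re < 0 ∧ 0 < w.im} := (isOpen_lt continuous_re continuous_const).inter
    (isOpen_lt continuous_const continuous_im)
  have hconv : Convex ℝ {w : ℂ | w.re < 0 ∧ 0 < w.im} :=
    (convex_halfSpace_re_lt 0).inter (convex_halfSpace_im_gt 0)
  refine (hd.analyticOnNhd ho).eqOn_zero_of_preconnected_of_eventuallyEq_zero
    hconv.isPreconnected (z₀ := 2 * I - 1) (by simp) ?_ ⟨hw, hw'⟩
  -- The points covered by the square argument form an open set; the identity theorem extends the
  -- vanishing to the quadrant.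
  have hV : IsOpen {w : ℂ | w.re < 0 ∧ -w.re < w.im} :=
    (isOpen_lt continuous_re continuous_const).inter (isOpen_lt continuous_re.neg continuous_im)
  filter_upwards [hV.mem_nhds (show (2 * I - 1 : ℂ) ∈ {w : ℂ | w.re < 0 ∧ -w.re < w.im} by
    simp)] with u hu
  have h1 := eq_zero_near_boundary hc hd h0 (neg_pos.2 hu.1) hu.2
  have h2 : (u.im : ℂ) * I - ((-u.re : ℝ) : ℂ) = u := by
    push_cast
    linear_combination re_add_im u
  rwa [h2] at h1

/-! ### The `S`-transformation on the upper half-plane -/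

lemma RapidSeq.sum {ι : Type*} {s : Finset ι} {F : ι → ℕ → ℝ → ℂ} (hF : ∀ l ∈ s, RapidSeq (F l))
    (c : ι → ℂ) : RapidSeq fun m t => ∑ l ∈ s, c l * F l m t where
  deriv m t ht := HasDerivAt.fun_sum fun l hl => ((hF l hl).deriv m t ht).const_mul (c l)
  bound m a := by
    choose! C hC h using fun l hl => (hF l hl).bound m a
    refine ⟨∑ l ∈ s, ‖c l‖ * C l, Finset.sum_nonneg fun l hl =>
      mul_nonneg (norm_nonneg _) (hC l hl), fun t ht => ?_⟩
    rw [Finset.sum_mul]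
    refine (norm_sum_le _ _).trans (Finset.sum_le_sum fun l hl => ?_)
    rw [norm_mul, mul_assoc]
    exact mul_le_mul_of_nonneg_left (h l hl t ht) (norm_nonneg _)

lemma halfInt_sum {ι : Type*} {s : Finset ι} {F : ι → ℕ → ℝ → ℂ} (hF : ∀ l ∈ s, RapidSeq (F l))
    (c : ι → ℂ) {y : ℝ} (hy : 0 ≤ y) :
    halfInt (fun m t => ∑ l ∈ s, c l * F l m t) y = ∑ l ∈ s, c l * halfInt (F l) y := by
  have hint : ∀ l ∈ s, IntegrableOn (fun u => F l 1 (y + u) * kern (1 / 2) 0 u) (Ioi 0) :=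
    fun l hl => ((hF l hl).integrableOn_shift 1 (e := -(1 / 2)) hy (by norm_num)
      (by norm_num)).congr_fun (fun u hu => by rw [kern_zero _ hu]) measurableSet_Ioi
  simp only [halfInt, ← integral_const_mul]
  rw [← integral_finsetSum _ fun l hl => (hint l hl).const_mul (c l)]
  congr 1
  funext u
  rw [Finset.sum_mul]
  exact Finset.sum_congr rfl fun l _ => by ring

/-- The base `-1/y` lies on the cut, where the principal argument is `π`; so the phase is `e^{3πi/2}
= -i`, as in the limit from the left. -/
lemma neg_real_cpow_three_halves {y : ℝ} (hy : 0 < y) :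
    (1 / ((y : ℂ) * I * I)) ^ (3 / 2 : ℂ) = -I * ((y ^ (-(3 / 2) : ℝ) : ℝ) : ℂ) := by
  have h1 : 1 / ((y : ℂ) * I * I) = ((-y⁻¹ : ℝ) : ℂ) := by
    have : (y : ℂ) ≠ 0 := ofReal_ne_zero.2 hy.ne'
    rw [mul_assoc, I_mul_I]
    push_cast
    field_simp
  have h2 : exp (π * I * (3 / 2)) = -I := by
    rw [show (π * I * (3 / 2) : ℂ) = π * I + π / 2 * I by ring, exp_add, exp_pi_mul_I,
      exp_pi_div_two_mul_I, neg_one_mul]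
  rw [h1, ofReal_cpow_of_nonpos (by rw [Left.neg_nonpos_iff]; positivity), h2, ofReal_neg, neg_neg,
    mul_comm, Real.rpow_neg hy.le, ← Real.inv_rpow hy.le, ofReal_cpow (by positivity)]
  norm_num

section Upper

variable {pp pm : ℕ}

/-- The vector of modified characters. -/
def chiVec (pp pm : ℕ) (w : ℂ) (k : kacTable pp pm) : ℂ := chiTilde pp pm k.1.1 k.1.2 w

lemma chiVec_eq_thetaSeries (hpp : 2 ≤ pp) (hpm : 2 ≤ pm) (k : kacTable pp pm) {z : ℂ}
    (hz : 0 < z.im) : chiVec pp pm z k = -(1 / (2 * pp * pm)) * thetaSeries (pp * pm)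
      (fun n => (thetaCoeff pp pm k n : ℂ) * ((|(n : ℝ)| : ℝ) : ℂ)) z := by
  rw [chiVec, ← neg_eq_iff_eq_neg.2 (hasSum_chiTilde hpp hpm k hz).tsum_eq, thetaSeries, neg_mul,
    ← tsum_mul_left]
  congr 1
  refine tsum_congr fun n => ?_
  ring

lemma differentiableAt_chiVec (hpp : 2 ≤ pp) (hpm : 2 ≤ pm) (k : kacTable pp pm) {z : ℂ}
    (hz : 0 < z.im) : DifferentiableAt ℂ (fun z => chiVec pp pm z k) z := by
  have h1 := (hasDerivAt_thetaSeries (N := pp * pm) (by positivity)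
    (a := fun n => (thetaCoeff pp pm k n : ℂ) * ((|(n : ℝ)| : ℝ) : ℂ)) (j := 1) (fun n => by
      have := abs_thetaCoeff_le pp pm k n
      rw [norm_mul, norm_real, norm_real, Real.norm_eq_abs, Real.norm_eq_abs, abs_abs, pow_one]
      exact mul_le_of_le_one_left (abs_nonneg _) this) hz).differentiableAt
  refine (h1.const_mul (-(1 / (2 * pp * pm)))).congr_of_eventuallyEq ?_
  filter_upwards [(isOpen_lt continuous_const continuous_im).mem_nhds hz] with w hw
  exact chiVec_eq_thetaSeries hpp hpm k hw

lemma chiVec_I (hpp : 2 ≤ pp) (hpm : 2 ≤ pm) (k : kacTable pp pm) {y : ℝ} (hy : 0 < y) :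
    chiVec pp pm (y * I) k = rayConst pp pm * (2 * halfInt (ray (cuspVec pp pm) 0 k) y) := by
  have h := chiTilde_ray hpp hpm 0 k hy
  rwa [Rat.cast_zero, zero_add] at h

/-- The boundary value of the error integral on the left of the positive imaginary axis. -/
lemma tendsto_errorG (hpp : 2 ≤ pp) (hpm : 2 ≤ pm)
    (hf : WeightHalf (cuspVec pp pm) (minimalS pp pm)) (k : kacTable pp pm) {y : ℝ} (hy : 0 < y) :
    Tendsto (fun w => errorG pp pm w k) (𝓝[{w | w.re < 0}] (y * I))
      (𝓝 (chiVec pp pm (y * I) k + (1 / ((y : ℂ) * I * I)) ^ (3 / 2 : ℂ)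
        * (minimalS pp pm *ᵥ chiVec pp pm (-1 / (y * I))) k)) := by
  have hF := hf.rapidSeq_ray 0 k
  have hFl := fun l => hf.rapidSeq_ray 0 l
  have hH : RapidSeq fun m t => ∑ l, minimalS pp pm k l * ray (cuspVec pp pm) 0 l m t :=
    RapidSeq.sum (fun l _ => hFl l) _
  -- On the imaginary axis the `S`-law of `f` is the inversion relation with `H = M F`.
  have hFH : ∀ t, 0 < t → ray (cuspVec pp pm) 0 k 0 t = ((t ^ (-(1 / 2) : ℝ) : ℝ) : ℂ)
      * ∑ l, minimalS pp pm k l * ray (cuspVec pp pm) 0 l 0 t⁻¹ := fun t ht => by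
    have h1 := congrFun (hf.trans_S (I * t) (by simpa using ht)) k
    have h2 : -I * (I * t) = (t : ℂ) := by linear_combination (-(t : ℂ)) * I_mul_I
    have h3 : -1 / (I * t) = I * ((t⁻¹ : ℝ) : ℂ) := by
      have : (t : ℂ) ≠ 0 := ofReal_ne_zero.2 ht.ne'
      push_cast
      field_simp
      rw [I_sq]
    rw [h2, h3, sqrt_eq_cpow ht.le] at h1
    simp only [ray_zero, Rat.cast_zero, zero_add]
    rw [h1, Pi.smul_apply, smul_eq_mul, Real.rpow_neg ht.le, ← Real.sqrt_eq_rpow, one_div,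
      ofReal_inv (√t)]
    rfl
  have h1 := hF.tendsto_stieltjes_cut hH hFH hy
  have h2 : Tendsto (fun w : ℂ => I * w) (𝓝[{w | w.re < 0}] (y * I))
      (𝓝[{v | v.im < 0}] ((-y : ℝ) : ℂ)) := by
    refine tendsto_nhdsWithin_iff.2 ⟨?_, ?_⟩
    · have : Continuous fun w : ℂ => I * w := by fun_prop
      have h3 := this.tendsto (y * I)
      rw [show I * (y * I) = ((-y : ℝ) : ℂ) by
        push_cast
        linear_combination (y : ℂ) * I_mul_I] at h3
      exact h3.mono_left nhdsWithin_le_nhds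
    · filter_upwards [self_mem_nhdsWithin] with w hw
      have hw : w.re < 0 := hw
      show (I * w).im < 0
      simpa using hw
  have h3 := (h1.comp h2).const_mul (rayConst pp pm)
  have h4 : -1 / ((y : ℂ) * I) = ((y⁻¹ : ℝ) : ℂ) * I := by
    have : (y : ℂ) ≠ 0 := ofReal_ne_zero.2 hy.ne'
    push_cast
    field_simp
    rw [I_sq]
  refine (h3.congr fun w => (errorG_eq hpp hpm w k).symm).trans_eq ?_
  rw [neg_real_cpow_three_halves hy, h4, chiVec_I hpp hpm k hy, halfInt_sum (fun l _ => hFl l) _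
    (inv_pos.2 hy).le]
  have h5 : (minimalS pp pm *ᵥ chiVec pp pm (((y⁻¹ : ℝ) : ℂ) * I)) k = rayConst pp pm
      * (2 * ∑ l, minimalS pp pm k l * halfInt (ray (cuspVec pp pm) 0 l) y⁻¹) := by
    rw [Finset.mul_sum, Finset.mul_sum]
    refine Finset.sum_congr rfl fun l _ => ?_
    rw [chiVec_I hpp hpm l (inv_pos.2 hy)]
    ring
  rw [h5]
  congr 1
  ring

/-- To the left of the imaginary axis the base of the power lies above the cut, so the principal
power is continuous up to the axis from this side. -/
lemma inv_mul_I_im {w : ℂ} (hw : w.re < 0) : 0 < (1 / (w * I)).im := by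
  have h0 : w * I ≠ 0 := fun h => by
    have := congrArg im h
    simp at this
    exact hw.ne this
  rw [one_div, inv_im]
  have h1 : (w * I).im = w.re := by simp
  rw [h1]
  exact div_pos (neg_pos.2 hw) (normSq_pos.2 h0)

lemma differentiableAt_errorG (hpp : 2 ≤ pp) (hpm : 2 ≤ pm)
    (hf : WeightHalf (cuspVec pp pm) (minimalS pp pm)) (k : kacTable pp pm) {w : ℂ}
    (hw : w.re ≠ 0) : DifferentiableAt ℂ (fun w => errorG pp pm w k) w := by
  have h1 := ((hf.rapidSeq_ray 0 k).rapid 0).hasDerivAt_stieltjes (s := 3 / 2) (by norm_num)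
    (v := I * w) (Or.inr (by simpa using hw))
  have h2 := (DifferentiableAt.comp w h1.differentiableAt
    (show DifferentiableAt ℂ (fun w : ℂ => I * w) w by fun_prop)).const_mul (rayConst pp pm)
  exact h2.congr_of_eventuallyEq (Eventually.of_forall fun w => errorG_eq hpp hpm w k)

/-- The `S`-transformation in the open second quadrant. -/
lemma chiVec_S_left (hpp : 2 ≤ pp) (hpm : 2 ≤ pm)
    (hf : WeightHalf (cuspVec pp pm) (minimalS pp pm)) (k : kacTable pp pm) {w : ℂ}
    (hw : w.re < 0) (hw' : 0 < w.im) :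
    errorG pp pm w k = chiVec pp pm w k + (1 / (w * I)) ^ (3 / 2 : ℂ)
        * (minimalS pp pm *ᵥ chiVec pp pm (-1 / w)) k := by
  set D : ℂ → ℂ := fun w => chiVec pp pm w k + (1 / (w * I)) ^ (3 / 2 : ℂ)
        * (minimalS pp pm *ᵥ chiVec pp pm (-1 / w)) k - errorG pp pm w k with hD
  have hne : ∀ w : ℂ, 0 < w.im → w ≠ 0 := fun w hw h => by simp [h] at hw
  have hsum : ∀ w : ℂ, 0 < w.im → DifferentiableAt ℂ
      (fun w => (minimalS pp pm *ᵥ chiVec pp pm (-1 / w)) k) w := fun w hw => by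
    refine DifferentiableAt.fun_sum fun l _ => DifferentiableAt.const_mul ?_ _
    exact DifferentiableAt.comp w (differentiableAt_chiVec hpp hpm l (neg_one_div_im_pos hw))
      (by have := hne w hw; fun_prop (disch := assumption))
  have hinv : ∀ w : ℂ, 0 < w.im → DifferentiableAt ℂ (fun w : ℂ => 1 / (w * I)) w := fun w hw => by
    have := mul_ne_zero (hne w hw) I_ne_zero
    fun_prop (disch := assumption)
  have hDd : ∀ w : ℂ, w.re < 0 → 0 < w.im → DifferentiableAt ℂ D w := fun w h h' => by
    refine ((differentiableAt_chiVec hpp hpm k h').add (DifferentiableAt.mul ?_ (hsum w h'))).sub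
      (differentiableAt_errorG hpp hpm hf k h.ne)
    exact (hinv w h').cpow_const (Or.inr (inv_mul_I_im h).ne')
  -- `D` is replaced by zero on the axis; that the result is continuous there is the content of
  -- `tendsto_errorG`.
  set E : ℂ → ℂ := fun w => if w.re < 0 then D w else 0 with hE
  have hEeq : ∀ w : ℂ, w.re < 0 → E =ᶠ[𝓝 w] D := fun w h => by
    filter_upwards [(isOpen_lt continuous_re continuous_const).mem_nhds h] with u hu
    exact if_pos hu
  have hdE : ∀ w : ℂ, w.re < 0 → 0 < w.im → DifferentiableAt ℂ E w := fun w h h' =>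
    (hDd w h h').congr_of_eventuallyEq (hEeq w h)
  have hcE : ContinuousOn E {w | w.re ≤ 0 ∧ 0 < w.im} := by
    rintro w ⟨h, h'⟩
    rcases h.lt_or_eq with h | h
    · exact (hdE w h h').continuousAt.continuousWithinAt
    · have hwy : w = w.im * I := by
        conv_lhs => rw [← re_add_im w, h, ofReal_zero, zero_add]
      have hE0 : E w = 0 := if_neg (by rw [h]; exact lt_irrefl 0)
      have hDlim : Tendsto D (𝓝[{w | w.re < 0}] w) (𝓝 0) := by
        have h1 := tendsto_errorG hpp hpm hf k h'
        rw [← hwy] at h1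
        have h2 : Tendsto (fun w : ℂ => (1 / (w * I)) ^ (3 / 2 : ℂ)) (𝓝[{w | w.re < 0}] w)
            (𝓝 ((1 / (w * I)) ^ (3 / 2 : ℂ))) :=
          ContinuousWithinAt.comp (g := fun z : ℂ => z ^ (3 / 2 : ℂ)) (t := {z | 0 ≤ z.im})
            (f := fun w : ℂ => 1 / (w * I)) (continuousWithinAt_cpow_const_of_im_nonneg
              (one_div_ne_zero (mul_ne_zero (hne w h') I_ne_zero)) _)
            (hinv w h').continuousAt.continuousWithinAt fun u hu => (inv_mul_I_im hu).le
        have h3 := ((((differentiableAt_chiVec hpp hpm k h').continuousAt.tendsto.mono_left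
          nhdsWithin_le_nhds).add (h2.mul ((hsum w h').continuousAt.tendsto.mono_left
          nhdsWithin_le_nhds))).sub h1)
        rwa [sub_self] at h3
      rw [ContinuousWithinAt, hE0]
      rw [Metric.tendsto_nhdsWithin_nhds] at hDlim ⊢
      intro ε hε
      obtain ⟨δ, hδ, hb⟩ := hDlim ε hε
      refine ⟨δ, hδ, fun u _ hu => ?_⟩
      by_cases hur : u.re < 0
      · rw [show E u = D u from if_pos hur]
        exact hb hur hu
      · rw [show E u = 0 from if_neg hur, dist_self]
        exact hε
  have h1 := eq_zero_of_boundary hcE (fun w h => (hdE w h.1 h.2).differentiableWithinAt)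
    (fun w h _ => if_neg (by rw [h]; exact lt_irrefl 0)) hw hw'
  rw [show E w = D w from if_pos hw] at h1
  exact (sub_eq_zero.1 h1).symm

end Upper

/-! ### Complex conjugation -/

open scoped ComplexConjugate

lemma qPow_neg_conj (z : ℂ) (x : ℝ) : qPow (-conj z) x = conj (qPow z x) := by
  have h2 : conj (2 : ℂ) = 2 := map_ofNat _ 2
  rw [qPow, qPow, ← exp_conj]
  congr 1
  simp [h2]

lemma thetaSeries_neg_conj (N : ℝ) {a : ℤ → ℂ} (ha : ∀ n, conj (a n) = a n) (z : ℂ) :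
    thetaSeries N a (-conj z) = conj (thetaSeries N a z) := by
  rw [thetaSeries, thetaSeries, conj_tsum]
  refine tsum_congr fun n => ?_
  rw [map_mul, ha, qPow_neg_conj]

lemma kern_conj (s : ℝ) {v : ℂ} (hv : Good v) {t : ℝ} (ht : 0 < t) :
    kern s (conj v) t = conj (kern s v t) := by
  have h1 := slitPlane_arg_ne_pi (hv.mem_slitPlane ht)
  have h2 : (t : ℂ) + conj v = conj ((t : ℂ) + v) := by simp
  rw [kern, kern, h2, conj_cpow _ _ h1, conj_ofReal]

section Conj

variable {pp pm : ℕ}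

lemma cuspVec_neg_conj (hpp : 2 ≤ pp) (hpm : 2 ≤ pm) (k : kacTable pp pm) {z : ℂ} (hz : 0 < z.im) :
    cuspVec pp pm (-conj z) k = conj (cuspVec pp pm z k) := by
  rw [cuspVec_eq_thetaSeries hpp hpm k hz, cuspVec_eq_thetaSeries hpp hpm k (by simpa using hz),
    thetaSeries_neg_conj _ fun n => conj_ofReal _]

lemma chiVec_neg_conj (hpp : 2 ≤ pp) (hpm : 2 ≤ pm) (k : kacTable pp pm) {z : ℂ} (hz : 0 < z.im) :
    chiVec pp pm (-conj z) k = conj (chiVec pp pm z k) := by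
  rw [chiVec_eq_thetaSeries hpp hpm k hz, chiVec_eq_thetaSeries hpp hpm k (by simpa using hz),
    thetaSeries_neg_conj _ fun n => by rw [map_mul, conj_ofReal, conj_ofReal]]
  have h2 : conj (2 : ℂ) = 2 := map_ofNat _ 2
  simp [h2]

/-- The reflection `z ↦ -z̄` fixes the imaginary axis, so `f` is real on the path of integration and
only the kernel is conjugated. -/
lemma errorG_neg_conj (hpp : 2 ≤ pp) (hpm : 2 ≤ pm) (k : kacTable pp pm) {w : ℂ}
    (hw : w.re ≠ 0) : errorG pp pm (-conj w) k = conj (errorG pp pm w k) := by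
  have hgood : Good (I * w) := Or.inr (by simpa using hw)
  have h1 : I * (-conj w) = conj (I * w) := by simp
  rw [errorG_eq hpp hpm, errorG_eq hpp hpm, h1, map_mul conj (rayConst pp pm), rayConst, conj_ofReal,
    stieltjes, stieltjes,
    ← integral_conj]
  congr 1
  refine setIntegral_congr_fun measurableSet_Ioi fun t ht => ?_
  have ht : 0 < t := ht
  have h2 := cuspVec_neg_conj hpp hpm k (z := I * t) (by simpa using ht)
  have h3 : -conj (I * t) = I * t := by simp
  rw [h3] at h2
  simp only [ray_zero, Rat.cast_zero, zero_add]
  rw [kern_conj _ hgood ht, map_mul conj (cuspVec pp pm (I * t) k), ← h2]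

/-- The `S`-transformation in the upper half-plane off the imaginary axis. -/
lemma chiVec_S (hpp : 2 ≤ pp) (hpm : 2 ≤ pm)
    (hf : WeightHalf (cuspVec pp pm) (minimalS pp pm)) {w : ℂ} (hw : w.re ≠ 0) (hw' : 0 < w.im) :
    errorG pp pm w = chiVec pp pm w + (1 / (w * I)) ^ (3 / 2 : ℂ)
        • (minimalS pp pm *ᵥ chiVec pp pm (-1 / w)) := by
  funext k
  rcases lt_or_gt_of_ne hw with h | h
  · exact chiVec_S_left hpp hpm hf k h hw'
  · have hre : (-conj w).re < 0 := by simpa using h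
    have him : 0 < (-conj w).im := by simpa using hw'
    have h1 := chiVec_S_left hpp hpm hf k hre him
    have h2 : (1 / (-conj w * I)) = conj (1 / (w * I)) := by
      rw [map_div₀, map_mul, conj_I, map_one]
      ring
    have h3 : (1 / (w * I)).arg ≠ π := by
      refine slitPlane_arg_ne_pi (Or.inr fun h4 => ?_)
      have h5 := inv_mul_I_im hre
      rw [h2, conj_im, h4, neg_zero] at h5
      exact lt_irrefl _ h5
    have h4 : (1 / (-conj w * I)) ^ (3 / 2 : ℂ) = conj ((1 / (w * I)) ^ (3 / 2 : ℂ)) := by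
      rw [h2, conj_cpow _ _ h3, map_div₀, map_ofNat, map_ofNat]
    have h5 : (minimalS pp pm *ᵥ chiVec pp pm (-1 / -conj w)) k
        = conj ((minimalS pp pm *ᵥ chiVec pp pm (-1 / w)) k) := by
      have h6 : -1 / -conj w = -conj (-1 / w) := by simp [neg_div]
      simp only [Matrix.mulVec, dotProduct, map_sum, map_mul]
      refine Finset.sum_congr rfl fun l _ => ?_
      rw [h6, chiVec_neg_conj hpp hpm l (neg_one_div_im_pos hw'), minimalS, conj_ofReal]
    rw [errorG_neg_conj hpp hpm k hw, chiVec_neg_conj hpp hpm k hw', h4, h5, ← map_mul,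
      ← map_add] at h1
    exact (starRingEnd ℂ).injective h1

end Conj

/-! ### The function `G` -/

section Main

variable {pp pm : ℕ}

open Classical in
/-- The function `G` on the two half-planes and the rational points. -/
def quantumG (pp pm : ℕ) (w : ℂ) : kacTable pp pm → ℂ :=
  if 0 < w.im then chiVec pp pm w else if w.im < 0 then eichlerG pp pm w
  else if h : ∃ x : ℚ, w = x then rayConst pp pm • eichlerRat (cuspVec pp pm) h.choose else 0

lemma quantumG_of_pos {w : ℂ} (hw : 0 < w.im) : quantumG pp pm w = chiVec pp pm w := if_pos hw

lemma quantumG_of_neg {w : ℂ} (hw : w.im < 0) : quantumG pp pm w = eichlerG pp pm w := by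
  rw [quantumG, if_neg (not_lt.2 hw.le), if_pos hw]

lemma quantumG_rat (x : ℚ) :
    quantumG pp pm x = rayConst pp pm • eichlerRat (cuspVec pp pm) x := by
  have h : ∃ y : ℚ, (x : ℂ) = y := ⟨x, rfl⟩
  rw [quantumG, if_neg (by simp), if_neg (by simp), dif_pos h]
  have h1 : (x : ℂ) = h.choose := h.choose_spec
  rw [← Rat.cast_injective h1]

lemma eichlerG_eq (hpp : 2 ≤ pp) (hpm : 2 ≤ pm) (w : ℂ) :
    eichlerG pp pm w = rayConst pp pm • eichlerLower (cuspVec pp pm) w := by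
  funext k
  have h1 : ∫ t in Ioi (0 : ℝ), eichlerIntegrand pp pm w k t
      = eichlerPrim (cuspVec pp pm) w (conj w) k := by
    rw [eichlerPrim, upInt]
    congr 1
    funext t
    rw [eichlerIntegrand]
    ring
  have h2 := eichlerConst_mul hpp hpm
  rw [eichlerG, h1, Pi.smul_apply, eichlerLower, Pi.smul_apply, smul_eq_mul, smul_eq_mul, ← mul_assoc,
    ← mul_div_assoc, ← h2, mul_div_cancel_right₀ _ I_ne_zero]

lemma integrableOn_eichlerIntegrand (hf : WeightHalf (cuspVec pp pm) (minimalS pp pm)) {w : ℂ}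
    (hw : w.im < 0) (k : kacTable pp pm) : IntegrableOn (eichlerIntegrand pp pm w k) (Ioi 0) := by
  obtain ⟨κ, hκ⟩ := hf.exists_decayUpper
  refine ((hκ w hw k).integrableOn (z := conj w) (by simpa using hw)).congr_fun (fun t _ => ?_)
    measurableSet_Ioi
  rw [eichlerIntegrand]
  ring

lemma agreeToAllOrders_quantumG (hpp : 2 ≤ pp) (hpm : 2 ≤ pm)
    (hf : WeightHalf (cuspVec pp pm) (minimalS pp pm)) (x : ℚ) :
    AgreeToAllOrders (quantumG pp pm) x := by
  have hF := fun k => hf.rapidSeq_ray x k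
  refine ⟨fun m k => rayConst pp pm * RapidSeq.coeff (ray (cuspVec pp pm) x k) m, ?_, fun n => ⟨?_, ?_⟩⟩
  · rw [ofReal_ratCast, quantumG_rat]
    funext k
    show rayConst pp pm * RapidSeq.coeff (ray (cuspVec pp pm) x k) 0 = _
    rw [(hF k).coeff_zero, Pi.smul_apply, eichlerRat, eichlerAt, sub_self, mul_zero, smul_eq_mul]
  · refine Asymptotics.isBigO_pi.2 fun k => ?_
    refine (((hF k).expansion_pos n).const_mul_left (rayConst pp pm)).congr' ?_ EventuallyEq.rfl
    filter_upwards [self_mem_nhdsWithin] with t ht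
    have ht : 0 < t := ht
    rw [quantumG_of_pos (by simpa using ht)]
    simp only [Pi.sub_apply, Finset.sum_apply, Pi.smul_apply, smul_eq_mul]
    rw [chiVec, ofReal_ratCast, chiTilde_ray hpp hpm x k ht, mul_sub, Finset.mul_sum]
    congr 1
    exact Finset.sum_congr rfl fun m _ => by ring
  · refine Asymptotics.isBigO_pi.2 fun k => ?_
    refine (((hF k).expansion_neg n).const_mul_left (rayConst pp pm)).congr' ?_ EventuallyEq.rfl
    filter_upwards [self_mem_nhdsWithin] with t ht
    have ht : 0 < t := ht
    rw [quantumG_of_neg (by simpa using ht)]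
    simp only [Pi.sub_apply, Finset.sum_apply, Pi.smul_apply, smul_eq_mul]
    rw [ofReal_ratCast, eichlerG_ray hpp hpm x k ht, mul_sub, Finset.mul_sum]
    congr 1
    exact Finset.sum_congr rfl fun m _ => by ring

lemma isQuantumModular_quantumG (hf : WeightHalf (cuspVec pp pm) (minimalS pp pm)) :
    IsQuantumModular (3 / 2) hf.multiplier fun x : ℚ => quantumG pp pm x := by
  refine ⟨hf.isMultiplierSystem, fun γ => ⟨fun y => rayConst pp pm • eichlerPeriod _ γ y,
    (hf.contDiff_eichlerPeriod γ).const_smul _, fun y hy =>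
      (analyticAt_const (v := rayConst pp pm)).smul (hf.analyticOnNhd_eichlerPeriod γ y hy), fun x hx => ?_⟩⟩
  have h := hf.eichlerRat_sub γ x hx
  rw [WeightHalf.slash, Matrix.smul_mulVec] at h
  simp only
  rw [ofReal_ratCast, ← h, quantumG_rat, quantumG_rat, smul_sub, Matrix.mulVec_smul,
    smul_comm (rayConst pp pm)]

lemma eichlerPeriod_S {ι : Type*} (f : ℂ → ι → ℂ) (w : ℂ) :
    eichlerPeriod f ModularGroup.S w = eichlerAt f 0 w := by
  rw [eichlerPeriod, if_neg (by simp [ModularGroup.S])]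
  congr 1
  simp [ModularGroup.S]

/-- The `S`-transformation on the lower half-plane and at the nonzero rational points. -/
lemma quantumG_S (hpp : 2 ≤ pp) (hpm : 2 ≤ pm)
    (hf : WeightHalf (cuspVec pp pm) (minimalS pp pm)) {w : ℂ} (hw : w.im < 0 ∨ ∃ x : ℚ, w = x)
    (hw0 : w ≠ 0) : errorG pp pm w = quantumG pp pm w + (1 / (w * I)) ^ (3 / 2 : ℂ)
      • (minimalS pp pm *ᵥ quantumG pp pm (-1 / w)) := by
  -- The constant `e^{πi/4}` of `ρ(S)` cancels against the automorphy factor and leaves a minus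
  -- sign.
  have hM : ∀ v, hf.slash ModularGroup.S w *ᵥ v
      = -((1 / (w * I)) ^ (3 / 2 : ℂ) • (minimalS pp pm *ᵥ v)) := fun v => by
    have harg : (w * I).arg ≠ π := by
      intro h
      rw [arg_eq_pi_iff] at h
      rcases hw with hw | ⟨x, rfl⟩
      · have : (w * I).re = -w.im := by simp
        linarith [h.1]
      · simp at h
    have he := exp_ne_zero (π * I / 4)
    rw [WeightHalf.slash, autFactor_S, hf.multiplier_S, one_div, inv_cpow _ _ harg, mul_comm I w,
      smul_smul, Matrix.smul_mulVec, ← neg_smul]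
    congr 1
    rw [mul_inv, inv_neg, neg_mul, neg_mul, mul_right_comm, inv_mul_cancel₀ he, one_mul]
  have herr : errorG pp pm w = rayConst pp pm • eichlerAt (cuspVec pp pm) 0 w := by
    funext k
    rw [errorG_eq hpp hpm, Pi.smul_apply, smul_eq_mul, eichlerAt, Rat.cast_zero, sub_zero]
  rw [herr, ← eichlerPeriod_S]
  rcases hw with hw | ⟨x, rfl⟩
  · have him := mob_im_neg ModularGroup.S hw
    rw [mob_S] at him
    rw [← hf.eichlerLower_sub ModularGroup.S hw, hM, sub_neg_eq_add, quantumG_of_neg hw,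
      quantumG_of_neg him, eichlerG_eq hpp hpm, eichlerG_eq hpp hpm, mob_S, Matrix.mulVec_smul,
      smul_add, smul_comm (rayConst pp pm)]
  · have hx : ((ModularGroup.S : SL(2, ℤ)) 1 0 : ℚ) * x + (ModularGroup.S : SL(2, ℤ)) 1 1 ≠ 0 := by
      have : (x : ℚ) ≠ 0 := by exact_mod_cast hw0
      simpa [ModularGroup.S] using this
    have hm : -1 / (x : ℂ) = ((mob ModularGroup.S x : ℚ) : ℂ) := by rw [← mob_ratCast, mob_S]
    rw [← hf.eichlerRat_sub ModularGroup.S x hx, hM, sub_neg_eq_add, quantumG_rat, hm, quantumG_rat,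
      Matrix.mulVec_smul, smul_add, smul_comm (rayConst pp pm)]

end Main

end Singlet

end

open Singlet in
theorem mainTheorem11 (pp pm : ℕ) (hpp : 2 ≤ pp) (hpm : 2 ≤ pm) (hcop : Nat.Coprime pp pm) :
    -- the Eichler integrals and the error integrals converge
    (∀ (w : ℂ) (k : Singlet.kacTable pp pm), w.im < 0 →
      IntegrableOn (Singlet.eichlerIntegrand pp pm w k) (Ioi 0)) ∧
    (∀ (w : ℂ) (k : Singlet.kacTable pp pm), ¬ (w.re = 0 ∧ 0 ≤ w.im) →
      IntegrableOn (Singlet.errorIntegrand pp pm w k) (Ioi 0)) ∧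
    ∃ (G : ℂ → Singlet.kacTable pp pm → ℂ) (ρ : SL(2, ℤ) → GL (Singlet.kacTable pp pm) ℂ),
      -- `G` on the upper and on the lower half-plane, and at the rational points
      (∀ w : ℂ, 0 < w.im → ∀ k : Singlet.kacTable pp pm,
        G w k = Singlet.chiTilde pp pm k.1.1 k.1.2 w) ∧
      (∀ w : ℂ, w.im < 0 → G w = Singlet.eichlerG pp pm w) ∧
      (∀ x : ℚ, Singlet.AgreeToAllOrders G x) ∧
      -- quantum modularity of weight `3/2`, with the `S`-matrix of the minimal model
      Singlet.IsQuantumModular (3 / 2) ρ (fun x : ℚ => G x) ∧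
      (ρ ModularGroup.S : Matrix (Singlet.kacTable pp pm) (Singlet.kacTable pp pm) ℂ) =
        exp (π * I / 4) • Singlet.minimalS pp pm ∧
      -- the `S`-transformation, off the path of integration `i[0, ∞)`
      (∀ w : ℂ, (w.im ≠ 0 ∨ ∃ x : ℚ, w = x) → ¬ (w.re = 0 ∧ 0 ≤ w.im) →
        (1 / (w * I)) ^ (3 / 2 : ℂ) • G (-1 / w) + Singlet.minimalS pp pm *ᵥ G w =
          Singlet.minimalS pp pm *ᵥ Singlet.errorG pp pm w) ∧
      -- the `S`-transformation on `i(0, ∞)`, with `g` continued from the left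
      (∀ y : ℝ, 0 < y → ∃ L : Singlet.kacTable pp pm → ℂ,
        Tendsto (fun x : ℝ => Singlet.errorG pp pm (x + y * I)) (𝓝[<] 0) (𝓝 L) ∧
        (1 / (y * I * I)) ^ (3 / 2 : ℂ) • G (-1 / (y * I)) + Singlet.minimalS pp pm *ᵥ G (y * I) =
          Singlet.minimalS pp pm *ᵥ L) := by
  have hf := weightHalf_cuspVec hpp hpm hcop
  refine ⟨fun w k hw => integrableOn_eichlerIntegrand hf hw k,
    fun w k hw => integrableOn_errorIntegrand hf hw k,
    quantumG pp pm, hf.multiplier, fun w hw k => congrFun (quantumG_of_pos hw) k,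
    fun w hw => quantumG_of_neg hw, agreeToAllOrders_quantumG hpp hpm hf,
    isQuantumModular_quantumG hf, hf.multiplier_S, fun w hw hw0 => ?_, fun y hy => ?_⟩
  · have h : errorG pp pm w = quantumG pp pm w + (1 / (w * I)) ^ (3 / 2 : ℂ)
        • (minimalS pp pm *ᵥ quantumG pp pm (-1 / w)) := by
      have hne : w ≠ 0 := fun h => hw0 (by simp [h])
      rcases hw with hw | hw
      · rcases lt_or_gt_of_ne hw with hw | hw
        · exact quantumG_S hpp hpm hf (Or.inl hw) hne
        · have hre : w.re ≠ 0 := fun h => hw0 ⟨h, le_of_lt hw⟩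
          rw [quantumG_of_pos hw, quantumG_of_pos (neg_one_div_im_pos hw)]
          exact chiVec_S hpp hpm hf hre hw
      · exact quantumG_S hpp hpm hf (Or.inr hw) hne
    -- Multiplication by `M` with `M² = 1` removes the matrix from the term at `-1/w`.
    rw [h, Matrix.mulVec_add, Matrix.mulVec_smul, Matrix.mulVec_mulVec, hf.mul_self,
      Matrix.one_mulVec, add_comm]
  · have hyI : 0 < ((y : ℂ) * I).im := by simpa using hy
    -- The limit is the boundary value of `g` on the left side of its cut.
    refine ⟨fun k => chiVec pp pm (y * I) k + (1 / ((y : ℂ) * I * I)) ^ (3 / 2 : ℂ)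
      * (minimalS pp pm *ᵥ chiVec pp pm (-1 / (y * I))) k, tendsto_pi_nhds.2 fun k => ?_, ?_⟩
    · refine (tendsto_errorG hpp hpm hf k hy).comp (tendsto_nhdsWithin_iff.2 ⟨?_, ?_⟩)
      · have : Continuous fun x : ℝ => (x : ℂ) + y * I := by fun_prop
        have h1 := this.tendsto 0
        rw [ofReal_zero, zero_add] at h1
        exact h1.mono_left nhdsWithin_le_nhds
      · filter_upwards [self_mem_nhdsWithin] with x hx
        have hx : x < 0 := hx
        show ((x : ℂ) + y * I).re < 0
        simpa using hx
    · rw [quantumG_of_pos hyI, quantumG_of_pos (neg_one_div_im_pos hyI)]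
      show _ = minimalS pp pm *ᵥ (chiVec pp pm (y * I) + (1 / ((y : ℂ) * I * I)) ^ (3 / 2 : ℂ)
        • (minimalS pp pm *ᵥ chiVec pp pm (-1 / (y * I))))
      rw [Matrix.mulVec_add, Matrix.mulVec_smul, Matrix.mulVec_mulVec, hf.mul_self,
        Matrix.one_mulVec, add_comm]
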